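/- Let $(X,\mathcal A,m)$ be a $\sigma$-finite measure space; all functions are real-valued, and a quadratic form $Q$ with domain $D(Q)\subseteq L^2(X,m)$ is identified with the bilinear form obtained by polarization, $Q(f)=Q(f,f)$. A *Dirichlet form* on $L^2(X,m)$ is a densely defined, closed, nonnegative quadratic form $Q$ such that $f\in D(Q)$ implies $f_+\wedge 1\in D(Q)$ and $Q(f_+\wedge 1)\le Q(f)$. For a form $Q$ with associated nonnegative self-adjoint operator $L$ (that is, $f\in D(L)$ and $Lf=h$ if and only if $f\in D(Q)$ and $Q(f,g)=\langle h,g\rangle$ for all $g\in D(Q)$) let $(e^{-tL})_{t\ge0}$ be the strongly continuous semigroup on $L^2(X,m)$ with generator $-L$. For forms $Q,Q'$ with operators $L,L'$ write $Q\preceq Q'$ if $e^{-tL}f\le e^{-tL'}f$ for all $t\ge 0$ and all nonnegative $f\in L^2(X,m)$. Let $Q$ be a Dirichlet form. For $\varphi\in D(Q)$ with $0\le\varphi\le1$ let $Q_\varphi$ be the closure on $L^2(X,m)$ of the (closable) form $$f\mapsto Q(\varphi f)-Q(\varphi f^2,\varphi),\qquad f\in\{f\in L^2(X,m)\cap L^\infty(X,m)\mid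 \varphi f,\ \varphi f^2\in D(Q)\}.$$ The *active main part* $Q^{(M)}$ of $Q$ is the form whose domain consists of all $f\in L^2(X,m)$ such that $f\in D(Q_\varphi)$ for all $\varphi\in D(Q)$ with $0\le\varphi\le1$ and $\varphi\mapsto Q_\varphi(f)$ is bounded, and $$Q^{(M)}(f)=\sup\{Q_\varphi(f)\mid \varphi\in D(Q),\ 0\le\varphi\le1\}.$$ The *killing part* of $Q$ is $Q^{(k)}=Q-Q^{(M)}$ with domain $D(Q)$. **Theorem.** Let $Q,Q'$ be Dirichlet forms on $L^2(X,m)$ with $Q^{(k)}=0$. The following assertions are equivalent. (i) $Q\preceq Q'\preceq Q^{(M)}$. (ii) The following three conditions hold: - (a) $D(Q')\subseteq D(Q^{(M)})$ and $D(Q')$ is an order ideal in $D(Q^{(M)})$: if $f\in D(Q')$, $g\in D(Q^{(M)})$ and $|g|\le|f|$, then $g\in D(Q')$. - (b) $q=Q'-Q^{(M)}$ with domain $D(q)=D(Q')$ is a quadratic form that is positive ($q(f,g)\ge0$ for all nonnegative $f,g\in D(Q')$) and local ($q(f,g)=0$ for all $f,g\in D(Q')$ with $fg=0$). - (c) $Q'$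 is an extension of $Q$: $D(Q)\subseteq D(Q')$ and $Q'(f)=Q(f)$ for all $f\in D(Q)$. -/

import Mathlib

open MeasureTheory Filter Topology
open scoped NNReal ENNReal

/-- The real Hilbert space `L²(X, m)` of classes of square integrable functions. -/
abbrev L2Space {X : Type*} [MeasurableSpace X] (m : Measure X) : Type _ := Lp ℝ 2 m

/-- The class of a real function in `L²(X, m)`. It is only used for square integrable functions
(otherwise the value is `0`). -/
noncomputable def L2Space.ofFun {X : Type*} [MeasurableSpace X] (m : Measure X) (u : X → ℝ) :
    L2Space m :=
  open Classical in if h : MemLp u 2 m then h.toLp u else 0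

theorem L2Space.coeFn_ofFun {X : Type*} [MeasurableSpace X] {m : Measure X} {u : X → ℝ}
    (h : MemLp u 2 m) : (L2Space.ofFun m u : X → ℝ) =ᵐ[m] u := by
  rw [L2Space.ofFun, dif_pos h]
  exact h.coeFn_toLp

/-- `f₊ ∧ 1` is square integrable for every `f` in `L²`. -/
theorem L2Space.memLp_unitCut {X : Type*} [MeasurableSpace X] {m : Measure X} (f : L2Space m) :
    MemLp (fun x => min (max (f x) 0) 1) 2 m := by
  have hf : MemLp (f : X → ℝ) 2 m := Lp.memLp f
  refine hf.mono ?_ (Eventually.of_forall fun x => ?_)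
  · exact (hf.1.sup aestronglyMeasurable_const).inf aestronglyMeasurable_const
  · have h0 : 0 ≤ min (max (f x) 0) 1 := le_min (le_max_right _ _) zero_le_one
    rw [Real.norm_eq_abs, Real.norm_eq_abs, abs_of_nonneg h0]
    exact (min_le_left _ _).trans (max_le (le_abs_self _) (abs_nonneg _))

/-- `f₊ ∧ 1`, the unit contraction of `f`, as an element of `L²`. -/
noncomputable def L2Space.unitCut {X : Type*} [MeasurableSpace X] {m : Measure X} (f : L2Space m) :
    L2Space m :=
  (L2Space.memLp_unitCut f).toLp _

/-- The products `φ f` with `f` bounded are square integrable. -/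
theorem L2Space.memLp_mul {X : Type*} [MeasurableSpace X] {m : Measure X} (φ f : L2Space m)
    (hf : MemLp (f : X → ℝ) ∞ m) : MemLp (fun x => φ x * f x) 2 m := by
  have h : MemLp (fun x => f x * φ x) 2 m := (Lp.memLp φ).mul (p := ∞) (q := 2) (r := 2) hf
  exact h.congr_norm ((Lp.memLp φ).1.mul hf.1) (Eventually.of_forall fun x => by rw [mul_comm])

/-- The products `φ f²` with `f` bounded are square integrable. -/
theorem L2Space.memLp_mul_sq {X : Type*} [MeasurableSpace X] {m : Measure X} (φ f : L2Space m)
    (hf : MemLp (f : X → ℝ) ∞ m) : MemLp (fun x => φ x * f x ^ 2) 2 m := by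
  have h1 : MemLp (fun x => φ x * f x) 2 m := L2Space.memLp_mul φ f hf
  have h : MemLp (fun x => f x * (φ x * f x)) 2 m := h1.mul (p := ∞) (q := 2) (r := 2) hf
  exact h.congr_norm ((Lp.memLp φ).1.mul (hf.1.pow 2))
    (Eventually.of_forall fun x => by ring_nf)

/-- A partially defined real functional on `L²(X, m)`: a domain and the values on the domain.
The values of `val` outside `domain` carry no meaning and are never used. -/
structure L2Form {X : Type*} [MeasurableSpace X] (m : Measure X) where
  domain : Set (L2Space m)
  val : L2Space m → ℝ

namespace L2Form

variable {X : Type*} [MeasurableSpace X] {m : Measure X}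

/-- The form induced by polarization, `Q(f, g) = (Q(f + g) - Q(f - g)) / 4`. -/
noncomputable def bilin (Q : L2Form m) (f g : L2Space m) : ℝ :=
  (Q.val (f + g) - Q.val (f - g)) / 4

/-- `Q` is a quadratic form: its domain is a linear subspace, and on it the values are those of
a quadratic form. -/
def IsQuadratic (Q : L2Form m) : Prop :=
  ∃ (S : Submodule ℝ (L2Space m)) (q : QuadraticForm ℝ S),
    (S : Set (L2Space m)) = Q.domain ∧ ∀ f : S, Q.val f = q f

/-- `Q(f, g) ≥ 0` for all nonnegative `f, g` in the domain. -/
def IsPositive (Q : L2Form m) : Prop :=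
  ∀ f ∈ Q.domain, ∀ g ∈ Q.domain, 0 ≤ f → 0 ≤ g → 0 ≤ Q.bilin f g

/-- `f g = 0` almost everywhere implies `Q(f, g) = 0`, for all `f, g` in the domain. -/
def IsLocal (Q : L2Form m) : Prop :=
  ∀ f ∈ Q.domain, ∀ g ∈ Q.domain, (∀ᵐ x ∂m, f x * g x = 0) → Q.bilin f g = 0

/-- `Q'` is an extension of `Q`. -/
def IsExtension (Q' Q : L2Form m) : Prop :=
  Q.domain ⊆ Q'.domain ∧ ∀ f ∈ Q.domain, Q'.val f = Q.val f

/-- The difference `Q - Q'`, with the domain of `Q`. -/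
def diff (Q Q' : L2Form m) : L2Form m where
  domain := Q.domain
  val f := Q.val f - Q'.val f

/-- A sequence in the domain which is a Cauchy sequence with respect to `Q`. -/
def IsFormCauchy (Q : L2Form m) (u : ℕ → L2Space m) : Prop :=
  (∀ n, u n ∈ Q.domain) ∧
    Tendsto (fun p : ℕ × ℕ => Q.val (u p.1 - u p.2)) atTop (𝓝 0)

/-- Closedness: the domain is complete with respect to the form norm
`(Q(f) + ‖f‖²)^(1/2)`. -/
def IsClosedForm (Q : L2Form m) : Prop :=
  ∀ (u : ℕ → L2Space m) (f : L2Space m), Q.IsFormCauchy u → Tendsto u atTop (𝓝 f) →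
    f ∈ Q.domain ∧ Tendsto (fun n => Q.val (u n - f)) atTop (𝓝 0)

/-- The closure of a closable form. Its domain consists of the `L²`-limits `f` of sequences
`u` that are Cauchy with respect to `Q`, and its value at `f` is `lim Q(uₙ)`. For a
closable form this limit exists and does not depend on the choice of `u`, so that the set of
which the infimum is taken is a singleton. -/
noncomputable def closure (Q : L2Form m) : L2Form m where
  domain := {f | ∃ u, Q.IsFormCauchy u ∧ Tendsto u atTop (𝓝 f)}
  val f := sInf {a : ℝ | ∃ u, Q.IsFormCauchy u ∧ Tendsto u atTop (𝓝 f) ∧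
    Tendsto (fun n => Q.val (u n)) atTop (𝓝 a)}

/-- Dirichlet forms: densely defined, closed, nonnegative quadratic forms on `L²(X, m)` with
the Markov property. -/
structure IsDirichlet (Q : L2Form m) : Prop where
  isQuadratic : Q.IsQuadratic
  nonneg : ∀ f ∈ Q.domain, 0 ≤ Q.val f
  dense : Dense Q.domain
  isClosedForm : Q.IsClosedForm
  markov : ∀ f ∈ Q.domain, f.unitCut ∈ Q.domain ∧ Q.val f.unitCut ≤ Q.val f

/-- `h = L f` for the self-adjoint operator `L` associated with `Q`:
`f ∈ D(Q)` and `Q(f, g) = ⟨h, g⟩` for all `g ∈ D(Q)`. -/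
def OperatorGraph (Q : L2Form m) (f h : L2Space m) : Prop :=
  f ∈ Q.domain ∧ ∀ g ∈ Q.domain, Q.bilin f g = inner ℝ h g

/-- `T` is the semigroup `(e^{-tL})` of `Q`: the strongly continuous semigroup of bounded
operators on `L²(X, m)` whose infinitesimal generator is `-L` (with equality of the domains),
where `L` is the operator associated with `Q`. -/
structure IsSemigroup (Q : L2Form m) (T : ℝ≥0 → L2Space m →L[ℝ] L2Space m) : Prop where
  zero : T 0 = ContinuousLinearMap.id ℝ (L2Space m)
  add : ∀ s t, T (s + t) = (T s).comp (T t)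
  continuous : ∀ f, Continuous fun t => T t f
  generator : ∀ f h, Q.OperatorGraph f h ↔
    Tendsto (fun t : ℝ≥0 => (t : ℝ)⁻¹ • (T t f - f)) (𝓝[>] 0) (𝓝 (-h))

/-- Domination `Q ≼ Q'`: the semigroups of `Q` and `Q'` satisfy `e^{-tL} f ≤ e^{-tL'} f` for all
`t ≥ 0` and all nonnegative `f ∈ L²(X, m)`. -/
def Dominates (Q' Q : L2Form m) : Prop :=
  ∃ T T' : ℝ≥0 → L2Space m →L[ℝ] L2Space m, Q.IsSemigroup T ∧ Q'.IsSemigroup T' ∧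
    ∀ (t : ℝ≥0) (f : L2Space m), 0 ≤ f → T t f ≤ T' t f

/-- The functions `φ ∈ D(Q)` with `0 ≤ φ ≤ 1`. -/
def cutoffs (Q : L2Form m) : Set (L2Space m) :=
  {φ | φ ∈ Q.domain ∧ 0 ≤ φ ∧ ∀ᵐ x ∂m, φ x ≤ 1}

/-- The form `f ↦ Q(φ f) - Q(φ f², φ)` on
`{f ∈ L² ∩ L^∞ | φ f, φ f² ∈ D(Q)}`. -/
noncomputable def preCut (Q : L2Form m) (φ : L2Space m) : L2Form m where
  domain := {f | MemLp (f : X → ℝ) ∞ m ∧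
    L2Space.ofFun m (fun x => φ x * f x) ∈ Q.domain ∧
    L2Space.ofFun m (fun x => φ x * f x ^ 2) ∈ Q.domain}
  val f := Q.val (L2Space.ofFun m fun x => φ x * f x) -
    Q.bilin (L2Space.ofFun m fun x => φ x * f x ^ 2) φ

/-- The form `Q_φ`, the closure of `preCut Q φ`. -/
noncomputable def cut (Q : L2Form m) (φ : L2Space m) : L2Form m := (Q.preCut φ).closure

/-- The active main part `Q^(M)`: the supremum of the forms `Q_φ` over the
`φ ∈ D(Q)` with `0 ≤ φ ≤ 1`, on the functions for which it is finite. -/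
noncomputable def mainPart (Q : L2Form m) : L2Form m where
  domain := {f | (∀ φ ∈ Q.cutoffs, f ∈ (Q.cut φ).domain) ∧
    BddAbove ((fun φ => (Q.cut φ).val f) '' Q.cutoffs)}
  val f := sSup ((fun φ => (Q.cut φ).val f) '' Q.cutoffs)

/-- The killing part `Q^(k) = Q - Q^(M)`, with domain `D(Q)`. -/
noncomputable def killingPart (Q : L2Form m) : L2Form m := Q.diff Q.mainPart

end L2Form

/-- `U` is an order ideal in `V`: `f ∈ U`, `g ∈ V` and `|g| ≤ |f|` imply `g ∈ U`. -/
def IsOrderIdealIn {X : Type*} [MeasurableSpace X] {m : Measure X} (U V : Set (L2Space m)) : Prop :=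
  ∀ f ∈ U, ∀ g ∈ V, |g| ≤ |f| → g ∈ U

/-!
Two forms `Q`, `Q'` are compared through their resolvents `G_a = (L + a)⁻¹` and the approximating
forms `a ⟨f - a G_a f, g⟩`, which increase to the form as `a → ∞`.

**The pointwise calculus.** The operator `a G_a` is symmetric and sub-Markovian, so its
approximating form is a nonnegative combination of the expressions `f(x) g(x)` and
`(f(x) - f(y)) (g(x) - g(y))`. Hence every inequality `∑ cᵢ uᵢ(x) vᵢ(x) ≥ 0`,
`∑ cᵢ (uᵢ(x) - uᵢ(y)) (vᵢ(x) - vᵢ(y)) ≥ 0` between numbers implies `∑ cᵢ Q(uᵢ, vᵢ) ≥ 0`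
(`IsDirichlet.sum_bilin_nonneg`). No kernel of `a G_a` is needed: the positivity of `a G_a` is
applied to the functions `∑ cᵢ vᵢ(y) uᵢ` for the fixed coefficients given by `y`, of which
countably many suffice (`L2Space.sum_inner_map_nonneg`). Stability of `D(Q)` under normal
contractions and products, monotonicity of `Q_φ` in `φ` and under contractions, and the comparison
`Q_φ ≤ Q` are all instances of this principle.

**The main part.** The forms `Q_φ` are monotone in `φ` and lower semicontinuous on `L²`, so
`Q^(M)`, the supremum of a directed family, is a closed quadratic form, and it inherits the Markov
property (`mainPart_isDirichlet`). Moreover `D(Q)` is an order ideal in `D(Q^(M))`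
(`domain_isOrderIdealIn_mainPart`).

**Domination.** Domination of the semigroups is equivalent to domination of the resolvents, in one
direction by a Laplace transform argument (`Dominates.resolventDominates`) and in the other by the
approximation of the semigroup by those of the bounded operators `a - a² G_a`
(`ResolventDominates.dominates`), which also yields the existence of the semigroup. Domination of
the resolvents holds if and only if `D(Q)` is an order ideal in `D(Q')` and `Q' ≤ Q` on pairs of
nonnegative functions of `D(Q)` (`resolventDominates_of_ideal`,
`ResolventDominates.domain_subset`, `ResolventDominates.isOrderIdealIn`,
`ResolventDominates.bilin_le`).

**The theorem.** As the killing part vanishes, `Q^(M)` extends `Q`. Under `Q ≼ Q' ≼ Q^(M)` the form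
`Q'` is squeezed between `Q` and `Q^(M)` on `D(Q)`, so it extends `Q`, and `Q' - Q^(M)` is positive.
For locality let `f, g ≥ 0` be bounded with `f g = 0`. Cutting off with `φ` gives
`Q'(f, g) ≤ Q'(φ f, φ g) = Q(φ f, φ g) = Q_φ(f, g)`, where the last equality uses `φ f g = 0`, and
the limit along `φ` is `Q^(M)(f, g)` (`bilin_le_mainPart_of_disjoint`). The converse is the
criterion for domination, applied to both pairs of forms.
-/

namespace L2Form

variable {X : Type*} [MeasurableSpace X] {m : Measure X}

/-! ### Algebra of quadratic forms -/

/-- Quadratic forms are recognised by identities in at most three vectors. These identities are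
preserved by pointwise limits, which is how closures and suprema of forms are seen to be
quadratic. -/
theorem isQuadratic_of {Q : L2Form m} (h0 : (0 : L2Space m) ∈ Q.domain)
    (hadd : ∀ f ∈ Q.domain, ∀ g ∈ Q.domain, f + g ∈ Q.domain)
    (hsmul : ∀ (c : ℝ), ∀ f ∈ Q.domain, c • f ∈ Q.domain)
    (hval : ∀ (c : ℝ), ∀ f ∈ Q.domain, Q.val (c • f) = c * c * Q.val f)
    (hthree : ∀ f ∈ Q.domain, ∀ g ∈ Q.domain, ∀ h ∈ Q.domain,
      Q.val (f + g + h) + (Q.val f + Q.val g + Q.val h) =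
        Q.val (f + g) + Q.val (g + h) + Q.val (h + f))
    (hpolar : ∀ (c : ℝ), ∀ f ∈ Q.domain, ∀ g ∈ Q.domain,
      Q.val (c • f + g) = c * c * Q.val f + Q.val g + c * (Q.val (f + g) - Q.val f - Q.val g)) :
    Q.IsQuadratic := by
  let S : Submodule ℝ (L2Space m) :=
    { carrier := Q.domain
      add_mem' := fun {a b} ha hb => hadd a ha b hb
      zero_mem' := h0
      smul_mem' := fun c f hf => hsmul c f hf }
  refine ⟨S, QuadraticMap.ofPolar (fun f : S => Q.val f) ?_ ?_ ?_, rfl, fun f => rfl⟩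
  · intro a x
    simpa using hval a x x.2
  · intro x x' y
    rw [QuadraticMap.polar_add_left_iff]
    simpa using hthree x x.2 x' x'.2 y y.2
  · intro a x y
    have h1 := hpolar a x x.2 y y.2
    have h2 := hval a x x.2
    simp only [QuadraticMap.polar, Submodule.coe_add, Submodule.coe_smul, smul_eq_mul]
    rw [h1, h2]
    ring

namespace IsQuadratic

variable {Q : L2Form m} (hq : Q.IsQuadratic)
include hq

theorem zero_mem : (0 : L2Space m) ∈ Q.domain := by
  obtain ⟨S, q, hS, h⟩ := hq
  rw [← hS]; exact S.zero_mem

theorem add_mem {f g : L2Space m} (hf : f ∈ Q.domain) (hg : g ∈ Q.domain) :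
    f + g ∈ Q.domain := by
  obtain ⟨S, q, hS, h⟩ := hq
  rw [← hS] at hf hg ⊢; exact S.add_mem hf hg

theorem sub_mem {f g : L2Space m} (hf : f ∈ Q.domain) (hg : g ∈ Q.domain) :
    f - g ∈ Q.domain := by
  obtain ⟨S, q, hS, h⟩ := hq
  rw [← hS] at hf hg ⊢; exact S.sub_mem hf hg

theorem smul_mem (c : ℝ) {f : L2Space m} (hf : f ∈ Q.domain) : c • f ∈ Q.domain := by
  obtain ⟨S, q, hS, h⟩ := hq
  rw [← hS] at hf ⊢; exact S.smul_mem c hf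

theorem neg_mem {f : L2Space m} (hf : f ∈ Q.domain) : -f ∈ Q.domain := by
  obtain ⟨S, q, hS, h⟩ := hq
  rw [← hS] at hf ⊢; exact S.neg_mem hf

theorem exists_bilinForm : ∃ (S : Submodule ℝ (L2Space m)) (B : S →ₗ[ℝ] S →ₗ[ℝ] ℝ),
    (S : Set (L2Space m)) = Q.domain ∧ (∀ f g : S, Q.bilin f g = B f g) ∧
      (∀ f g : S, B f g = B g f) ∧ ∀ f : S, Q.val f = B f f := by
  obtain ⟨S, q, hS, h⟩ := hq
  have hB : ∀ f g : S, Q.bilin f g = QuadraticMap.associated q f g := by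
    intro f g
    have e1 := QuadraticMap.map_add q f g
    have e2 := QuadraticMap.map_add q f (-g)
    rw [QuadraticMap.polar_neg_right, QuadraticMap.map_neg, ← sub_eq_add_neg] at e2
    have e3 : QuadraticMap.associated q f g = 2⁻¹ * QuadraticMap.polar q f g := by
      rw [QuadraticMap.associated_apply]
      simp [QuadraticMap.polar]
    rw [bilin, e3, ← Submodule.coe_add, ← Submodule.coe_sub, h, h, e1, e2]
    ring
  refine ⟨S, QuadraticMap.associated q, hS, hB, fun f g => ?_, fun f => ?_⟩
  · exact QuadraticMap.associated_isSymm ℝ q f g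
  · rw [h, QuadraticMap.associated_eq_self_apply]

theorem bilin_add_left {f g h : L2Space m} (hf : f ∈ Q.domain) (hg : g ∈ Q.domain)
    (hh : h ∈ Q.domain) : Q.bilin (f + g) h = Q.bilin f h + Q.bilin g h := by
  obtain ⟨S, B, hS, hB, -, -⟩ := hq.exists_bilinForm
  rw [← hS] at hf hg hh
  have e := hB (⟨f, hf⟩ + ⟨g, hg⟩) ⟨h, hh⟩
  rw [map_add, LinearMap.add_apply, ← hB, ← hB] at e
  exact e

theorem bilin_smul_left (c : ℝ) {f h : L2Space m} (hf : f ∈ Q.domain)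
    (hh : h ∈ Q.domain) : Q.bilin (c • f) h = c * Q.bilin f h := by
  obtain ⟨S, B, hS, hB, -, -⟩ := hq.exists_bilinForm
  rw [← hS] at hf hh
  have e := hB (c • ⟨f, hf⟩) ⟨h, hh⟩
  rw [map_smul, LinearMap.smul_apply, ← hB, smul_eq_mul] at e
  exact e

theorem bilin_comm {f g : L2Space m} (hf : f ∈ Q.domain) (hg : g ∈ Q.domain) :
    Q.bilin f g = Q.bilin g f := by
  obtain ⟨S, B, hS, hB, hs, -⟩ := hq.exists_bilinForm
  rw [← hS] at hf hg
  have e := hs ⟨f, hf⟩ ⟨g, hg⟩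
  rwa [← hB, ← hB] at e

theorem bilin_self {f : L2Space m} (hf : f ∈ Q.domain) : Q.bilin f f = Q.val f := by
  obtain ⟨S, B, hS, hB, hs, hv⟩ := hq.exists_bilinForm
  rw [← hS] at hf
  have e := hv ⟨f, hf⟩
  rw [← hB] at e
  exact e.symm

theorem bilin_add_right {f g h : L2Space m} (hf : f ∈ Q.domain) (hg : g ∈ Q.domain)
    (hh : h ∈ Q.domain) : Q.bilin h (f + g) = Q.bilin h f + Q.bilin h g := by
  rw [hq.bilin_comm hh (hq.add_mem hf hg), hq.bilin_add_left hf hg hh, hq.bilin_comm hf hh,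
    hq.bilin_comm hg hh]

theorem bilin_smul_right (c : ℝ) {f h : L2Space m} (hf : f ∈ Q.domain)
    (hh : h ∈ Q.domain) : Q.bilin h (c • f) = c * Q.bilin h f := by
  rw [hq.bilin_comm hh (hq.smul_mem c hf), hq.bilin_smul_left c hf hh, hq.bilin_comm hf hh]

theorem bilin_sub_left {f g h : L2Space m} (hf : f ∈ Q.domain) (hg : g ∈ Q.domain)
    (hh : h ∈ Q.domain) : Q.bilin (f - g) h = Q.bilin f h - Q.bilin g h := by
  have e : f - g = f + (-1 : ℝ) • g := by rw [neg_one_smul, sub_eq_add_neg]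
  rw [e, hq.bilin_add_left hf (hq.smul_mem _ hg) hh, hq.bilin_smul_left _ hg hh]
  ring

theorem bilin_sub_right {f g h : L2Space m} (hf : f ∈ Q.domain) (hg : g ∈ Q.domain)
    (hh : h ∈ Q.domain) : Q.bilin h (f - g) = Q.bilin h f - Q.bilin h g := by
  rw [hq.bilin_comm hh (hq.sub_mem hf hg), hq.bilin_sub_left hf hg hh, hq.bilin_comm hf hh,
    hq.bilin_comm hg hh]

theorem val_zero : Q.val 0 = 0 := by
  rw [← hq.bilin_self hq.zero_mem, bilin]; simp

theorem val_smul (c : ℝ) {f : L2Space m} (hf : f ∈ Q.domain) :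
    Q.val (c • f) = c * c * Q.val f := by
  rw [← hq.bilin_self (hq.smul_mem c hf), hq.bilin_smul_left c hf (hq.smul_mem c hf),
    hq.bilin_smul_right c hf hf, hq.bilin_self hf, mul_assoc]

theorem val_add {f g : L2Space m} (hf : f ∈ Q.domain) (hg : g ∈ Q.domain) :
    Q.val (f + g) = Q.val f + 2 * Q.bilin f g + Q.val g := by
  rw [← hq.bilin_self (hq.add_mem hf hg), hq.bilin_add_left hf hg (hq.add_mem hf hg),
    hq.bilin_add_right hf hg hf, hq.bilin_add_right hf hg hg, hq.bilin_comm hg hf,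
    hq.bilin_self hf, hq.bilin_self hg]
  ring

theorem val_sub {f g : L2Space m} (hf : f ∈ Q.domain) (hg : g ∈ Q.domain) :
    Q.val (f - g) = Q.val f - 2 * Q.bilin f g + Q.val g := by
  rw [← hq.bilin_self (hq.sub_mem hf hg), hq.bilin_sub_left hf hg (hq.sub_mem hf hg),
    hq.bilin_sub_right hf hg hf, hq.bilin_sub_right hf hg hg, hq.bilin_comm hg hf,
    hq.bilin_self hf, hq.bilin_self hg]
  ring

theorem val_sub_comm {f g : L2Space m} (hf : f ∈ Q.domain) (hg : g ∈ Q.domain) :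
    Q.val (f - g) = Q.val (g - f) := by
  rw [hq.val_sub hf hg, hq.val_sub hg hf, hq.bilin_comm hf hg]; ring

theorem val_add_three {f g h : L2Space m} (hf : f ∈ Q.domain) (hg : g ∈ Q.domain)
    (hh : h ∈ Q.domain) :
    Q.val (f + g + h) + (Q.val f + Q.val g + Q.val h) =
        Q.val (f + g) + Q.val (g + h) + Q.val (h + f) := by
  rw [hq.val_add (hq.add_mem hf hg) hh, hq.bilin_add_left hf hg hh, hq.val_add hf hg,
    hq.val_add hg hh, hq.val_add hh hf, hq.bilin_comm hh hf]
  ring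

theorem val_smul_add (c : ℝ) {f g : L2Space m} (hf : f ∈ Q.domain) (hg : g ∈ Q.domain) :
    Q.val (c • f + g) =
      c * c * Q.val f + Q.val g + c * (Q.val (f + g) - Q.val f - Q.val g) := by
  rw [hq.val_add (hq.smul_mem c hf) hg, hq.bilin_smul_left c hf hg, hq.val_add hf hg,
    hq.val_smul c hf]
  ring

theorem convex_domain : Convex ℝ Q.domain := fun _ hf _ hg a b _ _ _ =>
  hq.add_mem (hq.smul_mem a hf) (hq.smul_mem b hg)

variable (hn : ∀ f ∈ Q.domain, 0 ≤ Q.val f)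
include hn

theorem val_add_le {f g : L2Space m} (hf : f ∈ Q.domain) (hg : g ∈ Q.domain) :
    Q.val (f + g) ≤ 2 * Q.val f + 2 * Q.val g := by
  have := hn _ (hq.sub_mem hf hg)
  rw [hq.val_sub hf hg] at this
  rw [hq.val_add hf hg]
  linarith

theorem val_sub_le {f g : L2Space m} (hf : f ∈ Q.domain) (hg : g ∈ Q.domain) :
    Q.val (f - g) ≤ 2 * Q.val f + 2 * Q.val g := by
  have := hn _ (hq.add_mem hf hg)
  rw [hq.val_add hf hg] at this
  rw [hq.val_sub hf hg]
  linarith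

/-- The Cauchy–Schwarz inequality. -/
theorem bilin_sq_le {f g : L2Space m} (hf : f ∈ Q.domain) (hg : g ∈ Q.domain) :
    Q.bilin f g ^ 2 ≤ Q.val f * Q.val g := by
  have h : ∀ t : ℝ, 0 ≤ Q.val g * (t * t) + (2 * Q.bilin f g) * t + Q.val f := by
    intro t
    have := hn _ (hq.add_mem (hq.smul_mem t hg) hf)
    rw [hq.val_smul_add t hg hf, hq.val_add hg hf, hq.bilin_comm hg hf] at this
    linarith
  have := discrim_le_zero h
  rw [discrim] at this
  nlinarith

theorem abs_bilin_le {f g : L2Space m} (hf : f ∈ Q.domain) (hg : g ∈ Q.domain) :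
    |Q.bilin f g| ≤ √(Q.val f) * √(Q.val g) := by
  rw [← Real.sqrt_mul (hn f hf)]
  exact Real.abs_le_sqrt (hq.bilin_sq_le hn hf hg)

theorem sqrt_val_add_le {f g : L2Space m} (hf : f ∈ Q.domain) (hg : g ∈ Q.domain) :
    √(Q.val (f + g)) ≤ √(Q.val f) + √(Q.val g) := by
  rw [Real.sqrt_le_left (by positivity), hq.val_add hf hg, add_sq, Real.sq_sqrt (hn f hf),
    Real.sq_sqrt (hn g hg)]
  have := (le_abs_self _).trans (hq.abs_bilin_le hn hf hg)
  linarith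

theorem abs_sqrt_val_sub_le {f g : L2Space m} (hf : f ∈ Q.domain) (hg : g ∈ Q.domain) :
    |√(Q.val f) - √(Q.val g)| ≤ √(Q.val (f - g)) := by
  have h1 := hq.sqrt_val_add_le hn (hq.sub_mem hf hg) hg
  have h2 := hq.sqrt_val_add_le hn (hq.sub_mem hg hf) hf
  rw [sub_add_cancel] at h1 h2
  rw [hq.val_sub_comm hg hf] at h2
  rw [abs_le]
  constructor <;> linarith

theorem convex_sublevel (c : ℝ) : Convex ℝ {f | f ∈ Q.domain ∧ Q.val f ≤ c} := by
  rintro f ⟨hf, hfc⟩ g ⟨hg, hgc⟩ a b ha hb hab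
  refine ⟨hq.convex_domain hf hg ha hb hab, ?_⟩
  have h := hn _ (hq.sub_mem hf hg)
  rw [hq.val_sub hf hg] at h
  rw [hq.val_add (hq.smul_mem a hf) (hq.smul_mem b hg), hq.bilin_smul_left a hf
    (hq.smul_mem b hg), hq.bilin_smul_right b hg hf, hq.val_smul _ hf, hq.val_smul _ hg]
  obtain rfl : b = 1 - a := by linarith
  have h2 : 0 ≤ a * (1 - a) := mul_nonneg ha hb
  nlinarith

theorem tendsto_bilin {ι : Type*} {l : Filter ι} {u : ι → L2Space m} {f g : L2Space m}
    (hu : ∀ i, u i ∈ Q.domain) (hf : f ∈ Q.domain) (hg : g ∈ Q.domain)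
    (h : Tendsto (fun i => Q.val (u i - f)) l (𝓝 0)) :
    Tendsto (fun i => Q.bilin (u i) g) l (𝓝 (Q.bilin f g)) := by
  rw [tendsto_iff_norm_sub_tendsto_zero]
  have h2 : Tendsto (fun i => √(Q.val (u i - f)) * √(Q.val g)) l (𝓝 0) := by
    have := (Real.continuous_sqrt.tendsto 0).comp h
    rw [Real.sqrt_zero] at this
    simpa using this.mul_const (√(Q.val g))
  refine squeeze_zero (fun _ => norm_nonneg _) (fun i => ?_) h2
  rw [← hq.bilin_sub_left (hu i) hf hg]
  exact hq.abs_bilin_le hn (hq.sub_mem (hu i) hf) hg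

theorem tendsto_val {ι : Type*} {l : Filter ι} {u : ι → L2Space m} {f : L2Space m}
    (hu : ∀ i, u i ∈ Q.domain) (hf : f ∈ Q.domain)
    (h : Tendsto (fun i => Q.val (u i - f)) l (𝓝 0)) :
    Tendsto (fun i => Q.val (u i)) l (𝓝 (Q.val f)) := by
  have h2 := (h.add ((hq.tendsto_bilin hn hu hf hf h).const_mul 2)).sub_const (Q.val f)
  rw [hq.bilin_self hf] at h2
  refine (h2.congr fun i => ?_).trans
    (by rw [show (0 : ℝ) + 2 * Q.val f - Q.val f = Q.val f by ring])
  rw [hq.val_sub (hu i) hf]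
  ring

end IsQuadratic

/-! ### Lower semicontinuity and closures -/

/-- The Banach–Saks argument for quadratic forms: an `L²`-convergent sequence along which `Q` is
bounded can be replaced by convex combinations of its tails which are also Cauchy for `Q`. The
convex combinations are near-minimisers of `Q` on the convex hulls of the tails, so that the
parallelogram identity makes them a Cauchy sequence. -/
theorem IsQuadratic.exists_isFormCauchy {Q : L2Form m} (hq : Q.IsQuadratic)
    (hn : ∀ f ∈ Q.domain, 0 ≤ Q.val f) {u : ℕ → L2Space m} {f : L2Space m} {c : ℝ}
    (hu : ∀ n, u n ∈ Q.domain) (hc : ∀ n, Q.val (u n) ≤ c) (hlim : Tendsto u atTop (𝓝 f)) :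
    ∃ w, Q.IsFormCauchy w ∧ Tendsto w atTop (𝓝 f) ∧ ∀ n, Q.val (w n) ≤ c := by
  set K : ℕ → Set (L2Space m) := fun n => convexHull ℝ (u '' Set.Ici n) with hK
  have hKsub : ∀ n, K n ⊆ {f | f ∈ Q.domain ∧ Q.val f ≤ c} := fun n =>
    convexHull_min (by rintro _ ⟨k, -, rfl⟩; exact ⟨hu k, hc k⟩) (hq.convex_sublevel hn c)
  have hKanti : ∀ {n k}, n ≤ k → K k ⊆ K n := fun h =>
    convexHull_mono (Set.image_mono (Set.Ici_subset_Ici.2 h))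
  have hKu : ∀ n, u n ∈ K n := fun n => subset_convexHull ℝ _ ⟨n, Set.mem_Ici.2 le_rfl, rfl⟩
  have hbdd : ∀ n, BddBelow (Q.val '' K n) := fun n =>
    ⟨0, by rintro _ ⟨v, hv, rfl⟩; exact hn _ (hKsub n hv).1⟩
  set d : ℕ → ℝ := fun n => sInf (Q.val '' K n) with hd
  have hdle : ∀ n, ∀ v ∈ K n, d n ≤ Q.val v := fun n v hv => csInf_le (hbdd n) ⟨v, hv, rfl⟩
  have hdmono : Monotone d := fun n k h =>
    csInf_le_csInf (hbdd n) ⟨_, u k, hKu k, rfl⟩ (Set.image_mono (hKanti h))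
  have hdb : BddAbove (Set.range d) := ⟨c, by
    rintro _ ⟨n, rfl⟩; exact (hdle n _ (hKu n)).trans (hc n)⟩
  have hdlim := tendsto_atTop_ciSup hdmono hdb
  have hex : ∀ n, ∃ v ∈ K n, Q.val v < d n + 1 / ((n : ℝ) + 1) := by
    intro n
    obtain ⟨_, ⟨v, hv, rfl⟩, h⟩ := exists_lt_of_csInf_lt (s := Q.val '' K n)
      (b := d n + 1 / ((n : ℝ) + 1)) ⟨_, u n, hKu n, rfl⟩
      (by have : (0 : ℝ) < 1 / ((n : ℝ) + 1) := by positivity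
          simp only [hd]; linarith)
    exact ⟨v, hv, h⟩
  choose w hwK hw using hex
  have hwd : ∀ n, w n ∈ Q.domain := fun n => (hKsub n (hwK n)).1
  refine ⟨w, ⟨hwd, ?_⟩, ?_, fun n => (hKsub n (hwK n)).2⟩
  · have key : ∀ n k, n ≤ k → Q.val (w n - w k) ≤
        2 * |d n - d k| + (2 * (1 / ((n : ℝ) + 1)) + 2 * (1 / ((k : ℝ) + 1))) := by
      intro n k hnk
      have hmid : (1 / 2 : ℝ) • w n + (1 / 2 : ℝ) • w k ∈ K n :=
        convex_convexHull ℝ _ (hwK n) (hKanti hnk (hwK k)) (by norm_num) (by norm_num)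
          (by norm_num)
      have h1 := hdle n _ hmid
      rw [← smul_add, hq.val_smul _ (hq.add_mem (hwd n) (hwd k)), hq.val_add (hwd n) (hwd k)] at h1
      have h2 := hw n
      have h3 := hw k
      have h4 := neg_abs_le (d n - d k)
      rw [hq.val_sub (hwd n) (hwd k)]
      linarith
    have key2 : ∀ p : ℕ × ℕ, Q.val (w p.1 - w p.2) ≤
        2 * |d p.1 - d p.2| + (2 * (1 / ((p.1 : ℝ) + 1)) + 2 * (1 / ((p.2 : ℝ) + 1))) := by
      rintro ⟨n, k⟩
      rcases le_total n k with h | h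
      · exact key n k h
      · have := key k n h
        rw [hq.val_sub_comm (hwd n) (hwd k), abs_sub_comm]
        dsimp only at this ⊢
        linarith
    refine squeeze_zero (fun p => hn _ (hq.sub_mem (hwd _) (hwd _))) key2 ?_
    rw [← prod_atTop_atTop_eq]
    have e1 := (hdlim.comp tendsto_fst).sub (hdlim.comp (tendsto_snd (f := atTop (α := ℕ))))
    have e2 := tendsto_one_div_add_atTop_nhds_zero_nat (𝕜 := ℝ)
    have e3 := ((e1.abs).const_mul 2).add (((e2.comp (tendsto_fst (g := atTop (α := ℕ)))).const_mul
      2).add ((e2.comp (tendsto_snd (f := atTop (α := ℕ)))).const_mul 2))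
    simpa using e3
  · rw [Metric.tendsto_atTop] at hlim ⊢
    intro ε hε
    obtain ⟨N, hN⟩ := hlim ε hε
    refine ⟨N, fun n hn' => ?_⟩
    have : K n ⊆ Metric.ball f ε := convexHull_min
      (by rintro _ ⟨k, hk, rfl⟩; exact hN k (le_trans hn' hk)) (convex_ball f ε)
    exact this (hwK n)

/-- Closed forms are lower semicontinuous on `L²`. -/
theorem IsClosedForm.mem_domain_and_val_le {Q : L2Form m} (hc : Q.IsClosedForm)
    (hq : Q.IsQuadratic) (hn : ∀ f ∈ Q.domain, 0 ≤ Q.val f) {u : ℕ → L2Space m} {f : L2Space m}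
    {c : ℝ} (hu : ∀ n, u n ∈ Q.domain) (huc : ∀ n, Q.val (u n) ≤ c)
    (hlim : Tendsto u atTop (𝓝 f)) : f ∈ Q.domain ∧ Q.val f ≤ c := by
  obtain ⟨w, hw, hwlim, hwc⟩ := hq.exists_isFormCauchy hn hu huc hlim
  obtain ⟨hf, h⟩ := hc w f hw hwlim
  exact ⟨hf, le_of_tendsto' (hq.tendsto_val hn hw.1 hf h) hwc⟩

/-- Conversely, forms which are lower semicontinuous on `L²` are closed. -/
theorem IsQuadratic.isClosedForm_of {Q : L2Form m} (hq : Q.IsQuadratic)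
    (hn : ∀ f ∈ Q.domain, 0 ≤ Q.val f)
    (h : ∀ (u : ℕ → L2Space m) (f : L2Space m) (c : ℝ), (∀ n, u n ∈ Q.domain) →
      (∀ n, Q.val (u n) ≤ c) → Tendsto u atTop (𝓝 f) → f ∈ Q.domain ∧ Q.val f ≤ c) :
    Q.IsClosedForm := by
  intro u f hu hlim
  have hev : ∀ ε > 0, ∃ N, ∀ n ≥ N, f - u n ∈ Q.domain ∧ Q.val (f - u n) ≤ ε := by
    intro ε hε
    have h1 := hu.2.eventually (gt_mem_nhds hε)
    rw [eventually_atTop] at h1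
    obtain ⟨⟨N1, N2⟩, hN⟩ := h1
    refine ⟨N1, fun n hn' => ?_⟩
    refine h (fun k => u (k + N2) - u n) _ ε (fun k => hq.sub_mem (hu.1 _) (hu.1 _))
      (fun k => ?_) (((tendsto_add_atTop_iff_nat N2).2 hlim).sub_const (u n))
    rw [hq.val_sub_comm (hu.1 _) (hu.1 _)]
    exact (hN (n, k + N2) ⟨hn', Nat.le_add_left _ _⟩).le
  have hf : f ∈ Q.domain := by
    obtain ⟨N, hN⟩ := hev 1 one_pos
    simpa using hq.add_mem (hN N le_rfl).1 (hu.1 N)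
  refine ⟨hf, ?_⟩
  rw [Metric.tendsto_atTop]
  intro ε hε
  obtain ⟨N, hN⟩ := hev (ε / 2) (half_pos hε)
  refine ⟨N, fun n hn' => ?_⟩
  rw [Real.dist_eq, sub_zero, abs_of_nonneg (hn _ (hq.sub_mem (hu.1 n) hf)),
    hq.val_sub_comm (hu.1 n) hf]
  linarith [(hN n hn').2]

/-- Lower semicontinuity of a form on its domain. For nonnegative quadratic forms it means
that the form is closable. -/
def IsClosableForm (Q : L2Form m) : Prop :=
  ∀ (u : ℕ → L2Space m) (f : L2Space m) (c : ℝ), (∀ n, u n ∈ Q.domain) → f ∈ Q.domain →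
    (∀ n, Q.val (u n) ≤ c) → Tendsto u atTop (𝓝 f) → Q.val f ≤ c

section Closure

variable {Q : L2Form m} (hq : Q.IsQuadratic) (hn : ∀ f ∈ Q.domain, 0 ≤ Q.val f)
  (hl : Q.IsClosableForm)
include hq hn

theorem IsFormCauchy.exists_tendsto_val {u : ℕ → L2Space m} (hu : Q.IsFormCauchy u) :
    ∃ a, Tendsto (fun n => Q.val (u n)) atTop (𝓝 a) := by
  have h : CauchySeq fun n => √(Q.val (u n)) := by
    rw [cauchySeq_iff_tendsto_dist_atTop_0]
    have h2 := (Real.continuous_sqrt.tendsto 0).comp hu.2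
    rw [Real.sqrt_zero] at h2
    exact squeeze_zero (fun _ => dist_nonneg)
      (fun p => hq.abs_sqrt_val_sub_le hn (hu.1 p.1) (hu.1 p.2)) h2
  obtain ⟨a, ha⟩ := cauchySeq_tendsto_of_complete h
  refine ⟨a ^ 2, (ha.pow 2).congr fun n => Real.sq_sqrt (hn _ (hu.1 n))⟩

theorem IsFormCauchy.add {u v : ℕ → L2Space m} (hu : Q.IsFormCauchy u)
    (hv : Q.IsFormCauchy v) : Q.IsFormCauchy fun n => u n + v n := by
  refine ⟨fun n => hq.add_mem (hu.1 n) (hv.1 n), ?_⟩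
  have h := (hu.2.const_mul 2).add (hv.2.const_mul 2)
  simp only [mul_zero, add_zero] at h
  refine squeeze_zero (fun p => hn _ (hq.sub_mem (hq.add_mem (hu.1 _) (hv.1 _))
    (hq.add_mem (hu.1 _) (hv.1 _)))) (fun p => ?_) h
  have := hq.val_add_le hn (hq.sub_mem (hu.1 p.1) (hu.1 p.2)) (hq.sub_mem (hv.1 p.1) (hv.1 p.2))
  rwa [sub_add_sub_comm] at this

omit hn in
theorem IsFormCauchy.smul (c : ℝ) {u : ℕ → L2Space m} (hu : Q.IsFormCauchy u) :
    Q.IsFormCauchy fun n => c • u n := by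
  refine ⟨fun n => hq.smul_mem c (hu.1 n), ?_⟩
  have h := hu.2.const_mul (c * c)
  rw [mul_zero] at h
  refine h.congr fun p => ?_
  rw [← smul_sub, hq.val_smul c (hq.sub_mem (hu.1 _) (hu.1 _))]

include hl

theorem IsFormCauchy.tendsto_val_zero {u : ℕ → L2Space m} (hu : Q.IsFormCauchy u)
    (h0 : Tendsto u atTop (𝓝 0)) : Tendsto (fun n => Q.val (u n)) atTop (𝓝 0) := by
  rw [Metric.tendsto_atTop]
  intro ε hε
  have h1 := hu.2.eventually (gt_mem_nhds (half_pos hε))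
  rw [eventually_atTop] at h1
  obtain ⟨⟨N1, N2⟩, hN⟩ := h1
  refine ⟨N1, fun n hn' => ?_⟩
  rw [Real.dist_eq, sub_zero, abs_of_nonneg (hn _ (hu.1 n))]
  have h2 : Tendsto (fun k => u n - u (k + N2)) atTop (𝓝 (u n)) := by
    simpa using (((tendsto_add_atTop_iff_nat N2).2 h0).const_sub (u n))
  have := hl _ _ (ε / 2) (fun k => hq.sub_mem (hu.1 n) (hu.1 (k + N2))) (hu.1 n)
    (fun k => (hN (n, k + N2) ⟨hn', Nat.le_add_left _ _⟩).le) h2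
  linarith

theorem IsFormCauchy.tendsto_closure_val {u : ℕ → L2Space m} {f : L2Space m}
    (hu : Q.IsFormCauchy u) (hlim : Tendsto u atTop (𝓝 f)) :
    Tendsto (fun n => Q.val (u n)) atTop (𝓝 (Q.closure.val f)) := by
  obtain ⟨a, ha⟩ := hu.exists_tendsto_val hq hn
  have hset : {a : ℝ | ∃ u, Q.IsFormCauchy u ∧ Tendsto u atTop (𝓝 f) ∧
      Tendsto (fun n => Q.val (u n)) atTop (𝓝 a)} = {a} := by
    ext b
    constructor
    · rintro ⟨v, hv, hvlim, hb⟩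
      have hw := hu.add hq hn (hv.smul hq (-1))
      have hw0 : Tendsto (fun n => u n + (-1 : ℝ) • v n) atTop (𝓝 0) := by
        simpa using hlim.add (hvlim.const_smul (-1 : ℝ))
      have h1 := hw.tendsto_val_zero hq hn hl hw0
      have h2 := (Real.continuous_sqrt.tendsto 0).comp h1
      rw [Real.sqrt_zero] at h2
      have h3 : Tendsto (fun n => √(Q.val (u n)) - √(Q.val (v n))) atTop (𝓝 0) := by
        refine squeeze_zero_norm (fun n => ?_) h2
        have := hq.abs_sqrt_val_sub_le hn (hu.1 n) (hv.1 n)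
        simpa [sub_eq_add_neg] using this
      have h4 := ((Real.continuous_sqrt.tendsto a).comp ha).sub
        ((Real.continuous_sqrt.tendsto b).comp hb)
      have h5 := tendsto_nhds_unique h4 h3
      have ha0 : 0 ≤ a := ge_of_tendsto' ha fun n => hn _ (hu.1 n)
      have hb0 : 0 ≤ b := ge_of_tendsto' hb fun n => hn _ (hv.1 n)
      exact (Real.sqrt_inj hb0 ha0).1 (by linarith)
    · rintro rfl
      exact ⟨u, hu, hlim, ha⟩
  have : Q.closure.val f = a := by
    change sInf _ = a
    rw [hset, csInf_singleton]
  rwa [this]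

theorem mem_closure_of_mem {f : L2Space m} (hf : f ∈ Q.domain) :
    f ∈ Q.closure.domain ∧ Q.closure.val f = Q.val f := by
  have h : Q.IsFormCauchy fun _ => f := ⟨fun _ => hf, by
    simp only [sub_self, hq.val_zero]; exact tendsto_const_nhds⟩
  exact ⟨⟨_, h, tendsto_const_nhds⟩,
    (tendsto_nhds_unique (h.tendsto_closure_val hq hn hl tendsto_const_nhds)
      tendsto_const_nhds)⟩

theorem closure_nonneg : ∀ f ∈ Q.closure.domain, 0 ≤ Q.closure.val f := by
  rintro f ⟨u, hu, hlim⟩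
  exact ge_of_tendsto' (hu.tendsto_closure_val hq hn hl hlim) fun n => hn _ (hu.1 n)

theorem closure_isQuadratic : Q.closure.IsQuadratic := by
  have hadd : ∀ {u v f g}, Q.IsFormCauchy u ∧ Tendsto u atTop (𝓝 f) →
      Q.IsFormCauchy v ∧ Tendsto v atTop (𝓝 g) → (Q.IsFormCauchy (fun n => u n + v n) ∧
        Tendsto (fun n => u n + v n) atTop (𝓝 (f + g))) := fun hu hv =>
    ⟨hu.1.add hq hn hv.1, hu.2.add hv.2⟩
  have hsmul : ∀ {u f} (c : ℝ), Q.IsFormCauchy u ∧ Tendsto u atTop (𝓝 f) →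
      (Q.IsFormCauchy (fun n => c • u n) ∧ Tendsto (fun n => c • u n) atTop (𝓝 (c • f))) :=
    fun c hu => ⟨hu.1.smul hq c, hu.2.const_smul c⟩
  have ht : ∀ {u f}, Q.IsFormCauchy u ∧ Tendsto u atTop (𝓝 f) →
      Tendsto (fun n => Q.val (u n)) atTop (𝓝 (Q.closure.val f)) := fun hu =>
    hu.1.tendsto_closure_val hq hn hl hu.2
  refine isQuadratic_of (mem_closure_of_mem hq hn hl hq.zero_mem).1 ?_ ?_ ?_ ?_ ?_
  · rintro f ⟨u, hu⟩ g ⟨v, hv⟩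
    exact ⟨_, hadd hu hv⟩
  · rintro c f ⟨u, hu⟩
    exact ⟨_, hsmul c hu⟩
  · rintro c f ⟨u, hu⟩
    refine tendsto_nhds_unique (ht (hsmul c hu)) (((ht hu).const_mul (c * c)).congr fun n => ?_)
    rw [hq.val_smul c (hu.1.1 n)]
  · rintro f ⟨u, hu⟩ g ⟨v, hv⟩ h ⟨w, hw⟩
    refine tendsto_nhds_unique ((ht (hadd (hadd hu hv) hw)).add (((ht hu).add (ht hv)).add
      (ht hw))) ((((ht (hadd hu hv)).add (ht (hadd hv hw))).add (ht (hadd hw hu))).congr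
        fun n => ?_)
    exact (hq.val_add_three (hu.1.1 n) (hv.1.1 n) (hw.1.1 n)).symm
  · rintro c f ⟨u, hu⟩ g ⟨v, hv⟩
    refine tendsto_nhds_unique (ht (hadd (hsmul c hu) hv)) (((((ht hu).const_mul (c * c)).add
      (ht hv)).add ((((ht (hadd hu hv)).sub (ht hu)).sub (ht hv)).const_mul c)).congr
        fun n => ?_)
    exact (hq.val_smul_add c (hu.1.1 n) (hv.1.1 n)).symm

theorem mem_closure_of_tendsto {u : ℕ → L2Space m} {f : L2Space m} {c : ℝ}
    (hu : ∀ n, u n ∈ Q.domain) (hc : ∀ n, Q.val (u n) ≤ c) (hlim : Tendsto u atTop (𝓝 f)) :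
    f ∈ Q.closure.domain ∧ Q.closure.val f ≤ c := by
  obtain ⟨w, hw, hwlim, hwc⟩ := hq.exists_isFormCauchy hn hu hc hlim
  exact ⟨⟨w, hw, hwlim⟩, le_of_tendsto' (hw.tendsto_closure_val hq hn hl hwlim) hwc⟩

theorem exists_tendsto_of_mem_closure {f : L2Space m} {c : ℝ} (hf : f ∈ Q.closure.domain)
    (hc : Q.closure.val f < c) : ∃ u : ℕ → L2Space m, (∀ n, u n ∈ Q.domain) ∧
      (∀ n, Q.val (u n) ≤ c) ∧ Tendsto u atTop (𝓝 f) := by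
  obtain ⟨u, hu, hlim⟩ := hf
  have h := (hu.tendsto_closure_val hq hn hl hlim).eventually (gt_mem_nhds hc)
  obtain ⟨N, hN⟩ := eventually_atTop.1 h
  exact ⟨fun n => u (n + N), fun n => hu.1 _, fun n => (hN _ (Nat.le_add_left _ _)).le,
    (tendsto_add_atTop_iff_nat N).2 hlim⟩

/-- The closure of a closable form is lower semicontinuous on `L²`. -/
theorem closure_mem_domain_and_val_le {u : ℕ → L2Space m} {f : L2Space m} {c : ℝ}
    (hu : ∀ n, u n ∈ Q.closure.domain) (hc : ∀ n, Q.closure.val (u n) ≤ c)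
    (hlim : Tendsto u atTop (𝓝 f)) : f ∈ Q.closure.domain ∧ Q.closure.val f ≤ c := by
  have key : ∀ ε > 0, f ∈ Q.closure.domain ∧ Q.closure.val f ≤ c + ε := by
    intro ε hε
    have hex : ∀ n : ℕ, ∃ v ∈ Q.domain, Q.val v ≤ c + ε ∧ dist v (u n) < 1 / ((n : ℝ) + 1) := by
      intro n
      obtain ⟨v, hv, hvc, hvlim⟩ := exists_tendsto_of_mem_closure hq hn hl (hu n)
        (show Q.closure.val (u n) < c + ε by linarith [hc n])
      obtain ⟨N, hN⟩ := Metric.tendsto_atTop.1 hvlim (1 / ((n : ℝ) + 1)) (by positivity)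
      exact ⟨v N, hv N, hvc N, hN N le_rfl⟩
    choose v hv hvc hvd using hex
    refine mem_closure_of_tendsto hq hn hl hv hvc (hlim.congr_dist ?_)
    refine squeeze_zero (fun _ => dist_nonneg) (fun n => ?_)
      (tendsto_one_div_add_atTop_nhds_zero_nat (𝕜 := ℝ))
    rw [dist_comm]
    exact (hvd n).le
  exact ⟨(key 1 one_pos).1, le_of_forall_pos_le_add fun ε hε => (key ε hε).2⟩

end Closure

end L2Form

/-! ### Order, truncation and convergence in `L²` -/

namespace L2Space

variable {X : Type*} [MeasurableSpace X] {m : Measure X}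

theorem nonneg_iff {f : L2Space m} : 0 ≤ f ↔ ∀ᵐ x ∂m, 0 ≤ f x :=
  (Lp.coeFn_nonneg f).symm

theorem le_iff {f g : L2Space m} : f ≤ g ↔ ∀ᵐ x ∂m, f x ≤ g x :=
  (Lp.coeFn_le f g).symm

theorem inner_eq (f g : L2Space m) : inner ℝ f g = ∫ x, f x * g x ∂m := by
  rw [L2.inner_def]
  exact integral_congr_ae (Eventually.of_forall fun x => by simp [mul_comm])

theorem integrable_mul (f g : L2Space m) : Integrable (fun x => f x * g x) m :=
  (Lp.memLp f).integrable_mul (Lp.memLp g)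

theorem norm_sq_eq (f : L2Space m) : ‖f‖ ^ 2 = ∫ x, f x ^ 2 ∂m := by
  rw [← real_inner_self_eq_norm_sq, inner_eq]
  simp only [sq]

theorem inner_nonneg {f g : L2Space m} (hf : 0 ≤ f) (hg : 0 ≤ g) : 0 ≤ inner ℝ f g := by
  rw [inner_eq]
  refine integral_nonneg_of_ae ?_
  filter_upwards [nonneg_iff.1 hf, nonneg_iff.1 hg] with x h1 h2 using mul_nonneg h1 h2

theorem smul_nonneg {c : ℝ} (hc : 0 ≤ c) {f : L2Space m} (hf : 0 ≤ f) : 0 ≤ c • f := by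
  rw [nonneg_iff] at *
  filter_upwards [hf, Lp.coeFn_smul c f] with x h1 h2
  rw [h2]
  exact mul_nonneg hc h1

theorem coeFn_posPart' (f : L2Space m) : ∀ᵐ x ∂m, (f ⊔ 0 : L2Space m) x = max (f x) 0 := by
  filter_upwards [Lp.coeFn_sup f 0, Lp.coeFn_zero ℝ 2 m] with x h1 h2
  rw [h1, Pi.sup_apply, h2]; rfl

theorem nonneg_of_inner_nonneg {f : L2Space m} (h : ∀ g : L2Space m, 0 ≤ g → 0 ≤ inner ℝ f g) :
    0 ≤ f := by
  have h1 := h (-f ⊔ 0) le_sup_right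
  have h2 : inner ℝ f (-f ⊔ 0) = - ‖(-f ⊔ 0 : L2Space m)‖ ^ 2 := by
    rw [inner_eq, norm_sq_eq, ← integral_neg]
    refine integral_congr_ae ?_
    filter_upwards [coeFn_posPart' (-f), Lp.coeFn_neg f] with x h1 h2
    rw [h1, h2, Pi.neg_apply]
    rcases le_total (-(f x)) 0 with h | h
    · rw [max_eq_right h]; simp
    · rw [max_eq_left h]; ring
  have h3 : (-f ⊔ 0 : L2Space m) = 0 := by
    rw [← norm_eq_zero]
    nlinarith [sq_nonneg ‖(-f ⊔ 0 : L2Space m)‖]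
  have h4 : -f ≤ 0 := by rw [← h3]; exact le_sup_left
  simpa using h4

/-- Dominated convergence in `L²`. -/
theorem tendsto_of_dominated {u : ℕ → L2Space m} {f g : L2Space m}
    (hb : ∀ n, ∀ᵐ x ∂m, |u n x| ≤ |g x|)
    (hlim : ∀ᵐ x ∂m, Tendsto (fun n => u n x) atTop (𝓝 (f x))) :
    Tendsto u atTop (𝓝 f) := by
  rw [tendsto_iff_norm_sub_tendsto_zero]
  have h : Tendsto (fun n => ∫ x, (u n x - f x) ^ 2 ∂m) atTop (𝓝 (∫ _, (0 : ℝ) ∂m)) := by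
    refine tendsto_integral_of_dominated_convergence (fun x => (2 * g x) ^ 2)
      (fun n => (((Lp.memLp (u n)).1.sub (Lp.memLp f).1).pow 2)) ?_ (fun n => ?_) ?_
    · have := ((Lp.memLp g).integrable_sq).const_mul 4
      refine this.congr (Eventually.of_forall fun x => ?_)
      change 4 * g x ^ 2 = (2 * g x) ^ 2
      ring
    · filter_upwards [hlim, ae_all_iff.2 hb] with x h1 h2
      have h3 : |f x| ≤ |g x| := le_of_tendsto' h1.abs h2
      rw [Real.norm_eq_abs, abs_of_nonneg (sq_nonneg _)]
      refine sq_le_sq.2 ?_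
      rw [abs_mul, abs_two]
      have := abs_sub (u n x) (f x)
      linarith [h2 n]
    · filter_upwards [hlim] with x h1
      have := (h1.sub_const (f x)).pow 2
      simpa using this
  rw [integral_zero] at h
  have h2 := (Real.continuous_sqrt.tendsto 0).comp h
  rw [Real.sqrt_zero] at h2
  refine h2.congr fun n => ?_
  rw [Function.comp_apply, ← Real.sqrt_sq (norm_nonneg (u n - f)), norm_sq_eq]
  congr 1
  refine integral_congr_ae ?_
  filter_upwards [Lp.coeFn_sub (u n) f] with x hx
  rw [hx]; rfl

/-- Truncation of a real number at the levels `k` and `-k`. -/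
def cap (k : ℝ≥0) (t : ℝ) : ℝ := max (-k) (min t k)

theorem lipschitz_cap (k : ℝ≥0) : LipschitzWith 1 (cap k) := by
  have h := (LipschitzWith.id (α := ℝ)).min_const k |>.const_max (-k)
  exact h

theorem cap_zero (k : ℝ≥0) : cap k 0 = 0 := by
  simp [cap]

theorem abs_cap_le (k : ℝ≥0) (t : ℝ) : |cap k t| ≤ k :=
  abs_le.2 ⟨le_max_left _ _, max_le (by linarith [k.2]) (min_le_right _ _)⟩

theorem cap_of_abs_le {k : ℝ≥0} {t : ℝ} (h : |t| ≤ k) : cap k t = t := by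
  rw [abs_le] at h
  rw [cap, min_eq_left h.2, max_eq_right h.1]

theorem abs_cap_sub_le (k : ℝ≥0) (s t : ℝ) : |cap k s - cap k t| ≤ |s - t| := by
  simpa [Real.dist_eq] using (lipschitz_cap k).dist_le_mul s t

theorem abs_cap_le_abs (k : ℝ≥0) (t : ℝ) : |cap k t| ≤ |t| := by
  simpa [cap_zero] using abs_cap_sub_le k t 0

/-- The truncation of an `L²` function at the levels `k` and `-k`. -/
noncomputable def trunc (k : ℝ≥0) (f : L2Space m) : L2Space m :=
  (lipschitz_cap k).compLp (cap_zero k) f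

theorem coeFn_trunc (k : ℝ≥0) (f : L2Space m) : ∀ᵐ x ∂m, trunc k f x = cap k (f x) :=
  (lipschitz_cap k).coeFn_compLp (cap_zero k) f

theorem tendsto_trunc (f : L2Space m) : Tendsto (fun n : ℕ => trunc (n : ℝ≥0) f) atTop (𝓝 f) := by
  refine tendsto_of_dominated (g := f) (fun n => ?_) ?_
  · filter_upwards [coeFn_trunc n f] with x hx
    rw [hx]
    exact abs_cap_le_abs _ _
  · filter_upwards [ae_all_iff.2 fun n : ℕ => coeFn_trunc (n : ℝ≥0) f] with x hx
    obtain ⟨N, hN⟩ := exists_nat_ge |f x|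
    refine tendsto_atTop_of_eventually_const (i₀ := N) fun n hn => ?_
    rw [hx n, cap_of_abs_le]
    refine hN.trans ?_
    simpa using hn

end L2Space

/-! ### Resolvents -/

namespace L2Form

variable {X : Type*} [MeasurableSpace X] {m : Measure X}

/-- `G` is the resolvent `(L + a)⁻¹` of the operator `L` of `Q`, characterised weakly. -/
def IsResolvent (Q : L2Form m) (a : ℝ) (G : L2Space m →L[ℝ] L2Space m) : Prop :=
  ∀ f, G f ∈ Q.domain ∧ ∀ g ∈ Q.domain, Q.bilin (G f) g + a * inner ℝ (G f) g = inner ℝ f g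

namespace IsDirichlet

variable {Q : L2Form m} (hQ : Q.IsDirichlet)
include hQ

/-- Weak solvability of `(L + a) u = f`: the solution is the minimiser of
`Q(u) + a ‖u‖² - 2 ⟨f, u⟩`. -/
theorem exists_weak_solution {a : ℝ} (ha : 0 < a) (f : L2Space m) :
    ∃ u ∈ Q.domain, ∀ g ∈ Q.domain, Q.bilin u g + a * inner ℝ u g = inner ℝ f g := by
  have hq := hQ.isQuadratic
  set J : L2Space m → ℝ := fun v => Q.val v + a * ‖v‖ ^ 2 - 2 * inner ℝ f v with hJ
  have hJb : BddBelow (J '' Q.domain) := by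
    refine ⟨-(‖f‖ ^ 2 / a), ?_⟩
    rintro _ ⟨v, hv, rfl⟩
    have h1 := hQ.nonneg v hv
    have h2 := real_inner_le_norm f v
    have h3 : 0 ≤ (a * ‖v‖ - ‖f‖) ^ 2 / a := by positivity
    have h4 : (a * ‖v‖ - ‖f‖) ^ 2 / a = a * ‖v‖ ^ 2 - 2 * (‖f‖ * ‖v‖) + ‖f‖ ^ 2 / a := by
      field_simp
      ring
    simp only [hJ]
    linarith
  set d := sInf (J '' Q.domain) with hd
  have hdle : ∀ v ∈ Q.domain, d ≤ J v := fun v hv => csInf_le hJb ⟨v, hv, rfl⟩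
  have hex : ∀ n : ℕ, ∃ v ∈ Q.domain, J v < d + 1 / ((n : ℝ) + 1) := by
    intro n
    obtain ⟨_, ⟨v, hv, rfl⟩, h⟩ := exists_lt_of_csInf_lt (s := J '' Q.domain)
      (b := d + 1 / ((n : ℝ) + 1)) ⟨_, 0, hq.zero_mem, rfl⟩
      (by have : (0 : ℝ) < 1 / ((n : ℝ) + 1) := by positivity
          linarith)
    exact ⟨v, hv, h⟩
  choose u hu huJ using hex
  have hpar : ∀ n k, Q.val (u n - u k) + a * ‖u n - u k‖ ^ 2 ≤
      2 * (1 / ((n : ℝ) + 1)) + 2 * (1 / ((k : ℝ) + 1)) := by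
    intro n k
    have h1 := hdle _ (hq.smul_mem (1 / 2) (hq.add_mem (hu n) (hu k)))
    have h2 := huJ n
    have h3 := huJ k
    simp only [hJ] at h1 h2 h3
    rw [hq.val_smul _ (hq.add_mem (hu n) (hu k)), hq.val_add (hu n) (hu k), norm_smul, mul_pow,
      norm_add_sq_real, inner_smul_right, inner_add_right] at h1
    rw [hq.val_sub (hu n) (hu k), norm_sub_sq_real]
    norm_num at h1
    linarith
  have hsum : Tendsto (fun p : ℕ × ℕ => 2 * (1 / ((p.1 : ℝ) + 1)) + 2 * (1 / ((p.2 : ℝ) + 1)))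
      atTop (𝓝 0) := by
    rw [← prod_atTop_atTop_eq]
    have e2 := tendsto_one_div_add_atTop_nhds_zero_nat (𝕜 := ℝ)
    have e3 := ((e2.comp (tendsto_fst (g := atTop (α := ℕ)))).const_mul
      2).add ((e2.comp (tendsto_snd (f := atTop (α := ℕ)))).const_mul 2)
    simpa using e3
  have hcau : CauchySeq u := by
    rw [cauchySeq_iff_tendsto_dist_atTop_0]
    have h1 := (Real.continuous_sqrt.tendsto 0).comp (hsum.const_mul a⁻¹ |>.trans (by simp))
    rw [Real.sqrt_zero] at h1
    refine squeeze_zero (fun _ => dist_nonneg) (fun p => ?_) h1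
    rw [dist_eq_norm]
    refine Real.le_sqrt_of_sq_le ?_
    beta_reduce
    rw [inv_mul_eq_div, le_div_iff₀ ha]
    have := hpar p.1 p.2
    have := hQ.nonneg _ (hq.sub_mem (hu p.1) (hu p.2))
    linarith
  obtain ⟨w, hw⟩ := cauchySeq_tendsto_of_complete hcau
  have hfc : Q.IsFormCauchy u := ⟨hu, squeeze_zero (fun p => hQ.nonneg _ (hq.sub_mem (hu _) (hu _)))
    (fun p => by have := hpar p.1 p.2; have : 0 ≤ a * ‖u p.1 - u p.2‖ ^ 2 := by positivity
                 linarith) hsum⟩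
  obtain ⟨hwd, hwt⟩ := hQ.isClosedForm u w hfc hw
  have hJw : J w ≤ d := by
    have h1 : Tendsto (fun n => J (u n)) atTop (𝓝 (J w)) :=
      ((hq.tendsto_val hQ.nonneg hu hwd hwt).add ((hw.norm.pow 2).const_mul a)).sub
        ((tendsto_const_nhds.inner hw).const_mul 2)
    have h2 : Tendsto (fun n : ℕ => d + 1 / ((n : ℝ) + 1)) atTop (𝓝 d) := by
      simpa using (tendsto_one_div_add_atTop_nhds_zero_nat (𝕜 := ℝ)).const_add d
    exact le_of_tendsto_of_tendsto' h1 h2 fun n => (huJ n).le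
  refine ⟨w, hwd, fun g hg => ?_⟩
  have hvar : ∀ t : ℝ, 0 ≤ (Q.val g + a * ‖g‖ ^ 2) * (t * t) +
      (2 * (Q.bilin w g + a * inner ℝ w g - inner ℝ f g)) * t + 0 := by
    intro t
    have h1 := hJw.trans (hdle _ (hq.add_mem (hq.smul_mem t hg) hwd))
    simp only [hJ] at h1
    rw [hq.val_smul_add t hg hwd, hq.val_add hg hwd, hq.bilin_comm hg hwd, norm_add_sq_real,
      norm_smul, mul_pow, real_inner_comm w (t • g), inner_smul_right, inner_add_right,
      inner_smul_right, Real.norm_eq_abs, sq_abs] at h1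
    linarith
  have := discrim_le_zero hvar
  rw [discrim] at this
  nlinarith

theorem weak_solution_unique {a : ℝ} (ha : 0 < a) {f u v : L2Space m} (hu : u ∈ Q.domain)
    (hv : v ∈ Q.domain) (hfu : ∀ g ∈ Q.domain, Q.bilin u g + a * inner ℝ u g = inner ℝ f g)
    (hfv : ∀ g ∈ Q.domain, Q.bilin v g + a * inner ℝ v g = inner ℝ f g) : u = v := by
  have hq := hQ.isQuadratic
  have hd := hq.sub_mem hu hv
  have h1 := hfu _ hd
  have h2 := hfv _ hd
  have h3 := hq.bilin_self hd
  rw [hq.bilin_sub_left hu hv hd] at h3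
  have h4 := hQ.nonneg _ hd
  have h5 : inner ℝ (u - v) (u - v) = ‖u - v‖ ^ 2 := real_inner_self_eq_norm_sq _
  rw [inner_sub_left] at h5
  have h6 : a * ‖u - v‖ ^ 2 ≤ 0 := by rw [← h5]; linarith
  have h7 : ‖u - v‖ ^ 2 ≤ 0 := by
    by_contra hcon
    push Not at hcon
    linarith [mul_pos ha hcon]
  have h8 : ‖u - v‖ = 0 := by nlinarith [norm_nonneg (u - v)]
  exact sub_eq_zero.1 (norm_eq_zero.1 h8)

theorem weak_solution_norm_le {a : ℝ} {f u : L2Space m} (hu : u ∈ Q.domain)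
    (hfu : ∀ g ∈ Q.domain, Q.bilin u g + a * inner ℝ u g = inner ℝ f g) : a * ‖u‖ ≤ ‖f‖ := by
  have h1 := hfu u hu
  rw [hQ.isQuadratic.bilin_self hu, real_inner_self_eq_norm_sq] at h1
  have h2 := hQ.nonneg u hu
  have h3 := real_inner_le_norm f u
  rcases (norm_nonneg u).eq_or_lt with h | h
  · rw [← h]; simp
  · refine le_of_mul_le_mul_right ?_ h
    nlinarith

theorem exists_isResolvent {a : ℝ} (ha : 0 < a) : ∃ G, Q.IsResolvent a G := by
  have hq := hQ.isQuadratic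
  choose G hG hGf using hQ.exists_weak_solution ha
  refine ⟨LinearMap.mkContinuous
    { toFun := G
      map_add' := fun f g => hQ.weak_solution_unique ha (hG _) (hq.add_mem (hG f) (hG g)) (hGf _)
        fun h hh => ?_
      map_smul' := fun c f => hQ.weak_solution_unique ha (hG _) (hq.smul_mem (c : ℝ) (hG f)) (hGf _)
        fun h hh => ?_ } a⁻¹ fun f => ?_, fun f => ⟨hG f, hGf f⟩⟩
  · rw [hq.bilin_add_left (hG f) (hG g) hh, inner_add_left, inner_add_left, ← hGf f h hh,
      ← hGf g h hh]
    ring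
  · rw [RingHom.id_apply, hq.bilin_smul_left c (hG f) hh, inner_smul_left, inner_smul_left,
      ← hGf f h hh]
    simp only [conj_trivial]
    ring
  · rw [inv_mul_eq_div, le_div_iff₀ ha, mul_comm]
    exact hQ.weak_solution_norm_le (hG f) (hGf f)

end IsDirichlet

/-- The resolvent `(L + a)⁻¹` of a Dirichlet form for `a > 0` (and `0` if there is none). -/
noncomputable def resolvent (Q : L2Form m) (a : ℝ) : L2Space m →L[ℝ] L2Space m :=
  open Classical in if h : ∃ G, Q.IsResolvent a G then h.choose else 0

/-- The approximating forms `a ⟨u - a (L + a)⁻¹ u, v⟩`. They are defined on all of `L²` and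
converge to `Q` as `a → ∞`. -/
noncomputable def approx (Q : L2Form m) (a : ℝ) (u v : L2Space m) : ℝ :=
  a * (inner ℝ u v - a * inner ℝ (Q.resolvent a u) v)

namespace IsDirichlet

variable {Q : L2Form m} (hQ : Q.IsDirichlet) {a : ℝ} (ha : 0 < a)
include hQ ha

theorem isResolvent : Q.IsResolvent a (Q.resolvent a) := by
  have h := hQ.exists_isResolvent ha
  rw [resolvent, dif_pos h]
  exact h.choose_spec

theorem resolvent_mem (f : L2Space m) : Q.resolvent a f ∈ Q.domain :=
  (hQ.isResolvent ha f).1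

theorem bilin_resolvent (f : L2Space m) {g : L2Space m} (hg : g ∈ Q.domain) :
    Q.bilin (Q.resolvent a f) g = inner ℝ f g - a * inner ℝ (Q.resolvent a f) g := by
  linarith [(hQ.isResolvent ha f).2 g hg]

theorem eq_resolvent {f u : L2Space m} (hu : u ∈ Q.domain)
    (h : ∀ g ∈ Q.domain, Q.bilin u g + a * inner ℝ u g = inner ℝ f g) : u = Q.resolvent a f :=
  hQ.weak_solution_unique ha hu (hQ.resolvent_mem ha f) h (hQ.isResolvent ha f).2

theorem norm_resolvent_le (f : L2Space m) : a * ‖Q.resolvent a f‖ ≤ ‖f‖ :=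
  hQ.weak_solution_norm_le (hQ.resolvent_mem ha f) (hQ.isResolvent ha f).2

theorem inner_resolvent_comm (f g : L2Space m) :
    inner ℝ (Q.resolvent a f) g = inner ℝ (Q.resolvent a g) f := by
  have hf := hQ.resolvent_mem ha f
  have hg := hQ.resolvent_mem ha g
  have h1 := (hQ.isResolvent ha f).2 _ hg
  have h2 := (hQ.isResolvent ha g).2 _ hf
  rw [hQ.isQuadratic.bilin_comm hf hg, real_inner_comm] at h1
  rw [real_inner_comm g, ← h2, h1, real_inner_comm]

/-- `a (L + a)⁻¹` preserves the functions with values in `[0, 1]`. Indeed `a (L + a)⁻¹ f` is the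
unique minimiser of `Q(v) + a ‖v - f‖²`, and the unit contraction does not increase this
functional. -/
theorem resolvent_mem_unit {f : L2Space m} (h0 : 0 ≤ f) (h1 : ∀ᵐ x ∂m, f x ≤ 1) :
    0 ≤ a • Q.resolvent a f ∧ ∀ᵐ x ∂m, (a • Q.resolvent a f) x ≤ 1 := by
  have hq := hQ.isQuadratic
  set w := a • Q.resolvent a f with hw
  have hwd : w ∈ Q.domain := hq.smul_mem a (hQ.resolvent_mem ha f)
  obtain ⟨hvd, hv⟩ := hQ.markov w hwd
  have hcoe : ∀ᵐ x ∂m, w.unitCut x = min (max (w x) 0) 1 := (L2Space.memLp_unitCut w).coeFn_toLp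
  set v := w.unitCut
  have hnorm : ‖v - f‖ ≤ ‖w - f‖ := by
    refine Lp.norm_le_norm_of_ae_le ?_
    filter_upwards [hcoe, Lp.coeFn_sub v f, Lp.coeFn_sub w f, L2Space.nonneg_iff.1 h0, h1]
      with x e1 e2 e3 e4 e5
    rw [e2, e3, Pi.sub_apply, Pi.sub_apply, e1, Real.norm_eq_abs, Real.norm_eq_abs]
    have e6 : min (max (f x) 0) 1 = f x := by rw [max_eq_left e4, min_eq_left e5]
    calc |min (max (w x) 0) 1 - f x| = |min (max (w x) 0) 1 - min (max (f x) 0) 1| := by rw [e6]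
      _ ≤ |w x - f x| := by
        simpa [Real.dist_eq] using
          ((LipschitzWith.id (α := ℝ)).max_const 0 |>.min_const 1).dist_le_mul (w x) (f x)
  have hdd := hq.sub_mem hvd hwd
  have horth : Q.bilin w (v - w) + a * inner ℝ (w - f) (v - w) = 0 := by
    rw [hw, hq.bilin_smul_left a (hQ.resolvent_mem ha f) hdd, hQ.bilin_resolvent ha f hdd,
      inner_sub_left (𝕜 := ℝ) (a • _), inner_smul_left]
    simp only [conj_trivial]
    ring
  have e1 : Q.val v = Q.val (v - w) + 2 * Q.bilin w (v - w) + Q.val w := by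
    conv_lhs => rw [← sub_add_cancel v w]
    rw [hq.val_add hdd hwd, hq.bilin_comm hdd hwd]
  have e2 : ‖v - f‖ ^ 2 = ‖v - w‖ ^ 2 + 2 * inner ℝ (w - f) (v - w) + ‖w - f‖ ^ 2 := by
    rw [← sub_add_sub_cancel v w f, norm_add_sq_real, real_inner_comm]
  have e3 := hQ.nonneg _ hdd
  have e4 : ‖v - f‖ ^ 2 ≤ ‖w - f‖ ^ 2 := pow_le_pow_left₀ (norm_nonneg _) hnorm 2
  have e5 : a * ‖v - w‖ ^ 2 ≤ 0 := by nlinarith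
  have e6 : ‖v - w‖ ^ 2 ≤ 0 := by
    by_contra hcon
    push Not at hcon
    linarith [mul_pos ha hcon]
  have e7 : v = w := sub_eq_zero.1 (norm_eq_zero.1 (by nlinarith [norm_nonneg (v - w)]))
  rw [← e7, L2Space.nonneg_iff]
  constructor
  · filter_upwards [hcoe] with x hx
    rw [hx]
    exact le_min (le_max_right _ _) zero_le_one
  · filter_upwards [hcoe] with x hx
    rw [hx]
    exact min_le_right _ _

theorem resolvent_nonneg {f : L2Space m} (h0 : 0 ≤ f) : 0 ≤ Q.resolvent a f := by
  have hb : ∀ n : ℕ, 0 ≤ Q.resolvent a (L2Space.trunc (n : ℝ≥0) f) := by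
    intro n
    have hc : (0 : ℝ) < (n : ℝ) + 1 := by positivity
    have h := (hQ.resolvent_mem_unit ha (f := ((n : ℝ) + 1)⁻¹ • L2Space.trunc (n : ℝ≥0) f) ?_ ?_).1
    · have h2 := L2Space.smul_nonneg (c := a⁻¹ * ((n : ℝ) + 1)) (by positivity) h
      rw [map_smul, smul_smul, smul_smul] at h2
      rwa [show a⁻¹ * ((n : ℝ) + 1) * a * ((n : ℝ) + 1)⁻¹ = 1 by field_simp, one_smul] at h2
    · refine L2Space.smul_nonneg (by positivity) ?_
      rw [L2Space.nonneg_iff] at *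
      filter_upwards [h0, L2Space.coeFn_trunc n f] with x h1 h2
      rw [h2]
      exact le_max_of_le_right (le_min h1 (NNReal.coe_nonneg _))
    · filter_upwards [L2Space.coeFn_trunc n f, Lp.coeFn_smul ((n : ℝ) + 1)⁻¹
        (L2Space.trunc (n : ℝ≥0) f)] with x h1 h2
      rw [h2, Pi.smul_apply, h1, smul_eq_mul, inv_mul_eq_div, div_le_one hc]
      have := (le_abs_self _).trans (L2Space.abs_cap_le n (f x))
      simp only [NNReal.coe_natCast] at this
      linarith
  exact ge_of_tendsto' (((Q.resolvent a).continuous.tendsto f).comp (L2Space.tendsto_trunc f)) hb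

/-! ### The approximating forms -/

theorem approx_eq_bilin (u : L2Space m) {v : L2Space m} (hv : v ∈ Q.domain) :
    Q.approx a u v = Q.bilin (a • Q.resolvent a u) v := by
  rw [hQ.isQuadratic.bilin_smul_left a (hQ.resolvent_mem ha u) hv, hQ.bilin_resolvent ha u hv,
    approx]

theorem approx_self_eq (u : L2Space m) : Q.approx a u u =
    a * ‖u - a • Q.resolvent a u‖ ^ 2 + Q.val (a • Q.resolvent a u) := by
  have hd := hQ.isQuadratic.smul_mem a (hQ.resolvent_mem ha u)
  have h1 := hQ.approx_eq_bilin ha u hd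
  rw [hQ.isQuadratic.bilin_self hd] at h1
  rw [← h1, norm_sub_sq_real, approx, approx, norm_smul, inner_smul_right, inner_smul_right,
    mul_pow, ← real_inner_self_eq_norm_sq u, ← real_inner_self_eq_norm_sq (Q.resolvent a u),
    Real.norm_eq_abs, sq_abs, real_inner_comm u (Q.resolvent a u)]
  ring

theorem approx_self_le {u : L2Space m} (hu : u ∈ Q.domain) : Q.approx a u u ≤ Q.val u := by
  have hd := hQ.isQuadratic.smul_mem a (hQ.resolvent_mem ha u)
  have h1 := hQ.approx_eq_bilin ha u hu
  have h2 := hQ.approx_self_eq ha u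
  have h3 := hQ.isQuadratic.val_sub hu hd
  have h4 := hQ.nonneg _ (hQ.isQuadratic.sub_mem hu hd)
  rw [hQ.isQuadratic.bilin_comm hu hd] at h3
  have h5 : 0 ≤ a * ‖u - a • Q.resolvent a u‖ ^ 2 := by positivity
  linarith

omit ha

/-- If the approximating forms stay bounded at `u`, then `a (L + a)⁻¹ u → u` in `L²`, because
`a ‖u - a (L + a)⁻¹ u‖²` is bounded. -/
theorem tendsto_smul_resolvent_of_le {u : L2Space m} {c : ℝ}
    (h : ∀ n : ℕ, Q.approx ((n : ℝ) + 1) u u ≤ c) :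
    Tendsto (fun n : ℕ => ((n : ℝ) + 1) • Q.resolvent ((n : ℝ) + 1) u) atTop (𝓝 u) := by
  rw [tendsto_iff_norm_sub_tendsto_zero]
  have h1 : Tendsto (fun n : ℕ => √(c * (1 / ((n : ℝ) + 1)))) atTop (𝓝 0) := by
    have := (tendsto_one_div_add_atTop_nhds_zero_nat (𝕜 := ℝ)).const_mul c
    rw [mul_zero] at this
    have h2 := (Real.continuous_sqrt.tendsto 0).comp this
    rwa [Real.sqrt_zero] at h2
  refine squeeze_zero (fun _ => norm_nonneg _) (fun n => ?_) h1
  have hp : (0 : ℝ) < (n : ℝ) + 1 := by positivity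
  refine Real.le_sqrt_of_sq_le ?_
  rw [mul_one_div, le_div_iff₀ hp, norm_sub_rev]
  have h2 := hQ.approx_self_eq hp u
  have h3 := hQ.nonneg _ (hQ.isQuadratic.smul_mem ((n : ℝ) + 1) (hQ.resolvent_mem hp u))
  linarith [h n]

theorem mem_domain_of_approx_le {u : L2Space m} {c : ℝ}
    (h : ∀ n : ℕ, Q.approx ((n : ℝ) + 1) u u ≤ c) : u ∈ Q.domain ∧ Q.val u ≤ c := by
  have hp : ∀ n : ℕ, (0 : ℝ) < (n : ℝ) + 1 := fun n => by positivity
  refine hQ.isClosedForm.mem_domain_and_val_le hQ.isQuadratic hQ.nonneg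
    (fun n => hQ.isQuadratic.smul_mem _ (hQ.resolvent_mem (hp n) u)) (fun n => ?_)
    (hQ.tendsto_smul_resolvent_of_le h)
  have h2 := hQ.approx_self_eq (hp n) u
  have h3 : 0 ≤ ((n : ℝ) + 1) * ‖u - ((n : ℝ) + 1) • Q.resolvent ((n : ℝ) + 1) u‖ ^ 2 := by
    positivity
  linarith [h n]

/-- `a (L + a)⁻¹ u → u` in the form norm as `a → ∞`, for `u ∈ D(Q)`. -/
theorem tendsto_val_smul_resolvent_sub {u : L2Space m} (hu : u ∈ Q.domain) :
    Tendsto (fun n : ℕ => Q.val (((n : ℝ) + 1) • Q.resolvent ((n : ℝ) + 1) u - u)) atTop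
      (𝓝 0) := by
  have hq := hQ.isQuadratic
  have hp : ∀ n : ℕ, (0 : ℝ) < (n : ℝ) + 1 := fun n => by positivity
  set w : ℕ → L2Space m := fun n => ((n : ℝ) + 1) • Q.resolvent ((n : ℝ) + 1) u with hw
  have hwd : ∀ n, w n ∈ Q.domain := fun n => hq.smul_mem _ (hQ.resolvent_mem (hp n) u)
  have hle : ∀ n : ℕ, Q.approx ((n : ℝ) + 1) u u ≤ Q.val u := fun n => hQ.approx_self_le (hp n) hu
  have hwlim := hQ.tendsto_smul_resolvent_of_le hle
  have hwu : ∀ n, Q.val (w n) ≤ Q.bilin (w n) u := by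
    intro n
    have h1 := hQ.approx_self_eq (hp n) u
    have h2 := hQ.approx_eq_bilin (hp n) u hu
    have h3 : 0 ≤ ((n : ℝ) + 1) * ‖u - ((n : ℝ) + 1) • Q.resolvent ((n : ℝ) + 1) u‖ ^ 2 := by
      positivity
    simp only [hw]
    linarith
  have hwu2 : ∀ n, Q.bilin (w n) u ≤ Q.val u := fun n => by
    rw [← hQ.approx_eq_bilin (hp n) u hu]; exact hle n
  -- By lower semicontinuity the values `Q (w n)` cannot drop below `Q u` infinitely often.
  have hev : ∀ ε > 0, ∀ᶠ n in atTop, Q.val u - ε < Q.val (w n) := by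
    intro ε hε
    by_contra hcon
    rw [not_eventually] at hcon
    obtain ⟨ns, hns, hns2⟩ := extraction_of_frequently_atTop hcon
    have := (hQ.isClosedForm.mem_domain_and_val_le hq hQ.nonneg (u := w ∘ ns)
      (fun n => hwd _) (fun n => not_lt.1 (hns2 n)) (hwlim.comp hns.tendsto_atTop)).2
    linarith
  rw [Metric.tendsto_atTop]
  intro ε hε
  obtain ⟨N, hN⟩ := eventually_atTop.1 (hev (ε / 2) (half_pos hε))
  refine ⟨N, fun n hn => ?_⟩
  rw [Real.dist_eq, sub_zero, abs_of_nonneg (hQ.nonneg _ (hq.sub_mem (hwd n) hu)),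
    hq.val_sub (hwd n) hu]
  linarith [hN n hn, hwu n, hwu2 n]

theorem tendsto_approx {u v : L2Space m} (hu : u ∈ Q.domain) (hv : v ∈ Q.domain) :
    Tendsto (fun n : ℕ => Q.approx ((n : ℝ) + 1) u v) atTop (𝓝 (Q.bilin u v)) := by
  have hp : ∀ n : ℕ, (0 : ℝ) < (n : ℝ) + 1 := fun n => by positivity
  refine (hQ.isQuadratic.tendsto_bilin hQ.nonneg (fun n => hQ.isQuadratic.smul_mem _
    (hQ.resolvent_mem (hp n) u)) hu hv (hQ.tendsto_val_smul_resolvent_sub hu)).congr fun n => ?_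
  rw [hQ.approx_eq_bilin (hp n) u hv]

/-- Bounded sequences in `D(Q)` which converge in `L²` converge weakly with respect to `Q`. -/
theorem tendsto_bilin_of_bounded {u : ℕ → L2Space m} {f g : L2Space m} {c : ℝ}
    (hu : ∀ n, u n ∈ Q.domain) (huc : ∀ n, Q.val (u n) ≤ c) (hlim : Tendsto u atTop (𝓝 f))
    (hg : g ∈ Q.domain) : Tendsto (fun n => Q.bilin (u n) g) atTop (𝓝 (Q.bilin f g)) := by
  have hq := hQ.isQuadratic
  obtain ⟨hf, hfc⟩ := hQ.isClosedForm.mem_domain_and_val_le hq hQ.nonneg hu huc hlim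
  have hp : ∀ n : ℕ, (0 : ℝ) < (n : ℝ) + 1 := fun n => by positivity
  have hcc : ∀ n, √(Q.val (u n - f)) ≤ √(4 * c) := fun n =>
    Real.sqrt_le_sqrt ((hq.val_sub_le hQ.nonneg (hu n) hf).trans (by linarith [huc n]))
  rw [Metric.tendsto_atTop]
  intro ε hε
  -- `g` is approximated in the form norm by `h = a (L + a)⁻¹ g`, for which `Q(·, h)` is
  -- continuous on `L²`.
  obtain ⟨k, hk⟩ : ∃ k : ℕ, √(4 * c) *
      √(Q.val (((k : ℝ) + 1) • Q.resolvent ((k : ℝ) + 1) g - g)) < ε / 2 := by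
    have h1 := (Real.continuous_sqrt.tendsto 0).comp (hQ.tendsto_val_smul_resolvent_sub hg)
    have h2 := h1.const_mul √(4 * c)
    rw [Real.sqrt_zero, mul_zero] at h2
    exact (h2.eventually (gt_mem_nhds (half_pos hε))).exists
  set h := ((k : ℝ) + 1) • Q.resolvent ((k : ℝ) + 1) g with hh
  have hhd : h ∈ Q.domain := hq.smul_mem _ (hQ.resolvent_mem (hp k) g)
  have hcont : Tendsto (fun n => Q.bilin (u n - f) h) atTop (𝓝 0) := by
    have h1 : Tendsto (fun n => Q.approx ((k : ℝ) + 1) g (u n - f)) atTop (𝓝 0) := by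
      have h0 : Tendsto (fun n => u n - f) atTop (𝓝 0) := by simpa using hlim.sub_const f
      have h2 : Tendsto (fun n => Q.approx ((k : ℝ) + 1) g (u n - f)) atTop
          (𝓝 (Q.approx ((k : ℝ) + 1) g 0)) :=
        ((tendsto_const_nhds.inner h0).sub ((tendsto_const_nhds.inner h0).const_mul _)).const_mul _
      simpa [approx] using h2
    refine h1.congr fun n => ?_
    have hd := hq.sub_mem (hu n) hf
    rw [hQ.approx_eq_bilin (hp k) g hd, hq.bilin_comm hd hhd]
  obtain ⟨N, hN⟩ := Metric.tendsto_atTop.1 hcont (ε / 2) (half_pos hε)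
  refine ⟨N, fun n hn => ?_⟩
  have hd := hq.sub_mem (hu n) hf
  have e1 := hN n hn
  rw [Real.dist_eq, sub_zero] at e1
  have e2 := hq.abs_bilin_le hQ.nonneg hd (hq.sub_mem hhd hg)
  have e3 := mul_le_mul_of_nonneg_right (hcc n) (Real.sqrt_nonneg (Q.val (h - g)))
  rw [Real.dist_eq, ← hq.bilin_sub_left (hu n) hf hg]
  have e4 : Q.bilin (u n - f) g = Q.bilin (u n - f) h - Q.bilin (u n - f) (h - g) := by
    rw [hq.bilin_sub_right hhd hg hd]; ring
  rw [e4]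
  have e5 := abs_sub (Q.bilin (u n - f) h) (Q.bilin (u n - f) (h - g))
  linarith

end IsDirichlet

end L2Form

/-! ### Inequalities for symmetric sub-Markov operators and Dirichlet forms -/

namespace L2Space

variable {X : Type*} [MeasurableSpace X] {m : Measure X}

theorem coeFn_sum {ι : Type*} (s : Finset ι) (u : ι → L2Space m) :
    ∀ᵐ x ∂m, (∑ i ∈ s, u i : L2Space m) x = ∑ i ∈ s, u i x := by
  classical
  induction s using Finset.induction_on with
  | empty =>
    filter_upwards [Lp.coeFn_zero ℝ 2 m] with x hx
    simpa using hx
  | insert i s hi ih =>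
    filter_upwards [ih, Lp.coeFn_add (u i) (∑ j ∈ s, u j)] with x h1 h2
    rw [Finset.sum_insert hi, Finset.sum_insert hi, h2, Pi.add_apply, h1]

/-- A positive operator `A` on `L²` acts like integration against a positive measure on
`X × X`: if `∑ uᵢ(x) vᵢ(y) ≥ 0` for almost all `x, y`, then `∑ ⟨A uᵢ, vᵢ⟩ ≥ 0`. For fixed `y`,
`∑ vᵢ(y) A uᵢ ≥ 0` almost everywhere. Since the coefficient vectors `(vᵢ(y))ᵢ` range in a
separable set, the exceptional null set can be chosen independently of `y`, and one can then put
the argument equal to `y`. -/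
theorem sum_inner_map_nonneg {ι : Type*} [Fintype ι] {A : L2Space m →L[ℝ] L2Space m}
    (hA : ∀ f, 0 ≤ f → 0 ≤ A f) {u v : ι → L2Space m}
    (h : ∀ᵐ y ∂m, ∀ᵐ x ∂m, 0 ≤ ∑ i, u i x * v i y) : 0 ≤ ∑ i, inner ℝ (A (u i)) (v i) := by
  set V : X → ι → ℝ := fun y i => v i y with hV
  set S : Set X := {y | ∀ᵐ x ∂m, 0 ≤ ∑ i, u i x * v i y} with hS
  obtain ⟨t, htS, htc, htd⟩ := (TopologicalSpace.IsSeparable.of_separableSpace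
    (V '' S)).exists_countable_dense_subset
  have h1 : ∀ c ∈ t, ∀ᵐ z ∂m, 0 ≤ ∑ i, c i * A (u i) z := by
    intro c hc
    obtain ⟨y, hy, rfl⟩ := htS hc
    have hpos : 0 ≤ ∑ i, V y i • u i := by
      rw [nonneg_iff]
      filter_upwards [coeFn_sum Finset.univ fun i => V y i • u i,
        ae_all_iff.2 fun i => Lp.coeFn_smul (V y i) (u i), hy] with x e1 e2 e3
      rw [e1]
      refine e3.trans_eq (Finset.sum_congr rfl fun i _ => ?_)
      rw [e2, Pi.smul_apply, smul_eq_mul, mul_comm]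
    have hpos2 := hA _ hpos
    rw [map_sum, nonneg_iff] at hpos2
    filter_upwards [hpos2, coeFn_sum Finset.univ fun i => A (V y i • u i),
      ae_all_iff.2 fun i => Lp.coeFn_smul (V y i) (A (u i))] with x e1 e2 e3
    rw [e2] at e1
    refine e1.trans_eq (Finset.sum_congr rfl fun i _ => ?_)
    rw [map_smul, e3, Pi.smul_apply, smul_eq_mul]
  have h2 : ∀ᵐ z ∂m, ∀ c ∈ t, 0 ≤ ∑ i, c i * A (u i) z := (ae_ball_iff htc).2 h1
  have h3 : ∀ᵐ z ∂m, 0 ≤ ∑ i, A (u i) z * v i z := by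
    filter_upwards [h2, h] with z hz hzS
    have hcl : IsClosed {c : ι → ℝ | 0 ≤ ∑ i, c i * A (u i) z} :=
      isClosed_le continuous_const (by fun_prop)
    have := closure_minimal (fun c hc => hz c hc) hcl (htd ⟨z, hzS, rfl⟩)
    refine le_of_le_of_eq this (Finset.sum_congr rfl fun i _ => mul_comm _ _)
  simp only [inner_eq]
  rw [← integral_finsetSum _ fun i _ => integrable_mul _ _]
  exact integral_nonneg_of_ae h3

/-- For a symmetric sub-Markov operator `A` the form `⟨u, v⟩ - ⟨A u, v⟩` acts like the sum of an
integral of `(u(x) - u(y)) (v(x) - v(y)) / 2` against a positive measure on `X × X` and of an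
integral of `u(x) v(x)` against a positive measure on `X`. The proof reduces this to
`sum_inner_map_nonneg` by cutting off to sets `E` of finite measure on which all functions are
bounded, where the diagonal part can be estimated by means of `A 1_E ≤ 1`. -/
theorem sum_inner_sub_inner_map_nonneg [SigmaFinite m] {ι : Type*} [Fintype ι]
    {A : L2Space m →L[ℝ] L2Space m} (hA : ∀ f, 0 ≤ f → 0 ≤ A f)
    (hAs : ∀ f g, inner ℝ (A f) g = inner ℝ (A g) f)
    (hA1 : ∀ f : L2Space m, 0 ≤ f → (∀ᵐ x ∂m, f x ≤ 1) → ∀ᵐ x ∂m, A f x ≤ 1)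
    {u v : ι → L2Space m} (hdiag : ∀ᵐ x ∂m, 0 ≤ ∑ i, u i x * v i x)
    (hpair : ∀ᵐ y ∂m, ∀ᵐ x ∂m, 0 ≤ ∑ i, (u i x - u i y) * (v i x - v i y)) :
    0 ≤ ∑ i, (inner ℝ (u i) (v i) - inner ℝ (A (u i)) (v i)) := by
  set E : ℕ → Set X := fun n =>
    spanningSets m n ∩ ⋂ i, ({x | |u i x| ≤ n} ∩ {x | |v i x| ≤ n}) with hE
  have hEm : ∀ n, MeasurableSet (E n) := fun n =>
    (measurableSet_spanningSets m n).inter (MeasurableSet.iInter fun i =>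
      (measurableSet_le (Lp.stronglyMeasurable (u i)).measurable.abs measurable_const).inter
        (measurableSet_le (Lp.stronglyMeasurable (v i)).measurable.abs measurable_const))
  have hEfin : ∀ n, m (E n) ≠ ∞ := fun n =>
    ((measure_mono Set.inter_subset_left).trans_lt (measure_spanningSets_lt_top m n)).ne
  have hEev : ∀ x, ∀ᶠ n in atTop, x ∈ E n := by
    intro x
    have h1 : ∀ᶠ n in atTop, x ∈ spanningSets m n := by
      filter_upwards [eventually_ge_atTop (spanningSetsIndex m x)] with n hn
      exact monotone_spanningSets m hn (mem_spanningSetsIndex m x)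
    have h2 : ∀ᶠ n : ℕ in atTop, ∀ i, |u i x| ≤ n ∧ |v i x| ≤ n := by
      rw [eventually_all]
      intro i
      obtain ⟨N, hN⟩ := exists_nat_ge (max |u i x| |v i x|)
      filter_upwards [eventually_ge_atTop N] with n hn
      have : (N : ℝ) ≤ n := by exact_mod_cast hn
      exact ⟨((le_max_left _ _).trans hN).trans this, ((le_max_right _ _).trans hN).trans this⟩
    filter_upwards [h1, h2] with n e1 e2
    exact ⟨e1, Set.mem_iInter.2 e2⟩
  set cut : ℕ → L2Space m → L2Space m := fun n f => ((Lp.memLp f).indicator (hEm n)).toLp _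
    with hcut
  have hcutx : ∀ n f, ∀ᵐ x ∂m, cut n f x = (E n).indicator f x := fun n f => MemLp.coeFn_toLp _
  have hcutlim : ∀ f, Tendsto (fun n => cut n f) atTop (𝓝 f) := by
    intro f
    refine tendsto_of_dominated (g := f) (fun n => ?_) ?_
    · filter_upwards [hcutx n f] with x hx
      rw [hx]
      by_cases h : x ∈ E n
      · rw [Set.indicator_of_mem h]
      · rw [Set.indicator_of_notMem h, abs_zero]; exact abs_nonneg _
    · filter_upwards [ae_all_iff.2 fun n => hcutx n f] with x hx
      refine tendsto_const_nhds.congr' ?_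
      filter_upwards [hEev x] with n hn
      rw [hx, Set.indicator_of_mem hn]
  have hlim : Tendsto (fun n => ∑ i, (inner ℝ (cut n (u i)) (cut n (v i)) -
      inner ℝ (A (cut n (u i))) (cut n (v i)))) atTop
      (𝓝 (∑ i, (inner ℝ (u i) (v i) - inner ℝ (A (u i)) (v i)))) :=
    tendsto_finsetSum _ fun i _ => ((hcutlim (u i)).inner (hcutlim (v i))).sub
      (((A.continuous.tendsto _).comp (hcutlim (u i))).inner (hcutlim (v i)))
  refine ge_of_tendsto' hlim fun n => ?_
  -- The diagonal function, cut off to `E n`.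
  have hSm : MemLp ((E n).indicator fun x => ∑ i, u i x * v i x) 2 m := by
    refine (memLp_indicator_const (μ := m) 2 (hEm n) (Fintype.card ι * ((n : ℝ) * n))
      (Or.inr (hEfin n))).mono ?_ (Eventually.of_forall fun x => ?_)
    · refine (AEStronglyMeasurable.indicator ?_ (hEm n))
      exact Finset.aestronglyMeasurable_fun_sum _ fun i _ =>
        (Lp.memLp (u i)).1.mul (Lp.memLp (v i)).1
    · by_cases h : x ∈ E n
      · rw [Set.indicator_of_mem h, Set.indicator_of_mem h, Real.norm_eq_abs, Real.norm_eq_abs,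
          abs_of_nonneg (a := _ * _) (by positivity)]
        refine (Finset.abs_sum_le_sum_abs _ _).trans ?_
        rw [← nsmul_eq_mul, ← Finset.card_univ, ← Finset.sum_const]
        refine Finset.sum_le_sum fun i _ => ?_
        have := Set.mem_iInter.1 h.2 i
        rw [abs_mul]
        exact mul_le_mul this.1 this.2 (abs_nonneg _) (Nat.cast_nonneg n)
      · rw [Set.indicator_of_notMem h, Set.indicator_of_notMem h]
  set S : L2Space m := hSm.toLp _ with hS
  have hSx : ∀ᵐ x ∂m, S x = (E n).indicator (fun x => ∑ i, u i x * v i x) x := MemLp.coeFn_toLp _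
  set I : L2Space m := indicatorConstLp 2 (hEm n) (hEfin n) (1 : ℝ) with hI
  have hIx : ∀ᵐ x ∂m, I x = (E n).indicator (fun _ => (1 : ℝ)) x := indicatorConstLp_coeFn
  have hux := ae_all_iff.2 fun i => hcutx n (u i)
  have hvx := ae_all_iff.2 fun i => hcutx n (v i)
  have key := sum_inner_map_nonneg hA
    (u := Sum.elim (Sum.elim (fun i => -cut n (u i)) (fun i => -cut n (v i)))
      (Sum.elim (fun _ : Unit => S) (fun _ : Unit => I)))
    (v := Sum.elim (Sum.elim (fun i => cut n (v i)) (fun i => cut n (u i)))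
      (Sum.elim (fun _ : Unit => I) (fun _ : Unit => S))) (by
    filter_upwards [hpair, hux, hvx, hSx, hIx] with y hy y1 y2 y3 y4
    filter_upwards [hy, hux, hvx, hSx, hIx, ae_all_iff.2 fun i => Lp.coeFn_neg (cut n (u i)),
      ae_all_iff.2 fun i => Lp.coeFn_neg (cut n (v i))] with x hx x1 x2 x3 x4 x5 x6
    simp only [Fintype.sum_sum_type, Sum.elim_inl, Sum.elim_inr, Finset.univ_unique,
      Finset.sum_singleton, x5, x6, Pi.neg_apply, x1, x2, x3, x4, y1, y2, y3, y4]
    by_cases hxE : x ∈ E n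
    · by_cases hyE : y ∈ E n
      · simp only [Set.indicator_of_mem hxE, Set.indicator_of_mem hyE]
        refine hx.trans_eq ?_
        rw [mul_one, one_mul, ← Finset.sum_add_distrib, ← Finset.sum_add_distrib,
          ← Finset.sum_add_distrib]
        exact Finset.sum_congr rfl fun i _ => by ring
      · simp [Set.indicator_of_notMem hyE]
    · simp [Set.indicator_of_notMem hxE])
  simp only [Fintype.sum_sum_type, Sum.elim_inl, Sum.elim_inr, Finset.univ_unique,
    Finset.sum_singleton, map_neg, inner_neg_left] at key
  have hsym : ∀ i, inner ℝ (A (cut n (v i))) (cut n (u i)) =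
      inner ℝ (A (cut n (u i))) (cut n (v i)) := fun i => hAs _ _
  simp only [hsym] at key
  rw [hAs S I] at key
  have hI0 : 0 ≤ I := by
    rw [nonneg_iff]
    filter_upwards [hIx] with x hx
    rw [hx]
    exact Set.indicator_nonneg (fun _ _ => zero_le_one) x
  have hI1 : ∀ᵐ x ∂m, I x ≤ 1 := by
    filter_upwards [hIx] with x hx
    rw [hx]
    exact Set.indicator_le_self' (fun _ _ => zero_le_one) x
  have hle : inner ℝ (A I) S ≤ ∑ i, inner ℝ (cut n (u i)) (cut n (v i)) := by
    simp only [inner_eq]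
    rw [← integral_finsetSum _ fun i _ => integrable_mul _ _]
    refine integral_mono_ae (integrable_mul _ _)
      (integrable_finsetSum _ fun i _ => integrable_mul _ _) ?_
    filter_upwards [hA1 I hI0 hI1, hux, hvx, hSx, hdiag] with x e1 e2 e3 e4 e5
    simp only [e2, e3, e4]
    by_cases h : x ∈ E n
    · simp only [Set.indicator_of_mem h]
      exact mul_le_of_le_one_left e5 e1
    · simp [Set.indicator_of_notMem h]
  rw [Finset.sum_sub_distrib]
  simp only [Finset.sum_neg_distrib] at key
  linarith

end L2Space

namespace L2Form

variable {X : Type*} [MeasurableSpace X] {m : Measure X} [SigmaFinite m]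

namespace IsDirichlet

variable {Q : L2Form m} (hQ : Q.IsDirichlet)
include hQ

theorem sum_approx_nonneg {a : ℝ} (ha : 0 < a) {ι : Type*} [Fintype ι] (c : ι → ℝ)
    {u v : ι → L2Space m} (hdiag : ∀ᵐ x ∂m, 0 ≤ ∑ i, c i * (u i x * v i x))
    (hpair : ∀ᵐ y ∂m, ∀ᵐ x ∂m, 0 ≤ ∑ i, c i * ((u i x - u i y) * (v i x - v i y))) :
    0 ≤ ∑ i, c i * Q.approx a (u i) (v i) := by
  have hcoe := ae_all_iff.2 fun i => Lp.coeFn_smul (c i) (u i)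
  have h := L2Space.sum_inner_sub_inner_map_nonneg (A := a • Q.resolvent a)
    (u := fun i => c i • u i) (v := v)
    (fun f hf => L2Space.smul_nonneg ha.le (hQ.resolvent_nonneg ha hf))
    (fun f g => by
      simp only [smul_apply, inner_smul_left]
      rw [hQ.inner_resolvent_comm ha])
    (fun f h0 h1 => (hQ.resolvent_mem_unit ha h0 h1).2)
    (by
      filter_upwards [hdiag, hcoe] with x h1 h2
      refine h1.trans_eq (Finset.sum_congr rfl fun i _ => ?_)
      rw [h2, Pi.smul_apply, smul_eq_mul, mul_assoc])
    (by
      filter_upwards [hpair, hcoe] with y h1 h2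
      filter_upwards [h1, hcoe] with x h3 h4
      refine h3.trans_eq (Finset.sum_congr rfl fun i _ => ?_)
      rw [h2, h4, Pi.smul_apply, Pi.smul_apply, smul_eq_mul, smul_eq_mul]
      ring)
  have h2 := mul_nonneg ha.le h
  rw [Finset.mul_sum] at h2
  refine h2.trans_eq (Finset.sum_congr rfl fun i _ => ?_)
  simp only [approx, map_smul, smul_apply, inner_smul_left, conj_trivial]
  ring

/-- Pointwise inequalities between functions imply inequalities for Dirichlet forms, as if
`Q(u, v)` were an integral of `(u(x) - u(y)) (v(x) - v(y))` against a positive measure plus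
an integral of `u(x) v(x)` against another one. Here `U` and `V` are representatives, and the
inequalities only have to hold for the points with the almost sure property `p`. -/
theorem sum_bilin_nonneg {ι : Type*} [Fintype ι] (c : ι → ℝ)
    {u v : ι → L2Space m} (hu : ∀ i, u i ∈ Q.domain) (hv : ∀ i, v i ∈ Q.domain)
    {U V : ι → X → ℝ} (hU : ∀ i, ∀ᵐ x ∂m, u i x = U i x) (hV : ∀ i, ∀ᵐ x ∂m, v i x = V i x)
    {p : X → Prop} (hp : ∀ᵐ x ∂m, p x) (hdiag : ∀ x, p x → 0 ≤ ∑ i, c i * (U i x * V i x))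
    (hpair : ∀ x y, p x → p y → 0 ≤ ∑ i, c i * ((U i x - U i y) * (V i x - V i y))) :
    0 ≤ ∑ i, c i * Q.bilin (u i) (v i) := by
  have hlim : Tendsto (fun n : ℕ => ∑ i, c i * Q.approx ((n : ℝ) + 1) (u i) (v i)) atTop
      (𝓝 (∑ i, c i * Q.bilin (u i) (v i))) :=
    tendsto_finsetSum _ fun i _ => (hQ.tendsto_approx (hu i) (hv i)).const_mul _
  refine ge_of_tendsto' hlim fun n => hQ.sum_approx_nonneg (by positivity) c ?_ ?_
  · filter_upwards [hp, ae_all_iff.2 hU, ae_all_iff.2 hV] with x h1 h2 h3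
    simp only [h2, h3]
    exact hdiag x h1
  · filter_upwards [hp, ae_all_iff.2 hU, ae_all_iff.2 hV] with y h1 h2 h3
    filter_upwards [hp, ae_all_iff.2 hU, ae_all_iff.2 hV] with x h4 h5 h6
    simp only [h2, h3, h5, h6]
    exact hpair x y h4 h1

/-- A criterion for membership in the domain of a Dirichlet form: `g ∈ D(Q)` if `g` is dominated
by functions in `D(Q)` in the sense of `sum_bilin_nonneg`. -/
theorem mem_domain_of_le_sum {ι : Type*} [Fintype ι] (c : ι → ℝ)
    {u v : ι → L2Space m} (hu : ∀ i, u i ∈ Q.domain) (hv : ∀ i, v i ∈ Q.domain)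
    {U V : ι → X → ℝ} (hU : ∀ i, ∀ᵐ x ∂m, u i x = U i x) (hV : ∀ i, ∀ᵐ x ∂m, v i x = V i x)
    {g : L2Space m} {G : X → ℝ} (hG : ∀ᵐ x ∂m, g x = G x)
    {p : X → Prop} (hp : ∀ᵐ x ∂m, p x)
    (hdiag : ∀ x, p x → G x ^ 2 ≤ ∑ i, c i * (U i x * V i x))
    (hpair : ∀ x y, p x → p y → (G x - G y) ^ 2 ≤
      ∑ i, c i * ((U i x - U i y) * (V i x - V i y))) :
    g ∈ Q.domain ∧ Q.val g ≤ ∑ i, c i * Q.bilin (u i) (v i) := by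
  have hlim : Tendsto (fun n : ℕ => ∑ i, c i * Q.approx ((n : ℝ) + 1) (u i) (v i)) atTop
      (𝓝 (∑ i, c i * Q.bilin (u i) (v i))) :=
    tendsto_finsetSum _ fun i _ => (hQ.tendsto_approx (hu i) (hv i)).const_mul _
  have hle : ∀ n : ℕ, Q.approx ((n : ℝ) + 1) g g ≤
      ∑ i, c i * Q.approx ((n : ℝ) + 1) (u i) (v i) := by
    intro n
    have h := hQ.sum_approx_nonneg (a := (n : ℝ) + 1) (by positivity) (ι := Option ι)
      (fun o => o.elim (-1) c) (u := fun o => o.elim g u) (v := fun o => o.elim g v) ?_ ?_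
    · simp only [Fintype.sum_option, Option.elim_none, Option.elim_some] at h
      linarith
    · filter_upwards [hp, ae_all_iff.2 hU, ae_all_iff.2 hV, hG] with x h1 h2 h3 h4
      simp only [Fintype.sum_option, Option.elim_none, Option.elim_some, h2, h3, h4]
      linarith [hdiag x h1]
    · filter_upwards [hp, ae_all_iff.2 hU, ae_all_iff.2 hV, hG] with y h1 h2 h3 h4
      filter_upwards [hp, ae_all_iff.2 hU, ae_all_iff.2 hV, hG] with x h5 h6 h7 h8
      simp only [Fintype.sum_option, Option.elim_none, Option.elim_some, h2, h3, h4, h6, h7, h8]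
      linarith [hpair x y h5 h1]
  obtain ⟨C, hC⟩ := hlim.bddAbove_range
  have hg : g ∈ Q.domain :=
    (hQ.mem_domain_of_approx_le fun n => (hle n).trans (hC ⟨n, rfl⟩)).1
  refine ⟨hg, ?_⟩
  rw [← hQ.isQuadratic.bilin_self hg]
  exact le_of_tendsto_of_tendsto' (hQ.tendsto_approx hg hg) hlim hle

/-- Normal contractions operate on Dirichlet forms. -/
theorem mem_domain_of_contraction {f g : L2Space m} (hf : f ∈ Q.domain) {G : X → ℝ}
    (hG : ∀ᵐ x ∂m, g x = G x) {p : X → Prop} (hp : ∀ᵐ x ∂m, p x)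
    (hdiag : ∀ x, p x → |G x| ≤ |f x|)
    (hpair : ∀ x y, p x → p y → |G x - G y| ≤ |f x - f y|) :
    g ∈ Q.domain ∧ Q.val g ≤ Q.val f := by
  have h := hQ.mem_domain_of_le_sum (ι := Unit) (fun _ => 1) (u := fun _ => f) (v := fun _ => f)
    (U := fun _ => f) (V := fun _ => f) (fun _ => hf) (fun _ => hf)
    (fun _ => Eventually.of_forall fun _ => rfl) (fun _ => Eventually.of_forall fun _ => rfl)
    hG hp (fun x hx => by simpa [sq] using sq_le_sq.2 (hdiag x hx))
    (fun x y hx hy => by simpa [sq] using sq_le_sq.2 (hpair x y hx hy))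
  simpa [hQ.isQuadratic.bilin_self hf] using h

theorem abs_mem {f : L2Space m} (hf : f ∈ Q.domain) : |f| ∈ Q.domain ∧ Q.val |f| ≤ Q.val f :=
  hQ.mem_domain_of_contraction hf (Lp.coeFn_abs f) (p := fun _ => True) (by simp)
    (fun x _ => (abs_abs _).le) fun x y _ _ => abs_abs_sub_abs_le_abs_sub _ _

theorem posPart_mem {f : L2Space m} (hf : f ∈ Q.domain) :
    (f ⊔ 0 : L2Space m) ∈ Q.domain ∧ Q.val (f ⊔ 0) ≤ Q.val f :=
  hQ.mem_domain_of_contraction hf (L2Space.coeFn_posPart' f) (p := fun _ => True) (by simp)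
    (fun x _ => by
      rw [abs_of_nonneg (le_max_right _ _)]; exact max_le (le_abs_self _) (abs_nonneg _))
    fun x y _ _ => abs_max_sub_max_le_abs _ _ _

theorem trunc_mem (k : ℝ≥0) {f : L2Space m} (hf : f ∈ Q.domain) :
    L2Space.trunc k f ∈ Q.domain ∧ Q.val (L2Space.trunc k f) ≤ Q.val f :=
  hQ.mem_domain_of_contraction hf (L2Space.coeFn_trunc k f) (p := fun _ => True) (by simp)
    (fun x _ => L2Space.abs_cap_le_abs k _) fun x y _ _ => L2Space.abs_cap_sub_le k _ _

/-- Functions with disjoint supports have nonpositive mutual energy, if they are nonnegative. -/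
theorem bilin_nonpos {f g : L2Space m} (hf : f ∈ Q.domain) (hg : g ∈ Q.domain) (hf0 : 0 ≤ f)
    (hg0 : 0 ≤ g) (hfg : ∀ᵐ x ∂m, f x * g x = 0) : Q.bilin f g ≤ 0 := by
  have h := hQ.sum_bilin_nonneg (ι := Unit) (fun _ => -1) (u := fun _ => f) (v := fun _ => g)
    (U := fun _ => f) (V := fun _ => g) (fun _ => hf) (fun _ => hg)
    (fun _ => Eventually.of_forall fun _ => rfl) (fun _ => Eventually.of_forall fun _ => rfl)
    (p := fun x => 0 ≤ f x ∧ 0 ≤ g x ∧ f x * g x = 0) (by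
      filter_upwards [L2Space.nonneg_iff.1 hf0, L2Space.nonneg_iff.1 hg0, hfg] with x h1 h2 h3
      exact ⟨h1, h2, h3⟩)
    (fun x hx => by simp [hx.2.2])
    (fun x y hx hy => by
      have h1 := mul_nonneg hx.1 hy.2.1
      have h2 := mul_nonneg hy.1 hx.2.1
      have h3 := hx.2.2
      have h4 := hy.2.2
      simp only [Finset.univ_unique, Finset.sum_singleton]
      nlinarith)
  simpa using h

end IsDirichlet

end L2Form

/-! ### The forms `Q_φ` on bounded functions -/

namespace L2Space

variable {X : Type*} [MeasurableSpace X] {m : Measure X}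

theorem ofFun_eq {u : X → ℝ} {f : L2Space m} (h : ∀ᵐ x ∂m, f x = u x) : ofFun m u = f := by
  have hu : MemLp u 2 m := (Lp.memLp f).ae_eq h
  exact Lp.ext ((coeFn_ofFun hu).trans (EventuallyEq.symm h))

theorem memLp_mul_of_bounded (φ : L2Space m) {h : X → ℝ} (hm : AEStronglyMeasurable h m) {C : ℝ}
    (hC : ∀ᵐ x ∂m, |h x| ≤ C) : MemLp (fun x => φ x * h x) 2 m := by
  have h1 : MemLp h ∞ m := memLp_top_of_bound hm C hC
  have h2 : MemLp (fun x => h x * φ x) 2 m := (Lp.memLp φ).mul (p := ∞) (q := 2) (r := 2) h1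
  exact h2.congr_norm ((Lp.memLp φ).1.mul hm) (Eventually.of_forall fun x => by rw [mul_comm])

theorem coeFn_ofFun_mul (φ : L2Space m) {h : X → ℝ} (hm : AEStronglyMeasurable h m) {C : ℝ}
    (hC : ∀ᵐ x ∂m, |h x| ≤ C) : ∀ᵐ x ∂m, ofFun m (fun x => φ x * h x) x = φ x * h x :=
  coeFn_ofFun (memLp_mul_of_bounded φ hm hC)

theorem exists_bound {f : L2Space m} (hf : MemLp (f : X → ℝ) ∞ m) :
    ∃ k : ℝ≥0, ∀ᵐ x ∂m, |f x| ≤ k := by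
  have h := hf.eLpNorm_lt_top
  rw [eLpNorm_exponent_top] at h
  refine ⟨(eLpNormEssSup f m).toNNReal, ?_⟩
  filter_upwards [enorm_ae_le_eLpNormEssSup f m] with x hx
  rw [ENNReal.coe_toNNReal_eq_toReal]
  simpa using ENNReal.toReal_mono h.ne hx

theorem memLp_top_of_abs_le {f : L2Space m} {k : ℝ} (hf : ∀ᵐ x ∂m, |f x| ≤ k) :
    MemLp (f : X → ℝ) ∞ m :=
  memLp_top_of_bound (Lp.memLp f).1 k hf

theorem trunc_eq_self {f : L2Space m} {k : ℝ≥0} (hf : ∀ᵐ x ∂m, |f x| ≤ k) : trunc k f = f := by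
  refine Lp.ext ?_
  filter_upwards [hf, coeFn_trunc k f] with x h1 h2
  rw [h2, cap_of_abs_le h1]

theorem abs_trunc_le (k : ℝ≥0) (f : L2Space m) : ∀ᵐ x ∂m, |trunc k f x| ≤ k := by
  filter_upwards [coeFn_trunc k f] with x hx
  rw [hx]
  exact abs_cap_le k _

theorem continuous_trunc (k : ℝ≥0) : Continuous (trunc k : L2Space m → L2Space m) :=
  (lipschitz_cap k).continuous_compLp (cap_zero k)

/-- The product of an `L²` function with a real function, in `L²` (for bounded measurable `h`). -/
noncomputable abbrev mulFun (φ : L2Space m) (h : X → ℝ) : L2Space m :=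
  ofFun m fun x => φ x * h x

theorem coeFn_mulFun (φ : L2Space m) {f : L2Space m} (hf : MemLp (f : X → ℝ) ∞ m) :
    ∀ᵐ x ∂m, mulFun φ f x = φ x * f x :=
  coeFn_ofFun (memLp_mul φ f hf)

theorem coeFn_mulFun_sq (φ : L2Space m) {f : L2Space m} (hf : MemLp (f : X → ℝ) ∞ m) :
    ∀ᵐ x ∂m, mulFun φ (fun y => f y ^ 2) x = φ x * f x ^ 2 :=
  coeFn_ofFun (memLp_mul_sq φ f hf)

theorem coeFn_mulFun_mul (φ : L2Space m) {f g : L2Space m} (hf : MemLp (f : X → ℝ) ∞ m)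
    (hg : MemLp (g : X → ℝ) ∞ m) :
    ∀ᵐ x ∂m, mulFun φ (fun y => f y * g y) x = φ x * (f x * g x) := by
  obtain ⟨k, hk⟩ := exists_bound hf
  obtain ⟨l, hl⟩ := exists_bound hg
  refine coeFn_ofFun_mul φ (hf.1.mul hg.1) (C := k * l) ?_
  filter_upwards [hk, hl] with x h1 h2
  rw [abs_mul]
  exact mul_le_mul h1 h2 (abs_nonneg _) k.2

end L2Space

namespace L2Form

variable {X : Type*} [MeasurableSpace X] {m : Measure X}

theorem zero_mem_cutoffs {Q : L2Form m} (hQ : Q.IsDirichlet) : (0 : L2Space m) ∈ Q.cutoffs := by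
  refine ⟨hQ.isQuadratic.zero_mem, le_rfl, ?_⟩
  filter_upwards [Lp.coeFn_zero ℝ 2 m] with x hx
  rw [hx]
  exact zero_le_one

section PreCut

open L2Space

/-- The elementary inequality behind the multiplication lemma: the increments of `φ h` are
controlled by the weighted increments of `h` and by the increments of `φ`. -/
theorem sq_mul_sub_mul_le {a b s t h k C D : ℝ} (ha : 0 ≤ a) (hb : 0 ≤ b) (has : a ≤ s)
    (hbt : b ≤ t) (hh : |h| ≤ C) (hk : |k| ≤ C) (hD : (h - k) ^ 2 ≤ D) :
    (a * h - b * k) ^ 2 ≤ 2 * (s * t) * D + 2 * C ^ 2 * (a - b) ^ 2 := by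
  have hD0 : 0 ≤ D := (sq_nonneg _).trans hD
  have h1 : a * b * (h - k) ^ 2 ≤ s * t * D :=
    mul_le_mul (mul_le_mul has hbt hb (ha.trans has)) hD (sq_nonneg _)
      (mul_nonneg (ha.trans has) (hb.trans hbt))
  have hh2 : h ^ 2 ≤ C ^ 2 := sq_le_sq' (abs_le.1 hh).1 (abs_le.1 hh).2
  have hk2 : k ^ 2 ≤ C ^ 2 := sq_le_sq' (abs_le.1 hk).1 (abs_le.1 hk).2
  have h3 : h ^ 2 * (a - b) ^ 2 ≤ C ^ 2 * (a - b) ^ 2 :=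
    mul_le_mul_of_nonneg_right hh2 (sq_nonneg _)
  have h4 : k ^ 2 * (a - b) ^ 2 ≤ C ^ 2 * (a - b) ^ 2 :=
    mul_le_mul_of_nonneg_right hk2 (sq_nonneg _)
  rcases le_total a b with hab | hab
  · have e1 : (a * h - b * k) ^ 2 ≤ 2 * (a * a * (h - k) ^ 2) + 2 * (k ^ 2 * (a - b) ^ 2) := by
      nlinarith [sq_nonneg (a * (h - k) - k * (a - b))]
    have e2 : a * a * (h - k) ^ 2 ≤ a * b * (h - k) ^ 2 :=
      mul_le_mul_of_nonneg_right (mul_le_mul_of_nonneg_left hab ha) (sq_nonneg _)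
    linarith
  · have e1 : (a * h - b * k) ^ 2 ≤ 2 * (b * b * (h - k) ^ 2) + 2 * (h ^ 2 * (a - b) ^ 2) := by
      nlinarith [sq_nonneg (b * (h - k) - h * (a - b))]
    have e2 : b * b * (h - k) ^ 2 ≤ a * b * (h - k) ^ 2 :=
      mul_le_mul_of_nonneg_right (mul_le_mul_of_nonneg_right hab hb) (sq_nonneg _)
    linarith

variable [SigmaFinite m] {Q : L2Form m} (hQ : Q.IsDirichlet)
include hQ

/-- Let `φ ≤ ψ` be cutoff functions. If the increments of the bounded function `h` are controlled
by those of functions `f`, `g` in the domain of `preCut Q ψ`, then `φ h ∈ D(Q)`. -/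
theorem mulFun_mem_domain {φ ψ : L2Space m} (hφ : φ ∈ Q.cutoffs) (hψ : ψ ∈ Q.cutoffs)
    (hle : φ ≤ ψ) {f g : L2Space m} (hf : f ∈ (Q.preCut ψ).domain)
    (hg : g ∈ (Q.preCut ψ).domain) {h : X → ℝ} (hm : AEStronglyMeasurable h m) {C K : ℝ}
    (hC : ∀ᵐ x ∂m, |h x| ≤ C) {p : X → Prop} (hp : ∀ᵐ x ∂m, p x)
    (hpair : ∀ x y, p x → p y → (h x - h y) ^ 2 ≤ K * ((f x - f y) ^ 2 + (g x - g y) ^ 2)) :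
    mulFun φ h ∈ Q.domain ∧ Q.val (mulFun φ h) ≤
      2 * K * ((Q.preCut ψ).val f + (Q.preCut ψ).val g) + 2 * C ^ 2 * Q.val φ := by
  have hcomb := hQ.mem_domain_of_le_sum (g := mulFun φ h) (G := fun x => φ x * h x)
    ![2 * K, -(2 * K), 2 * K, -(2 * K), 2 * C ^ 2]
    (u := ![mulFun ψ f, mulFun ψ fun x => f x ^ 2, mulFun ψ g, mulFun ψ fun x => g x ^ 2, φ])
    (v := ![mulFun ψ f, ψ, mulFun ψ g, ψ, φ])
    (U := ![fun x => ψ x * f x, fun x => ψ x * f x ^ 2, fun x => ψ x * g x,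
      fun x => ψ x * g x ^ 2, φ])
    (V := ![fun x => ψ x * f x, ψ, fun x => ψ x * g x, ψ, φ])
    (by intro i; fin_cases i; exacts [hf.2.1, hf.2.2, hg.2.1, hg.2.2, hφ.1])
    (by intro i; fin_cases i; exacts [hf.2.1, hψ.1, hg.2.1, hψ.1, hφ.1])
    (by intro i; fin_cases i
        exacts [coeFn_mulFun ψ hf.1, coeFn_mulFun_sq ψ hf.1, coeFn_mulFun ψ hg.1,
          coeFn_mulFun_sq ψ hg.1, Eventually.of_forall fun _ => rfl])
    (by intro i; fin_cases i
        exacts [coeFn_mulFun ψ hf.1, Eventually.of_forall fun _ => rfl, coeFn_mulFun ψ hg.1,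
          Eventually.of_forall fun _ => rfl, Eventually.of_forall fun _ => rfl])
    (coeFn_ofFun_mul φ hm hC)
    (p := fun x => p x ∧ |h x| ≤ C ∧ 0 ≤ φ x ∧ φ x ≤ ψ x) (by
      filter_upwards [hp, hC, nonneg_iff.1 hφ.2.1, le_iff.1 hle] with x h1 h2 h3 h4
      exact ⟨h1, h2, h3, h4⟩)
    (by
      rintro x ⟨h1, h2, h3, h4⟩
      simp only [Fin.sum_univ_five, Matrix.cons_val]
      have h5 : h x ^ 2 ≤ C ^ 2 := sq_le_sq' (abs_le.1 h2).1 (abs_le.1 h2).2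
      have h6 : φ x ^ 2 * h x ^ 2 ≤ φ x ^ 2 * C ^ 2 :=
        mul_le_mul_of_nonneg_left h5 (sq_nonneg _)
      have h7 : 0 ≤ φ x ^ 2 * C ^ 2 := by positivity
      rw [mul_pow]
      refine h6.trans (le_of_sub_nonneg (h7.trans_eq ?_))
      ring)
    (by
      rintro x y ⟨h1, h2, h3, h4⟩ ⟨k1, k2, k3, k4⟩
      simp only [Fin.sum_univ_five, Matrix.cons_val]
      refine (sq_mul_sub_mul_le h3 k3 h4 k4 h2 k2 (hpair x y h1 k1)).trans_eq ?_
      ring)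
  refine ⟨hcomb.1, hcomb.2.trans_eq ?_⟩
  simp only [Fin.sum_univ_five, Matrix.cons_val]
  rw [hQ.isQuadratic.bilin_self hf.2.1, hQ.isQuadratic.bilin_self hg.2.1,
    hQ.isQuadratic.bilin_self hφ.1, preCut]
  ring

/-- Additivity of `preCut Q φ`, with the bilinear form `Q(φ f, φ g) - Q(φ f g, φ)` on the
domain of `preCut Q φ`. -/
theorem preCut_val_add {φ : L2Space m} (hφ : φ ∈ Q.cutoffs) {f g : L2Space m}
    (hf : f ∈ (Q.preCut φ).domain) (hg : g ∈ (Q.preCut φ).domain) :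
    mulFun φ (fun x => f x * g x) ∈ Q.domain ∧ f + g ∈ (Q.preCut φ).domain ∧
      (Q.preCut φ).val (f + g) = (Q.preCut φ).val f + 2 * (Q.bilin (mulFun φ f) (mulFun φ g) -
        Q.bilin (mulFun φ fun x => f x * g x) φ) + (Q.preCut φ).val g := by
  have hq := hQ.isQuadratic
  obtain ⟨k, hk⟩ := exists_bound hf.1
  obtain ⟨l, hl⟩ := exists_bound hg.1
  have hfg : mulFun φ (fun x => f x * g x) ∈ Q.domain := by
    refine (mulFun_mem_domain hQ hφ hφ le_rfl hf hg (h := fun x => f x * g x)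
      (hf.1.1.mul hg.1.1) (C := k * l)
      (K := 2 * (k ^ 2 + l ^ 2)) ?_
      (p := fun x => |f x| ≤ k ∧ |g x| ≤ l) (by filter_upwards [hk, hl] with x h1 h2 using ⟨h1, h2⟩)
      ?_).1
    · filter_upwards [hk, hl] with x h1 h2
      rw [abs_mul]
      exact mul_le_mul h1 h2 (abs_nonneg _) k.2
    · rintro x y ⟨h1, h2⟩ ⟨h3, h4⟩
      have e1 : f y ^ 2 ≤ k ^ 2 := sq_le_sq' (abs_le.1 h3).1 (abs_le.1 h3).2
      have e2 : g x ^ 2 ≤ l ^ 2 := sq_le_sq' (abs_le.1 h2).1 (abs_le.1 h2).2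
      have e3 := mul_le_mul_of_nonneg_right e1 (sq_nonneg (g x - g y))
      have e4 := mul_le_mul_of_nonneg_right e2 (sq_nonneg (f x - f y))
      have e5 := mul_nonneg (sq_nonneg (l : ℝ)) (sq_nonneg (g x - g y))
      have e6 := mul_nonneg (sq_nonneg (k : ℝ)) (sq_nonneg (f x - f y))
      have e7 := sq_nonneg ((f x - f y) * g x - f y * (g x - g y))
      nlinarith
  have hbd : MemLp ((f + g : L2Space m) : X → ℝ) ∞ m :=
    (hf.1.add hg.1).ae_eq (Lp.coeFn_add f g).symm
  have e1 : mulFun φ (f + g : L2Space m) = mulFun φ f + mulFun φ g := by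
    refine ofFun_eq ?_
    filter_upwards [Lp.coeFn_add (mulFun φ f) (mulFun φ g), coeFn_mulFun φ hf.1,
      coeFn_mulFun φ hg.1, Lp.coeFn_add f g] with x h1 h2 h3 h4
    rw [h1, Pi.add_apply, h2, h3, h4, Pi.add_apply, mul_add]
  have e2 : mulFun φ (fun x => (f + g : L2Space m) x ^ 2) = (mulFun φ fun x => f x ^ 2) +
      (2 : ℝ) • (mulFun φ fun x => f x * g x) + mulFun φ fun x => g x ^ 2 := by
    refine ofFun_eq ?_
    filter_upwards [Lp.coeFn_add ((mulFun φ fun x => f x ^ 2) +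
      (2 : ℝ) • (mulFun φ fun x => f x * g x)) (mulFun φ fun x => g x ^ 2),
      Lp.coeFn_add (mulFun φ fun x => f x ^ 2) ((2 : ℝ) • (mulFun φ fun x => f x * g x)),
      Lp.coeFn_smul (2 : ℝ) (mulFun φ fun x => f x * g x), coeFn_mulFun_sq φ hf.1,
      coeFn_mulFun_sq φ hg.1, coeFn_mulFun_mul φ hf.1 hg.1, Lp.coeFn_add f g]
      with x h1 h2 h3 h4 h5 h6 h7
    rw [h1, Pi.add_apply, h2, Pi.add_apply, h3, Pi.smul_apply, h4, h5, h6, h7, Pi.add_apply,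
      smul_eq_mul]
    ring
  have h1d := hf.2.1
  have h2d := hf.2.2
  have h3d := hg.2.1
  have h4d := hg.2.2
  refine ⟨hfg, ⟨hbd, ?_, ?_⟩, ?_⟩
  · change mulFun φ (f + g : L2Space m) ∈ _
    rw [e1]; exact hq.add_mem h1d h3d
  · change mulFun φ (fun x => (f + g : L2Space m) x ^ 2) ∈ _
    rw [e2]; exact hq.add_mem (hq.add_mem h2d (hq.smul_mem 2 hfg)) h4d
  · change Q.val (mulFun φ (f + g : L2Space m)) -
      Q.bilin (mulFun φ (fun x => (f + g : L2Space m) x ^ 2)) φ = Q.val (mulFun φ f) -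
      Q.bilin (mulFun φ fun x => f x ^ 2) φ + _ + (Q.val (mulFun φ g) -
      Q.bilin (mulFun φ fun x => g x ^ 2) φ)
    rw [e1, e2, hq.val_add h1d h3d, hq.bilin_add_left (hq.add_mem h2d (hq.smul_mem 2 hfg)) h4d hφ.1,
      hq.bilin_add_left h2d (hq.smul_mem 2 hfg) hφ.1, hq.bilin_smul_left 2 hfg hφ.1]
    ring

omit [SigmaFinite m] in
theorem preCut_val_smul {φ : L2Space m} (hφ : φ ∈ Q.cutoffs) (c : ℝ) {f : L2Space m}
    (hf : f ∈ (Q.preCut φ).domain) : mulFun φ (c • f : L2Space m) = c • mulFun φ f ∧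
      c • f ∈ (Q.preCut φ).domain ∧ (Q.preCut φ).val (c • f) = c * c * (Q.preCut φ).val f := by
  have hq := hQ.isQuadratic
  have hbd : MemLp ((c • f : L2Space m) : X → ℝ) ∞ m :=
    (hf.1.const_smul c).ae_eq (Lp.coeFn_smul c f).symm
  have e1 : mulFun φ (c • f : L2Space m) = c • mulFun φ f := by
    refine ofFun_eq ?_
    filter_upwards [Lp.coeFn_smul c (mulFun φ f), coeFn_mulFun φ hf.1, Lp.coeFn_smul c f]
      with x h1 h2 h3
    rw [h1, Pi.smul_apply, h2, h3, Pi.smul_apply, smul_eq_mul, smul_eq_mul]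
    ring
  have e2 : mulFun φ (fun x => (c • f : L2Space m) x ^ 2) =
      (c * c) • mulFun φ fun x => f x ^ 2 := by
    refine ofFun_eq ?_
    filter_upwards [Lp.coeFn_smul (c * c) (mulFun φ fun x => f x ^ 2), coeFn_mulFun_sq φ hf.1,
      Lp.coeFn_smul c f] with x h1 h2 h3
    rw [h1, Pi.smul_apply, h2, h3, Pi.smul_apply, smul_eq_mul, smul_eq_mul]
    ring
  have h1d := hf.2.1
  have h2d := hf.2.2
  refine ⟨e1, ⟨hbd, ?_, ?_⟩, ?_⟩
  · change mulFun φ (c • f : L2Space m) ∈ _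
    rw [e1]; exact hq.smul_mem c h1d
  · change mulFun φ (fun x => (c • f : L2Space m) x ^ 2) ∈ _
    rw [e2]; exact hq.smul_mem _ h2d
  · change Q.val (mulFun φ (c • f : L2Space m)) -
      Q.bilin (mulFun φ (fun x => (c • f : L2Space m) x ^ 2)) φ = c * c * (Q.val (mulFun φ f) -
      Q.bilin (mulFun φ fun x => f x ^ 2) φ)
    rw [e1, e2, hq.val_smul c h1d, hq.bilin_smul_left _ h2d hφ.1]
    ring

theorem preCut_isQuadratic {φ : L2Space m} (hφ : φ ∈ Q.cutoffs) : (Q.preCut φ).IsQuadratic := by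
  have hq := hQ.isQuadratic
  have hadd := fun {f g : L2Space m} hf hg => preCut_val_add hQ hφ (f := f) (g := g) hf hg
  have hsmul := fun (c : ℝ) {f : L2Space m} hf => preCut_val_smul hQ hφ c (f := f) hf
  set B : L2Space m → L2Space m → ℝ := fun f g => Q.bilin (mulFun φ f) (mulFun φ g) -
        Q.bilin (mulFun φ fun x => f x * g x) φ with hB
  have hBadd : ∀ {f g h : L2Space m}, f ∈ (Q.preCut φ).domain → g ∈ (Q.preCut φ).domain →
      h ∈ (Q.preCut φ).domain → B (f + g) h = B f h + B g h := by
    intro f g h hf hg hh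
    have e1 : mulFun φ (f + g : L2Space m) = mulFun φ f + mulFun φ g := by
      refine ofFun_eq ?_
      filter_upwards [Lp.coeFn_add (mulFun φ f) (mulFun φ g), coeFn_mulFun φ hf.1,
        coeFn_mulFun φ hg.1, Lp.coeFn_add f g] with x h1 h2 h3 h4
      rw [h1, Pi.add_apply, h2, h3, h4, Pi.add_apply, mul_add]
    have e2 : mulFun φ (fun x => (f + g : L2Space m) x * h x) =
        (mulFun φ fun x => f x * h x) + mulFun φ fun x => g x * h x := by
      refine ofFun_eq ?_
      filter_upwards [Lp.coeFn_add (mulFun φ fun x => f x * h x) (mulFun φ fun x => g x * h x),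
        coeFn_mulFun_mul φ hf.1 hh.1, coeFn_mulFun_mul φ hg.1 hh.1, Lp.coeFn_add f g]
        with x h1 h2 h3 h4
      rw [h1, Pi.add_apply, h2, h3, h4, Pi.add_apply]
      ring
    simp only [hB]
    rw [e1, e2, hq.bilin_add_left hf.2.1 hg.2.1 hh.2.1,
      hq.bilin_add_left (hadd hf hh).1 (hadd hg hh).1 hφ.1]
    ring
  have hBsmul : ∀ (c : ℝ) {f g : L2Space m}, f ∈ (Q.preCut φ).domain →
      g ∈ (Q.preCut φ).domain → B (c • f) g = c * B f g := by
    intro c f g hf hg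
    have e2 : mulFun φ (fun x => (c • f : L2Space m) x * g x) =
        c • mulFun φ fun x => f x * g x := by
      refine ofFun_eq ?_
      filter_upwards [Lp.coeFn_smul c (mulFun φ fun x => f x * g x),
        coeFn_mulFun_mul φ hf.1 hg.1, Lp.coeFn_smul c f] with x h1 h2 h3
      rw [h1, Pi.smul_apply, h2, h3, Pi.smul_apply, smul_eq_mul, smul_eq_mul]
      ring
    simp only [hB]
    rw [(hsmul c hf).1, e2, hq.bilin_smul_left c hf.2.1 hg.2.1,
      hq.bilin_smul_left c (hadd hf hg).1 hφ.1]
    ring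
  have hBcomm : ∀ {f g : L2Space m}, f ∈ (Q.preCut φ).domain → g ∈ (Q.preCut φ).domain →
      B f g = B g f := by
    intro f g hf hg
    simp only [hB]
    rw [hq.bilin_comm hf.2.1 hg.2.1]
    congr 3
    ext x
    ring
  refine isQuadratic_of ?_ (fun f hf g hg => (hadd hf hg).2.1) (fun c f hf => (hsmul c hf).2.1)
    (fun c f hf => (hsmul c hf).2.2) ?_ ?_
  · have h0 : ∀ᵐ x ∂m, (0 : L2Space m) x = 0 := Lp.coeFn_zero ℝ 2 m
    refine ⟨memLp_top_of_abs_le (k := 0) ?_, ?_, ?_⟩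
    · filter_upwards [h0] with x hx
      rw [hx, abs_zero]
    · rw [ofFun_eq (f := 0)]
      · exact hq.zero_mem
      · filter_upwards [h0] with x hx
        rw [hx, mul_zero]
    · rw [ofFun_eq (f := 0)]
      · exact hq.zero_mem
      · filter_upwards [h0] with x hx
        rw [hx]; ring
  · intro f hf g hg h hh
    have h1 := (hadd (hadd hf hg).2.1 hh).2.2
    have h2 := (hadd hf hg).2.2
    have h3 := (hadd hg hh).2.2
    have h4 := (hadd hh hf).2.2
    have h5 := hBadd hf hg hh
    have h6 := hBcomm hh hf
    simp only [hB] at h5 h6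
    linarith
  · intro c f hf g hg
    have h1 := (hadd (hsmul c hf).2.1 hg).2.2
    have h2 := (hadd hf hg).2.2
    have h3 := (hsmul c hf).2.2
    have h4 := hBsmul c hf hg
    simp only [hB] at h4
    rw [h1, h2, h3, h4]
    ring

/-- The value of `preCut Q φ` decreases under contractions of the function and increases in
`φ`. In the pointwise calculus `Q(φ f) - Q(φ f², φ)` corresponds to `φ(x) φ(y) (f(x) - f(y))²` off
the diagonal and to `0` on the diagonal. -/
theorem preCut_mono {φ ψ : L2Space m} (hφ : φ ∈ Q.cutoffs) (hψ : ψ ∈ Q.cutoffs)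
    (hle : φ ≤ ψ) {f g : L2Space m} (hf : f ∈ (Q.preCut ψ).domain) {G : X → ℝ}
    (hG : ∀ᵐ x ∂m, g x = G x) {k : ℝ≥0} (hk : ∀ᵐ x ∂m, |g x| ≤ k) {p : X → Prop}
    (hp : ∀ᵐ x ∂m, p x) (hpair : ∀ x y, p x → p y → |G x - G y| ≤ |f x - f y|) :
    g ∈ (Q.preCut φ).domain ∧ (Q.preCut φ).val g ≤ (Q.preCut ψ).val f := by
  have hq := hQ.isQuadratic
  have hgt := memLp_top_of_abs_le hk
  have hsq : ∀ x y, p x → p y → (G x - G y) ^ 2 ≤ (f x - f y) ^ 2 := fun x y hx hy =>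
    sq_le_sq.2 (hpair x y hx hy)
  have h1 : mulFun φ g ∈ Q.domain := by
    refine (mulFun_mem_domain hQ hφ hψ hle hf hf (Lp.memLp g).1 (K := 1) hk
      (p := fun x => p x ∧ g x = G x) (by filter_upwards [hp, hG] with x e1 e2 using ⟨e1, e2⟩)
      ?_).1
    rintro x y ⟨e1, e2⟩ ⟨e3, e4⟩
    rw [e2, e4]
    linarith [hsq x y e1 e3, sq_nonneg (f x - f y)]
  have h2 : mulFun φ (fun x => g x ^ 2) ∈ Q.domain := by
    refine (mulFun_mem_domain hQ hφ hψ hle hf hf (h := fun x => g x ^ 2)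
      ((Lp.memLp g).1.pow 2) (C := k ^ 2)
      (K := 4 * k ^ 2) ?_ (p := fun x => p x ∧ g x = G x ∧ |g x| ≤ k)
      (by filter_upwards [hp, hG, hk] with x e1 e2 e3 using ⟨e1, e2, e3⟩) ?_).1
    · filter_upwards [hk] with x hx
      rw [abs_pow]
      exact pow_le_pow_left₀ (abs_nonneg _) hx 2
    · rintro x y ⟨e1, e2, e3⟩ ⟨e4, e5, e6⟩
      have e7 : (g x + g y) ^ 2 ≤ 4 * (k : ℝ) ^ 2 := by
        have : |g x + g y| ≤ |2 * (k : ℝ)| := by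
          rw [abs_of_nonneg (a := 2 * (k : ℝ)) (by positivity)]
          exact (abs_add_le _ _).trans (by linarith)
        calc (g x + g y) ^ 2 ≤ (2 * (k : ℝ)) ^ 2 := sq_le_sq.2 this
          _ = 4 * (k : ℝ) ^ 2 := by ring
      calc (g x ^ 2 - g y ^ 2) ^ 2 = (g x + g y) ^ 2 * (g x - g y) ^ 2 := by ring
        _ ≤ 4 * k ^ 2 * (f x - f y) ^ 2 := by
          refine mul_le_mul e7 ?_ (sq_nonneg _) (by positivity)
          rw [e2, e5]; exact hsq x y e1 e4
        _ ≤ 4 * k ^ 2 * ((f x - f y) ^ 2 + (f x - f y) ^ 2) :=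
          mul_le_mul_of_nonneg_left (by linarith [sq_nonneg (f x - f y)]) (by positivity)
  refine ⟨⟨hgt, h1, h2⟩, ?_⟩
  have h3 := hQ.sum_bilin_nonneg ![1, -1, -1, 1]
    (u := ![mulFun ψ f, mulFun ψ fun x => f x ^ 2, mulFun φ g, mulFun φ fun x => g x ^ 2])
    (v := ![mulFun ψ f, ψ, mulFun φ g, φ])
    (U := ![fun x => ψ x * f x, fun x => ψ x * f x ^ 2, fun x => φ x * g x,
      fun x => φ x * g x ^ 2])
    (V := ![fun x => ψ x * f x, ψ, fun x => φ x * g x, φ])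
    (by intro i; fin_cases i; exacts [hf.2.1, hf.2.2, h1, h2])
    (by intro i; fin_cases i; exacts [hf.2.1, hψ.1, h1, hφ.1])
    (by intro i; fin_cases i
        exacts [coeFn_mulFun ψ hf.1, coeFn_mulFun_sq ψ hf.1, coeFn_mulFun φ hgt,
          coeFn_mulFun_sq φ hgt])
    (by intro i; fin_cases i
        exacts [coeFn_mulFun ψ hf.1, Eventually.of_forall fun _ => rfl, coeFn_mulFun φ hgt,
          Eventually.of_forall fun _ => rfl])
    (p := fun x => p x ∧ g x = G x ∧ 0 ≤ φ x ∧ φ x ≤ ψ x) (by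
      filter_upwards [hp, hG, nonneg_iff.1 hφ.2.1, le_iff.1 hle] with x h1 h2 h3 h4
      exact ⟨h1, h2, h3, h4⟩)
    (by
      rintro x ⟨e1, e2, e3, e4⟩
      simp only [Fin.sum_univ_four, Matrix.cons_val]
      exact le_of_eq (by ring))
    (by
      rintro x y ⟨e1, e2, e3, e4⟩ ⟨k1, k2, k3, k4⟩
      simp only [Fin.sum_univ_four, Matrix.cons_val]
      have e5 : φ x * φ y * (g x - g y) ^ 2 ≤ ψ x * ψ y * (f x - f y) ^ 2 := by
        rw [e2, k2]
        exact mul_le_mul (mul_le_mul e4 k4 k3 (e3.trans e4)) (hsq x y e1 k1) (sq_nonneg _)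
          (mul_nonneg (e3.trans e4) (k3.trans k4))
      refine (sub_nonneg.2 e5).trans_eq ?_
      ring)
  simp only [Fin.sum_univ_four, Matrix.cons_val] at h3
  rw [hq.bilin_self hf.2.1, hq.bilin_self h1] at h3
  change Q.val (mulFun φ g) - Q.bilin (mulFun φ fun x => g x ^ 2) φ ≤
    Q.val (mulFun ψ f) - Q.bilin (mulFun ψ fun x => f x ^ 2) ψ
  linarith

theorem preCut_nonneg {φ : L2Space m} (hφ : φ ∈ Q.cutoffs) :
    ∀ f ∈ (Q.preCut φ).domain, 0 ≤ (Q.preCut φ).val f := by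
  intro f hf
  have h0 : ∀ᵐ x ∂m, (0 : L2Space m) x = 0 := Lp.coeFn_zero ℝ 2 m
  have h := (preCut_mono hQ hφ hφ le_rfl hf h0 (k := 0) (p := fun _ => True)
    (by filter_upwards [h0] with x hx; rw [hx, abs_zero]; exact NNReal.coe_nonneg _)
    (by simp) (by simp)).2
  rwa [(preCut_isQuadratic hQ hφ).val_zero] at h

omit [SigmaFinite m] hQ in
theorem norm_mulFun_sub_le {φ f g : L2Space m} {h k : X → ℝ} {C D : ℝ} (hφ0 : 0 ≤ φ)
    (hφ1 : ∀ᵐ x ∂m, φ x ≤ 1) (hh : AEStronglyMeasurable h m) (hk : AEStronglyMeasurable k m)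
    (hhC : ∀ᵐ x ∂m, |h x| ≤ C) (hkC : ∀ᵐ x ∂m, |k x| ≤ C) (hD : 0 ≤ D)
    (hle : ∀ᵐ x ∂m, |h x - k x| ≤ D * |f x - g x|) :
    ‖mulFun φ h - mulFun φ k‖ ≤ D * ‖f - g‖ := by
  rw [← abs_of_nonneg hD, ← Real.norm_eq_abs, ← norm_smul]
  refine Lp.norm_le_norm_of_ae_le ?_
  filter_upwards [Lp.coeFn_sub (mulFun φ h) (mulFun φ k), coeFn_ofFun_mul φ hh hhC,
    coeFn_ofFun_mul φ hk hkC, Lp.coeFn_smul D (f - g), Lp.coeFn_sub f g, nonneg_iff.1 hφ0, hφ1,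
    hle] with x e1 e2 e3 e4 e5 e6 e7 e8
  rw [e1, e4, Pi.sub_apply, e2, e3, Pi.smul_apply, e5, Pi.sub_apply, ← mul_sub, smul_eq_mul,
    Real.norm_eq_abs, Real.norm_eq_abs, abs_mul, abs_mul, abs_of_nonneg e6, abs_of_nonneg hD]
  exact (mul_le_of_le_one_left (abs_nonneg _) e7).trans e8

/-- Lower semicontinuity of `preCut Q φ` along uniformly bounded sequences. The products `φ uₙ` and
`φ uₙ²` are bounded in `D(Q)`, hence converge weakly there. -/
theorem preCut_lsc_of_bounded {φ : L2Space m} (hφ : φ ∈ Q.cutoffs) {u : ℕ → L2Space m}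
    {f : L2Space m} {k : ℝ≥0} {c : ℝ} (hu : ∀ n, u n ∈ (Q.preCut φ).domain)
    (hk : ∀ n, ∀ᵐ x ∂m, |u n x| ≤ k) (hc : ∀ n, (Q.preCut φ).val (u n) ≤ c)
    (hlim : Tendsto u atTop (𝓝 f)) :
    f ∈ (Q.preCut φ).domain ∧ (Q.preCut φ).val f ≤ c := by
  have hq := hQ.isQuadratic
  have hfk : ∀ᵐ x ∂m, |f x| ≤ k := by
    have h1 : trunc k f = f := by
      refine tendsto_nhds_unique ((continuous_trunc k).tendsto f |>.comp hlim) (hlim.congr ?_)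
      exact fun n => (trunc_eq_self (hk n)).symm
    rw [← h1]
    exact abs_trunc_le k f
  have hft := memLp_top_of_abs_le hfk
  have hk2 : ∀ {g : L2Space m}, (∀ᵐ x ∂m, |g x| ≤ k) → ∀ᵐ x ∂m, |g x ^ 2| ≤ (k : ℝ) ^ 2 := by
    intro g hg
    filter_upwards [hg] with x hx
    rw [abs_pow]
    exact pow_le_pow_left₀ (abs_nonneg _) hx 2
  have hdist : Tendsto (fun n => ‖u n - f‖) atTop (𝓝 0) := tendsto_iff_norm_sub_tendsto_zero.1 hlim
  have hlim1 : Tendsto (fun n => mulFun φ (u n)) atTop (𝓝 (mulFun φ f)) := by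
    rw [tendsto_iff_norm_sub_tendsto_zero]
    have h1 := hdist.const_mul 1
    rw [mul_zero] at h1
    refine squeeze_zero (fun _ => norm_nonneg _) (fun n => ?_) h1
    exact norm_mulFun_sub_le hφ.2.1 hφ.2.2 (Lp.memLp _).1 (Lp.memLp _).1 (hk n) hfk zero_le_one
      (Eventually.of_forall fun x => (one_mul _).ge)
  have hlim2 : Tendsto (fun n => mulFun φ fun x => u n x ^ 2) atTop
      (𝓝 (mulFun φ fun x => f x ^ 2)) := by
    rw [tendsto_iff_norm_sub_tendsto_zero]
    have h1 := hdist.const_mul (2 * k : ℝ)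
    rw [mul_zero] at h1
    refine squeeze_zero (fun _ => norm_nonneg _) (fun n => ?_) h1
    refine norm_mulFun_sub_le hφ.2.1 hφ.2.2 ((Lp.memLp _).1.pow 2) ((Lp.memLp _).1.pow 2)
      (hk2 (hk n)) (hk2 hfk) (by positivity) ?_
    filter_upwards [hk n, hfk] with x e1 e2
    rw [show u n x ^ 2 - f x ^ 2 = (u n x + f x) * (u n x - f x) by ring, abs_mul]
    exact mul_le_mul_of_nonneg_right ((abs_add_le _ _).trans (by linarith)) (abs_nonneg _)
  have hb1 : ∀ n, Q.val (mulFun φ (u n)) ≤ 2 * 1 * (c + c) + 2 * k ^ 2 * Q.val φ := by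
    intro n
    refine (mulFun_mem_domain hQ hφ hφ le_rfl (hu n) (hu n) (Lp.memLp (u n)).1 (K := 1) (hk n)
      (p := fun _ => True) (by simp) ?_).2.trans ?_
    · intro x y _ _
      linarith [sq_nonneg (u n x - u n y)]
    · linarith [hc n]
  have hb2 : ∀ n, Q.val (mulFun φ fun x => u n x ^ 2) ≤
      2 * (4 * k ^ 2) * (c + c) + 2 * (k ^ 2) ^ 2 * Q.val φ := by
    intro n
    refine (mulFun_mem_domain hQ hφ hφ le_rfl (hu n) (hu n) ((Lp.memLp (u n)).1.pow 2)
      (K := 4 * k ^ 2) (hk2 (hk n)) (p := fun x => |u n x| ≤ k) (hk n) ?_).2.trans ?_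
    · intro x y e3 e6
      have e7 : (u n x + u n y) ^ 2 ≤ 4 * (k : ℝ) ^ 2 := by
        have : |u n x + u n y| ≤ |2 * (k : ℝ)| := by
          rw [abs_of_nonneg (a := 2 * (k : ℝ)) (by positivity)]
          exact (abs_add_le _ _).trans (by linarith)
        calc (u n x + u n y) ^ 2 ≤ (2 * (k : ℝ)) ^ 2 := sq_le_sq.2 this
          _ = 4 * (k : ℝ) ^ 2 := by ring
      calc (u n x ^ 2 - u n y ^ 2) ^ 2 = (u n x + u n y) ^ 2 * (u n x - u n y) ^ 2 := by ring
        _ ≤ 4 * k ^ 2 * (u n x - u n y) ^ 2 := mul_le_mul_of_nonneg_right e7 (sq_nonneg _)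
        _ ≤ 4 * k ^ 2 * ((u n x - u n y) ^ 2 + (u n x - u n y) ^ 2) :=
          mul_le_mul_of_nonneg_left (by linarith [sq_nonneg (u n x - u n y)]) (by positivity)
    · have h1 : 2 * (4 * (k : ℝ) ^ 2) * ((Q.preCut φ).val (u n) + (Q.preCut φ).val (u n)) ≤
          2 * (4 * k ^ 2) * (c + c) :=
        mul_le_mul_of_nonneg_left (by linarith [hc n]) (by positivity)
      linarith
  have hd1 := (hQ.isClosedForm.mem_domain_and_val_le hq hQ.nonneg (fun n => (hu n).2.1) hb1
    hlim1).1
  have hd2 := (hQ.isClosedForm.mem_domain_and_val_le hq hQ.nonneg (fun n => (hu n).2.2) hb2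
    hlim2).1
  refine ⟨⟨hft, hd1, hd2⟩, ?_⟩
  have hweak := hQ.tendsto_bilin_of_bounded (fun n => (hu n).2.2) hb2 hlim2 hφ.1
  have key : ∀ ε > 0, Q.val (mulFun φ f) ≤
      c + (Q.bilin (mulFun φ fun x => f x ^ 2) φ + ε) := by
    intro ε hε
    have hev := hweak.eventually (gt_mem_nhds (lt_add_of_pos_right _ hε))
    obtain ⟨N, hN⟩ := eventually_atTop.1 hev
    refine (hQ.isClosedForm.mem_domain_and_val_le hq hQ.nonneg (u := fun n => mulFun φ (u (n + N)))
      (fun n => (hu _).2.1) (fun n => ?_) ((tendsto_add_atTop_iff_nat N).2 hlim1)).2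
    have h1 := hc (n + N)
    change Q.val (mulFun φ (u (n + N))) - Q.bilin (mulFun φ fun x => u (n + N) x ^ 2) φ ≤ c at h1
    have h2 := hN (n + N) (Nat.le_add_left _ _)
    linarith
  change Q.val (mulFun φ f) - Q.bilin (mulFun φ fun x => f x ^ 2) φ ≤ c
  refine le_of_forall_pos_le_add fun ε hε => ?_
  linarith [key ε hε]

theorem preCut_trunc {φ : L2Space m} (hφ : φ ∈ Q.cutoffs) (k : ℝ≥0) {f : L2Space m}
    (hf : f ∈ (Q.preCut φ).domain) : trunc k f ∈ (Q.preCut φ).domain ∧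
      (Q.preCut φ).val (trunc k f) ≤ (Q.preCut φ).val f :=
  preCut_mono hQ hφ hφ le_rfl hf (coeFn_trunc k f) (abs_trunc_le k f) (p := fun _ => True)
    (by simp) fun _ _ _ _ => abs_cap_sub_le k _ _

theorem preCut_isClosableForm {φ : L2Space m} (hφ : φ ∈ Q.cutoffs) :
    (Q.preCut φ).IsClosableForm := by
  intro u f c hu hf hc hlim
  obtain ⟨k, hk⟩ := exists_bound hf.1
  have h := preCut_lsc_of_bounded hQ hφ (u := fun n => trunc k (u n))
    (fun n => (preCut_trunc hQ hφ k (hu n)).1) (fun n => abs_trunc_le k _)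
    (fun n => (preCut_trunc hQ hφ k (hu n)).2.trans (hc n))
    (((continuous_trunc k).tendsto f).comp hlim)
  rw [trunc_eq_self hk] at h
  exact h.2

end PreCut

end L2Form

/-! ### The forms `Q_φ` and the active main part -/

namespace L2Form

open L2Space

variable {X : Type*} [MeasurableSpace X] {m : Measure X} [SigmaFinite m]

section Cut

variable {Q : L2Form m} (hQ : Q.IsDirichlet) {φ : L2Space m} (hφ : φ ∈ Q.cutoffs)
include hQ hφ

theorem cut_isQuadratic : (Q.cut φ).IsQuadratic :=
  closure_isQuadratic (preCut_isQuadratic hQ hφ) (preCut_nonneg hQ hφ)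
    (preCut_isClosableForm hQ hφ)

theorem cut_nonneg : ∀ f ∈ (Q.cut φ).domain, 0 ≤ (Q.cut φ).val f :=
  closure_nonneg (preCut_isQuadratic hQ hφ) (preCut_nonneg hQ hφ) (preCut_isClosableForm hQ hφ)

theorem cut_lsc {u : ℕ → L2Space m} {f : L2Space m} {c : ℝ}
    (hu : ∀ n, u n ∈ (Q.cut φ).domain) (hc : ∀ n, (Q.cut φ).val (u n) ≤ c)
    (hlim : Tendsto u atTop (𝓝 f)) : f ∈ (Q.cut φ).domain ∧ (Q.cut φ).val f ≤ c :=
  closure_mem_domain_and_val_le (preCut_isQuadratic hQ hφ) (preCut_nonneg hQ hφ)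
    (preCut_isClosableForm hQ hφ) hu hc hlim

theorem mem_cut_of_mem_preCut {f : L2Space m} (hf : f ∈ (Q.preCut φ).domain) :
    f ∈ (Q.cut φ).domain ∧ (Q.cut φ).val f = (Q.preCut φ).val f :=
  mem_closure_of_mem (preCut_isQuadratic hQ hφ) (preCut_nonneg hQ hφ)
    (preCut_isClosableForm hQ hφ) hf

/-- Passing to the closure does not add bounded functions to the domain. -/
theorem mem_preCut_of_mem_cut {f : L2Space m} (hf : f ∈ (Q.cut φ).domain) {k : ℝ≥0}
    (hk : ∀ᵐ x ∂m, |f x| ≤ k) : f ∈ (Q.preCut φ).domain := by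
  obtain ⟨u, hu, huc, hlim⟩ := exists_tendsto_of_mem_closure (preCut_isQuadratic hQ hφ)
    (preCut_nonneg hQ hφ) (preCut_isClosableForm hQ hφ) hf (lt_add_one _)
  have h := preCut_lsc_of_bounded hQ hφ (u := fun n => trunc k (u n))
    (fun n => (preCut_trunc hQ hφ k (hu n)).1) (fun n => abs_trunc_le k _)
    (fun n => (preCut_trunc hQ hφ k (hu n)).2.trans (huc n))
    (((continuous_trunc k).tendsto f).comp hlim)
  rw [trunc_eq_self hk] at h
  exact h.1

/-- Normal contractions operate on the forms `Q_ψ`, and these forms increase in `ψ`. -/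
theorem cut_compLp {ψ : L2Space m} (hψ : ψ ∈ Q.cutoffs) (hle : φ ≤ ψ) {T : ℝ → ℝ}
    (hT : LipschitzWith 1 T) (hT0 : T 0 = 0) {f : L2Space m} (hf : f ∈ (Q.cut ψ).domain) :
    hT.compLp hT0 f ∈ (Q.cut φ).domain ∧ (Q.cut φ).val (hT.compLp hT0 f) ≤ (Q.cut ψ).val f := by
  have hTs : ∀ s t, |T s - T t| ≤ |s - t| := fun s t => by
    simpa [Real.dist_eq] using hT.dist_le_mul s t
  have key : ∀ ε > 0, hT.compLp hT0 f ∈ (Q.cut φ).domain ∧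
      (Q.cut φ).val (hT.compLp hT0 f) ≤ (Q.cut ψ).val f + ε := by
    intro ε hε
    obtain ⟨u, hu, huc, hlim⟩ := exists_tendsto_of_mem_closure (preCut_isQuadratic hQ hψ)
      (preCut_nonneg hQ hψ) (preCut_isClosableForm hQ hψ) hf (lt_add_of_pos_right _ hε)
    have h1 : ∀ n, hT.compLp hT0 (u n) ∈ (Q.preCut φ).domain ∧
        (Q.preCut φ).val (hT.compLp hT0 (u n)) ≤ (Q.preCut ψ).val (u n) := by
      intro n
      obtain ⟨k, hk⟩ := exists_bound (hu n).1
      refine preCut_mono hQ hφ hψ hle (hu n) (hT.coeFn_compLp hT0 (u n)) (k := k) ?_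
        (p := fun _ => True) (by simp) fun x y _ _ => hTs _ _
      filter_upwards [hk, hT.coeFn_compLp hT0 (u n)] with x h1 h2
      rw [h2]
      refine le_trans ?_ h1
      simpa [hT0] using hTs (u n x) 0
    exact mem_closure_of_tendsto (preCut_isQuadratic hQ hφ) (preCut_nonneg hQ hφ)
      (preCut_isClosableForm hQ hφ) (fun n => (h1 n).1) (fun n => (h1 n).2.trans (huc n))
      (((hT.continuous_compLp hT0).tendsto f).comp hlim)
  exact ⟨(key 1 one_pos).1, le_of_forall_pos_le_add fun ε hε => (key ε hε).2⟩

theorem cut_mono {ψ : L2Space m} (hψ : ψ ∈ Q.cutoffs) (hle : φ ≤ ψ) {f : L2Space m}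
    (hf : f ∈ (Q.cut ψ).domain) : f ∈ (Q.cut φ).domain ∧ (Q.cut φ).val f ≤ (Q.cut ψ).val f := by
  have h := cut_compLp hQ hφ hψ hle (T := fun t => t) LipschitzWith.id rfl hf
  have e : (LipschitzWith.id (α := ℝ)).compLp (p := 2) (μ := m) rfl f = f :=
    Lp.ext ((LipschitzWith.id (α := ℝ)).coeFn_compLp rfl f)
  rwa [e] at h

/-- If the increments of the bounded function `h` are controlled by those of `f ∈ D(Q)`, then
`φ h ∈ D(Q)`. -/
theorem mulFun_mem_of_mem_domain {f : L2Space m} (hf : f ∈ Q.domain) {h : X → ℝ}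
    (hm : AEStronglyMeasurable h m) {C K : ℝ} (hK : 0 ≤ K) (hC : ∀ᵐ x ∂m, |h x| ≤ C)
    {p : X → Prop} (hp : ∀ᵐ x ∂m, p x)
    (hpair : ∀ x y, p x → p y → (h x - h y) ^ 2 ≤ K * (f x - f y) ^ 2) :
    mulFun φ h ∈ Q.domain := by
  refine (hQ.mem_domain_of_le_sum (g := mulFun φ h) (G := fun x => φ x * h x)
    ![2 * K, 2 * C ^ 2] (u := ![f, φ]) (v := ![f, φ]) (U := ![f, φ]) (V := ![f, φ])
    (by intro i; fin_cases i; exacts [hf, hφ.1]) (by intro i; fin_cases i; exacts [hf, hφ.1])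
    (by intro i; fin_cases i <;> exact Eventually.of_forall fun _ => rfl)
    (by intro i; fin_cases i <;> exact Eventually.of_forall fun _ => rfl)
    (coeFn_ofFun_mul φ hm hC) (p := fun x => p x ∧ |h x| ≤ C ∧ 0 ≤ φ x ∧ φ x ≤ 1) (by
      filter_upwards [hp, hC, nonneg_iff.1 hφ.2.1, hφ.2.2] with x h1 h2 h3 h4
      exact ⟨h1, h2, h3, h4⟩) ?_ ?_).1
  · rintro x ⟨h1, h2, h3, h4⟩
    simp only [Fin.sum_univ_two, Matrix.cons_val]
    have h5 : h x ^ 2 ≤ C ^ 2 := sq_le_sq' (abs_le.1 h2).1 (abs_le.1 h2).2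
    have h6 : φ x ^ 2 * h x ^ 2 ≤ φ x ^ 2 * C ^ 2 := mul_le_mul_of_nonneg_left h5 (sq_nonneg _)
    have h7 : 0 ≤ φ x ^ 2 * C ^ 2 + 2 * K * (f x) ^ 2 := by positivity
    rw [mul_pow]
    refine h6.trans (le_of_sub_nonneg (h7.trans_eq ?_))
    ring
  · rintro x y ⟨h1, h2, h3, h4⟩ ⟨k1, k2, k3, k4⟩
    simp only [Fin.sum_univ_two, Matrix.cons_val]
    refine (sq_mul_sub_mul_le h3 k3 h4 k4 h2 k2 (hpair x y h1 k1)).trans_eq ?_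
    ring

/-- `Q_φ ≤ Q` on bounded functions in `D(Q)`, because
`φ(x) φ(y) (f(x) - f(y))² ≤ (f(x) - f(y))²`. -/
theorem mem_preCut_of_mem_domain {f : L2Space m} (hf : f ∈ Q.domain) {k : ℝ≥0}
    (hk : ∀ᵐ x ∂m, |f x| ≤ k) :
    f ∈ (Q.preCut φ).domain ∧ (Q.preCut φ).val f ≤ Q.val f := by
  have hft := memLp_top_of_abs_le hk
  have h1 : mulFun φ f ∈ Q.domain :=
    mulFun_mem_of_mem_domain hQ hφ hf (Lp.memLp f).1 zero_le_one hk (p := fun _ => True) (by simp)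
      fun x y _ _ => (one_mul _).ge
  have h2 : mulFun φ (fun x => f x ^ 2) ∈ Q.domain := by
    refine mulFun_mem_of_mem_domain hQ hφ hf ((Lp.memLp f).1.pow 2) (C := k ^ 2)
      (K := 4 * k ^ 2) (by positivity) ?_ (p := fun x => |f x| ≤ k) hk ?_
    · filter_upwards [hk] with x hx
      rw [abs_pow]
      exact pow_le_pow_left₀ (abs_nonneg _) hx 2
    · intro x y e3 e6
      have e7 : (f x + f y) ^ 2 ≤ 4 * (k : ℝ) ^ 2 := by
        have : |f x + f y| ≤ |2 * (k : ℝ)| := by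
          rw [abs_of_nonneg (a := 2 * (k : ℝ)) (by positivity)]
          exact (abs_add_le _ _).trans (by linarith)
        calc (f x + f y) ^ 2 ≤ (2 * (k : ℝ)) ^ 2 := sq_le_sq.2 this
          _ = 4 * (k : ℝ) ^ 2 := by ring
      calc (f x ^ 2 - f y ^ 2) ^ 2 = (f x + f y) ^ 2 * (f x - f y) ^ 2 := by ring
        _ ≤ 4 * k ^ 2 * (f x - f y) ^ 2 := mul_le_mul_of_nonneg_right e7 (sq_nonneg _)
  refine ⟨⟨hft, h1, h2⟩, ?_⟩
  have h3 := hQ.sum_bilin_nonneg ![1, -1, 1]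
    (u := ![f, mulFun φ f, mulFun φ fun x => f x ^ 2]) (v := ![f, mulFun φ f, φ])
    (U := ![f, fun x => φ x * f x, fun x => φ x * f x ^ 2]) (V := ![f, fun x => φ x * f x, φ])
    (by intro i; fin_cases i; exacts [hf, h1, h2]) (by intro i; fin_cases i; exacts [hf, h1, hφ.1])
    (by intro i; fin_cases i
        exacts [Eventually.of_forall fun _ => rfl, coeFn_mulFun φ hft, coeFn_mulFun_sq φ hft])
    (by intro i; fin_cases i
        exacts [Eventually.of_forall fun _ => rfl, coeFn_mulFun φ hft,
          Eventually.of_forall fun _ => rfl])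
    (p := fun x => 0 ≤ φ x ∧ φ x ≤ 1) (by
      filter_upwards [nonneg_iff.1 hφ.2.1, hφ.2.2] with x h1 h2 using ⟨h1, h2⟩)
    (by
      rintro x ⟨e1, e2⟩
      simp only [Fin.sum_univ_three, Matrix.cons_val]
      refine (mul_self_nonneg (f x)).trans_eq ?_
      ring)
    (by
      rintro x y ⟨e1, e2⟩ ⟨k1, k2⟩
      simp only [Fin.sum_univ_three, Matrix.cons_val]
      have e3 : φ x * φ y ≤ 1 := mul_le_one₀ e2 k1 k2
      have e5 : φ x * φ y * (f x - f y) ^ 2 ≤ (f x - f y) ^ 2 :=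
        mul_le_of_le_one_left (sq_nonneg _) e3
      refine (sub_nonneg.2 e5).trans_eq ?_
      ring)
  simp only [Fin.sum_univ_three, Matrix.cons_val] at h3
  rw [hQ.isQuadratic.bilin_self hf, hQ.isQuadratic.bilin_self h1] at h3
  change Q.val (mulFun φ f) - Q.bilin (mulFun φ fun x => f x ^ 2) φ ≤ Q.val f
  linarith

theorem mem_cut_of_mem_domain {f : L2Space m} (hf : f ∈ Q.domain) :
    f ∈ (Q.cut φ).domain ∧ (Q.cut φ).val f ≤ Q.val f := by
  have h : ∀ n : ℕ, trunc (n : ℝ≥0) f ∈ (Q.preCut φ).domain ∧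
      (Q.preCut φ).val (trunc (n : ℝ≥0) f) ≤ Q.val f := fun n => by
    have h1 := hQ.trunc_mem n hf
    have h2 := mem_preCut_of_mem_domain hQ hφ h1.1 (abs_trunc_le n f)
    exact ⟨h2.1, h2.2.trans h1.2⟩
  exact mem_closure_of_tendsto (preCut_isQuadratic hQ hφ) (preCut_nonneg hQ hφ)
    (preCut_isClosableForm hQ hφ) (fun n => (h n).1) (fun n => (h n).2) (tendsto_trunc f)

end Cut

section MainPart

variable {Q : L2Form m} (hQ : Q.IsDirichlet)
include hQ

theorem sup_mem_cutoffs {φ ψ : L2Space m} (hφ : φ ∈ Q.cutoffs) (hψ : ψ ∈ Q.cutoffs) :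
    φ ⊔ ψ ∈ Q.cutoffs := by
  refine ⟨?_, hφ.2.1.trans le_sup_left, ?_⟩
  · refine (hQ.mem_domain_of_le_sum (g := φ ⊔ ψ) (G := fun x => max (φ x) (ψ x))
      ![1, 1] (u := ![φ, ψ]) (v := ![φ, ψ]) (U := ![φ, ψ]) (V := ![φ, ψ])
      (by intro i; fin_cases i; exacts [hφ.1, hψ.1]) (by intro i; fin_cases i; exacts [hφ.1, hψ.1])
      (by intro i; fin_cases i <;> exact Eventually.of_forall fun _ => rfl)
      (by intro i; fin_cases i <;> exact Eventually.of_forall fun _ => rfl)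
      (Lp.coeFn_sup φ ψ) (p := fun _ => True) (by simp) ?_ ?_).1
    · intro x _
      simp only [Fin.sum_univ_two, Matrix.cons_val]
      rcases max_choice (φ x) (ψ x) with h | h
      · rw [h]; linarith [mul_self_nonneg (ψ x)]
      · rw [h]; linarith [mul_self_nonneg (φ x)]
    · intro x y _ _
      simp only [Fin.sum_univ_two, Matrix.cons_val]
      have h := abs_max_sub_max_le_max (φ x) (ψ x) (φ y) (ψ y)
      have h2 := sq_le_sq.2 (h.trans (le_abs_self _))
      rcases max_choice |φ x - φ y| |ψ x - ψ y| with e | e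
      · rw [e, sq_abs] at h2
        linarith [mul_self_nonneg (ψ x - ψ y)]
      · rw [e, sq_abs] at h2
        linarith [mul_self_nonneg (φ x - φ y)]
  · filter_upwards [hφ.2.2, hψ.2.2, Lp.coeFn_sup φ ψ] with x h1 h2 h3
    rw [h3]
    exact max_le h1 h2

omit hQ [SigmaFinite m] in
theorem cut_le_mainPart {f : L2Space m} (hf : f ∈ Q.mainPart.domain) {φ : L2Space m}
    (hφ : φ ∈ Q.cutoffs) : (Q.cut φ).val f ≤ Q.mainPart.val f :=
  le_csSup hf.2 ⟨φ, hφ, rfl⟩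

omit [SigmaFinite m] in
theorem mem_mainPart_of_le {f : L2Space m} {c : ℝ}
    (h : ∀ φ ∈ Q.cutoffs, f ∈ (Q.cut φ).domain ∧ (Q.cut φ).val f ≤ c) :
    f ∈ Q.mainPart.domain ∧ Q.mainPart.val f ≤ c := by
  refine ⟨⟨fun φ hφ => (h φ hφ).1, c, ?_⟩, csSup_le ?_ ?_⟩
  · rintro _ ⟨φ, hφ, rfl⟩; exact (h φ hφ).2
  · exact ⟨_, 0, zero_mem_cutoffs hQ, rfl⟩
  · rintro _ ⟨φ, hφ, rfl⟩; exact (h φ hφ).2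

theorem mainPart_nonneg : ∀ f ∈ Q.mainPart.domain, 0 ≤ Q.mainPart.val f := fun f hf =>
  (cut_nonneg hQ (zero_mem_cutoffs hQ) f (hf.1 _ (zero_mem_cutoffs hQ))).trans
    (cut_le_mainPart hf (zero_mem_cutoffs hQ))

theorem tendsto_cut_mainPart {f : L2Space m} (hf : f ∈ Q.mainPart.domain) :
    Tendsto (fun φ : Q.cutoffs => (Q.cut φ).val f) atTop (𝓝 (Q.mainPart.val f)) := by
  have h := tendsto_atTop_ciSup (f := fun φ : Q.cutoffs => (Q.cut φ).val f)
    (fun φ ψ hle => (cut_mono hQ φ.2 ψ.2 hle (hf.1 _ ψ.2)).2) ?_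
  · rwa [← sSup_image' (f := fun φ => (Q.cut φ).val f)] at h
  · obtain ⟨c, hc⟩ := hf.2
    refine ⟨c, ?_⟩
    rintro _ ⟨φ, rfl⟩
    exact hc ⟨φ, φ.2, rfl⟩

theorem atTop_cutoffs_neBot : (atTop : Filter Q.cutoffs).NeBot := by
  have hnonempty : Nonempty Q.cutoffs := ⟨⟨0, zero_mem_cutoffs hQ⟩⟩
  have hdir : IsDirectedOrder Q.cutoffs := ⟨fun φ ψ =>
    ⟨⟨φ ⊔ ψ, sup_mem_cutoffs hQ φ.2 ψ.2⟩, le_sup_left (a := (φ : L2Space m)),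
      le_sup_right (a := (φ : L2Space m))⟩⟩
  infer_instance

theorem mainPart_isQuadratic : Q.mainPart.IsQuadratic := by
  have hneBot := atTop_cutoffs_neBot hQ
  have hc : ∀ φ : Q.cutoffs, (Q.cut φ).IsQuadratic := fun φ => cut_isQuadratic hQ φ.2
  have hadd : ∀ f ∈ Q.mainPart.domain, ∀ g ∈ Q.mainPart.domain, f + g ∈ Q.mainPart.domain := by
    intro f hf g hg
    refine (mem_mainPart_of_le hQ (c := 2 * Q.mainPart.val f + 2 * Q.mainPart.val g)
      fun φ hφ => ⟨(cut_isQuadratic hQ hφ).add_mem (hf.1 φ hφ) (hg.1 φ hφ), ?_⟩).1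
    have h1 := (cut_isQuadratic hQ hφ).val_add_le (cut_nonneg hQ hφ) (hf.1 φ hφ) (hg.1 φ hφ)
    have h2 := cut_le_mainPart hf hφ
    have h3 := cut_le_mainPart hg hφ
    linarith
  have hsmul : ∀ (c : ℝ), ∀ f ∈ Q.mainPart.domain, c • f ∈ Q.mainPart.domain := by
    intro c f hf
    refine (mem_mainPart_of_le hQ (c := c * c * Q.mainPart.val f)
      fun φ hφ => ⟨(cut_isQuadratic hQ hφ).smul_mem c (hf.1 φ hφ), ?_⟩).1
    rw [(cut_isQuadratic hQ hφ).val_smul c (hf.1 φ hφ)]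
    exact mul_le_mul_of_nonneg_left (cut_le_mainPart hf hφ) (mul_self_nonneg c)
  have ht := fun {f : L2Space m} hf => tendsto_cut_mainPart hQ (f := f) hf
  refine isQuadratic_of ?_ hadd hsmul ?_ ?_ ?_
  · refine (mem_mainPart_of_le hQ (c := 0) fun φ hφ => ⟨(cut_isQuadratic hQ hφ).zero_mem, ?_⟩).1
    rw [(cut_isQuadratic hQ hφ).val_zero]
  · intro c f hf
    refine tendsto_nhds_unique (ht (hsmul c f hf)) (((ht hf).const_mul (c * c)).congr fun φ => ?_)
    rw [(hc φ).val_smul c (hf.1 φ φ.2)]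
  · intro f hf g hg h hh
    refine tendsto_nhds_unique ((ht (hadd _ (hadd f hf g hg) h hh)).add (((ht hf).add (ht hg)).add
      (ht hh))) ((((ht (hadd f hf g hg)).add (ht (hadd g hg h hh))).add
        (ht (hadd h hh f hf))).congr fun φ => ?_)
    exact ((hc φ).val_add_three (hf.1 φ φ.2) (hg.1 φ φ.2) (hh.1 φ φ.2)).symm
  · intro c f hf g hg
    refine tendsto_nhds_unique (ht (hadd _ (hsmul c f hf) g hg)) (((((ht hf).const_mul
      (c * c)).add (ht hg)).add ((((ht (hadd f hf g hg)).sub (ht hf)).sub (ht hg)).const_mul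
        c)).congr fun φ => ?_)
    exact ((hc φ).val_smul_add c (hf.1 φ φ.2) (hg.1 φ φ.2)).symm

theorem mainPart_isClosedForm : Q.mainPart.IsClosedForm := by
  refine (mainPart_isQuadratic hQ).isClosedForm_of (mainPart_nonneg hQ) ?_
  intro u f c hu hc hlim
  exact mem_mainPart_of_le hQ fun φ hφ => cut_lsc hQ hφ (fun n => (hu n).1 φ hφ)
    (fun n => (cut_le_mainPart (hu n) hφ).trans (hc n)) hlim

theorem mainPart_compLp {T : ℝ → ℝ} (hT : LipschitzWith 1 T) (hT0 : T 0 = 0) {f : L2Space m}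
    (hf : f ∈ Q.mainPart.domain) : hT.compLp hT0 f ∈ Q.mainPart.domain ∧
      Q.mainPart.val (hT.compLp hT0 f) ≤ Q.mainPart.val f := by
  refine mem_mainPart_of_le hQ fun φ hφ => ?_
  have h := cut_compLp hQ hφ hφ le_rfl hT hT0 (hf.1 φ hφ)
  exact ⟨h.1, h.2.trans (cut_le_mainPart hf hφ)⟩

theorem mem_mainPart_of_mem_domain {f : L2Space m} (hf : f ∈ Q.domain) :
    f ∈ Q.mainPart.domain ∧ Q.mainPart.val f ≤ Q.val f :=
  mem_mainPart_of_le hQ fun _ hφ => mem_cut_of_mem_domain hQ hφ hf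

/-- The active main part of a Dirichlet form is a Dirichlet form. -/
theorem mainPart_isDirichlet : Q.mainPart.IsDirichlet where
  isQuadratic := mainPart_isQuadratic hQ
  nonneg := mainPart_nonneg hQ
  dense := hQ.dense.mono fun _ hf => (mem_mainPart_of_mem_domain hQ hf).1
  isClosedForm := mainPart_isClosedForm hQ
  markov := by
    intro f hf
    have hT : LipschitzWith 1 fun t : ℝ => min (max t 0) 1 :=
      ((LipschitzWith.id (α := ℝ)).max_const 0).min_const 1
    have h := mainPart_compLp hQ hT (by simp) hf
    have e : hT.compLp (by simp) f = f.unitCut :=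
      Lp.ext ((hT.coeFn_compLp (by simp) f).trans (L2Space.memLp_unitCut f).coeFn_toLp.symm)
    rwa [e] at h

/-- `D(Q)` is an order ideal in the domain of the active main part. If `|g| ≤ |f|` with `f ∈ D(Q)`,
then `g` is approximated by the functions `h` which arise from `g` by lowering `|g|` by `ε`. The
cutoff function `φ = (|f| / ε) ∧ 1` equals `1` on the support of `h`, so that
`Q(h) ≤ Q_φ(h) + Q(f)`. -/
theorem domain_isOrderIdealIn_mainPart : IsOrderIdealIn Q.domain Q.mainPart.domain := by
  intro f hf g hg hgf
  have hgf' : ∀ᵐ x ∂m, |g x| ≤ |f x| := by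
    filter_upwards [le_iff.1 hgf, Lp.coeFn_abs f, Lp.coeFn_abs g] with x h1 h2 h3
    rwa [h2, h3] at h1
  -- `shrink ε` moves a real number by `ε` towards `0`.
  set shrink : ℝ≥0 → ℝ → ℝ := fun ε t => t - cap ε t with hshrink
  have hshrinkL : ∀ ε s t, |shrink ε s - shrink ε t| ≤ |s - t| := by
    have hmono : ∀ ε, Monotone (cap ε) := fun ε s t hst =>
      max_le_max le_rfl (min_le_min hst le_rfl)
    have key : ∀ ε s t, s ≤ t → |shrink ε s - shrink ε t| ≤ |s - t| := by
      intro ε s t hst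
      have h1 := hmono ε hst
      have h2 := abs_cap_sub_le ε s t
      rw [abs_of_nonpos (by linarith), abs_of_nonpos (by linarith)] at h2
      simp only [hshrink]
      rw [abs_of_nonpos (by linarith), abs_of_nonpos (by linarith)]
      linarith
    intro ε s t
    rcases le_total s t with h | h
    · exact key ε s t h
    · rw [abs_sub_comm, abs_sub_comm s]; exact key ε t s h
  have hshrink0 : ∀ ε, shrink ε 0 = 0 := fun ε => by simp [hshrink, cap_zero]
  have hshrink_le : ∀ ε t, |shrink ε t| ≤ max (|t| - ε) 0 := by
    intro ε t
    simp only [hshrink, cap]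
    have hε : (0 : ℝ) ≤ ε := ε.2
    rcases le_total t ε with h1 | h1
    · rcases le_total (-(ε : ℝ)) t with h2 | h2
      · rw [min_eq_left h1, max_eq_right h2, sub_self, abs_zero]; exact le_max_right _ _
      · rw [min_eq_left h1, max_eq_left h2, abs_of_nonpos (by linarith),
          abs_of_nonpos (by linarith)]
        exact le_max_of_le_left (by linarith)
    · rw [min_eq_right h1, max_eq_right (by linarith), abs_of_nonneg (by linarith),
        abs_of_nonneg (by linarith)]
      exact le_max_left _ _
  set T : ℕ → ℝ → ℝ := fun n t => shrink (1 / ((n : ℝ≥0) + 1)) (cap n t) with hT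
  have hTL : ∀ n, LipschitzWith 1 (T n) := fun n => LipschitzWith.of_dist_le_mul fun s t => by
    simpa [Real.dist_eq] using (hshrinkL _ _ _).trans (abs_cap_sub_le n s t)
  have hT0 : ∀ n, T n 0 = 0 := fun n => by simp only [hT, cap_zero, hshrink0]
  set h : ℕ → L2Space m := fun n => (hTL n).compLp (hT0 n) g with hh
  have hhx : ∀ n, ∀ᵐ x ∂m, h n x = T n (g x) := fun n => (hTL n).coeFn_compLp (hT0 n) g
  have hTabs : ∀ n t, |T n t| ≤ |t| := fun n t => by
    have := (hTL n).dist_le_mul t 0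
    simpa [Real.dist_eq, hT0] using this
  have hlim : Tendsto h atTop (𝓝 g) := by
    refine tendsto_of_dominated (g := g) (fun n => ?_) ?_
    · filter_upwards [hhx n] with x hx
      rw [hx]; exact hTabs n _
    · filter_upwards [ae_all_iff.2 hhx] with x hx
      obtain ⟨N, hN⟩ := exists_nat_ge |g x|
      rw [tendsto_iff_dist_tendsto_zero]
      refine squeeze_zero' (Eventually.of_forall fun _ => dist_nonneg) ?_
        (tendsto_one_div_add_atTop_nhds_zero_nat (𝕜 := ℝ))
      filter_upwards [eventually_ge_atTop N] with n hn
      have h1 : (N : ℝ) ≤ n := by exact_mod_cast hn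
      have h2 : cap n (g x) = g x := cap_of_abs_le (by simpa using hN.trans h1)
      rw [hx n, Real.dist_eq]
      simp only [hT, hshrink, h2]
      rw [show g x - cap (1 / ((n : ℝ≥0) + 1)) (g x) - g x = -cap (1 / ((n : ℝ≥0) + 1)) (g x) by
        ring, abs_neg]
      simpa using abs_cap_le (1 / ((n : ℝ≥0) + 1)) (g x)
  have hbound : ∀ n, h n ∈ Q.domain ∧ Q.val (h n) ≤ Q.mainPart.val g + Q.val f := by
    intro n
    set ε : ℝ≥0 := 1 / ((n : ℝ≥0) + 1) with hε
    have hε0 : 0 < ε := by positivity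
    have hφm := hQ.markov _ (hQ.isQuadratic.smul_mem (ε : ℝ)⁻¹ (hQ.abs_mem hf).1)
    set φ : L2Space m := ((ε : ℝ)⁻¹ • |f|).unitCut with hφdef
    have hφx : ∀ᵐ x ∂m, φ x = min (max ((ε : ℝ)⁻¹ * |f x|) 0) 1 := by
      filter_upwards [(L2Space.memLp_unitCut ((ε : ℝ)⁻¹ • |f|)).coeFn_toLp,
        Lp.coeFn_smul (ε : ℝ)⁻¹ |f|, Lp.coeFn_abs f] with x h1 h2 h3
      rw [hφdef, L2Space.unitCut, h1, h2, Pi.smul_apply, h3, smul_eq_mul]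
    have hφ : φ ∈ Q.cutoffs := by
      refine ⟨hφm.1, ?_, ?_⟩
      · rw [nonneg_iff]
        filter_upwards [hφx] with x hx
        rw [hx]
        exact le_min (le_max_right _ _) zero_le_one
      · filter_upwards [hφx] with x hx
        rw [hx]
        exact min_le_right _ _
    have hcut := cut_compLp hQ hφ hφ le_rfl (hTL n) (hT0 n) (hg.1 φ hφ)
    have hhk : ∀ᵐ x ∂m, |h n x| ≤ (n : ℝ≥0) := by
      filter_upwards [hhx n] with x hx
      rw [hx]
      refine le_trans ?_ (abs_cap_le (n : ℝ≥0) (g x))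
      simpa [hshrink0] using hshrinkL ε (cap n (g x)) 0
    have hpre : h n ∈ (Q.preCut φ).domain := mem_preCut_of_mem_cut hQ hφ hcut.1 hhk
    have hval : (Q.preCut φ).val (h n) ≤ Q.mainPart.val g := by
      rw [← (mem_cut_of_mem_preCut hQ hφ hpre).2]
      exact hcut.2.trans (cut_le_mainPart hg hφ)
    have hmain := hQ.mem_domain_of_le_sum (g := h n) (G := h n) ![1, -1, 1]
      (u := ![mulFun φ (h n), mulFun φ fun x => h n x ^ 2, f]) (v := ![mulFun φ (h n), φ, f])
      (U := ![fun x => φ x * h n x, fun x => φ x * h n x ^ 2, f])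
      (V := ![fun x => φ x * h n x, φ, f])
      (by intro i; fin_cases i; exacts [hpre.2.1, hpre.2.2, hf])
      (by intro i; fin_cases i; exacts [hpre.2.1, hφ.1, hf])
      (by intro i; fin_cases i
          exacts [coeFn_mulFun φ hpre.1, coeFn_mulFun_sq φ hpre.1,
            Eventually.of_forall fun _ => rfl])
      (by intro i; fin_cases i
          exacts [coeFn_mulFun φ hpre.1, Eventually.of_forall fun _ => rfl,
            Eventually.of_forall fun _ => rfl])
      (Eventually.of_forall fun _ => rfl)
      (p := fun x => |h n x| ≤ max (|f x| - ε) 0 ∧ 0 ≤ φ x ∧ (ε ≤ |f x| → φ x = 1)) (by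
        filter_upwards [hhx n, hφx, hgf', nonneg_iff.1 hφ.2.1] with x h1 h2 h3 h4
        refine ⟨?_, h4, fun h5 => ?_⟩
        · rw [h1]
          refine (hshrink_le ε _).trans (max_le_max ?_ le_rfl)
          linarith [abs_cap_le_abs n (g x)]
        · have h6 : 1 ≤ (ε : ℝ)⁻¹ * |f x| := by
            rw [inv_mul_eq_div, le_div_iff₀ (by exact_mod_cast hε0), one_mul]; exact h5
          rw [h2, max_eq_left (zero_le_one.trans h6), min_eq_right h6])
      (by
        rintro x ⟨e1, e2, e3⟩
        simp only [Fin.sum_univ_three, Matrix.cons_val]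
        have e4 : h n x ^ 2 ≤ f x ^ 2 := by
          rw [sq_le_sq]
          exact e1.trans (max_le (by linarith [ε.2]) (abs_nonneg _))
        refine e4.trans_eq ?_
        ring)
      (by
        have hdisj : ∀ x y, |h n x| ≤ max (|f x| - ε) 0 → |h n y| ≤ max (|f y| - ε) 0 →
            |f y| < ε → (h n x - h n y) ^ 2 ≤ (f x - f y) ^ 2 := by
          intro x y e1 e2 e3
          rw [max_eq_right (a := |f y| - (ε : ℝ)) (by linarith)] at e2
          rw [abs_nonpos_iff.1 e2, sub_zero, sq_le_sq]
          refine e1.trans (max_le ?_ (abs_nonneg _))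
          linarith [abs_sub_abs_le_abs_sub (f x) (f y)]
        rintro x y ⟨e1, e2, e3⟩ ⟨k1, k2, k3⟩
        simp only [Fin.sum_univ_three, Matrix.cons_val]
        have e4 : (h n x - h n y) ^ 2 ≤
            φ x * φ y * (h n x - h n y) ^ 2 + (f x - f y) ^ 2 := by
          have e5 : 0 ≤ φ x * φ y * (h n x - h n y) ^ 2 := by positivity
          rcases lt_or_ge |f y| (ε : ℝ) with c1 | c1
          · linarith [hdisj x y e1 k1 c1]
          · rcases lt_or_ge |f x| (ε : ℝ) with c2 | c2
            · have := hdisj y x k1 e1 c2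
              rw [sub_sq_comm (h n y), sub_sq_comm (f y)] at this
              linarith
            · rw [e3 c2, k3 c1]
              linarith [sq_nonneg (f x - f y)]
        refine e4.trans_eq ?_
        ring)
    refine ⟨hmain.1, hmain.2.trans ?_⟩
    simp only [Fin.sum_univ_three, Matrix.cons_val]
    rw [hQ.isQuadratic.bilin_self hpre.2.1, hQ.isQuadratic.bilin_self hf]
    change Q.val (mulFun φ (h n)) - Q.bilin (mulFun φ fun x => h n x ^ 2) φ ≤ _ at hval
    linarith
  exact (hQ.isClosedForm.mem_domain_and_val_le hQ.isQuadratic hQ.nonneg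
    (fun n => (hbound n).1) (fun n => (hbound n).2) hlim).1

end MainPart

end L2Form

/-! ### Existence of the semigroup -/

section BoundedGenerators

variable {E : Type*} [NormedAddCommGroup E] [NormedSpace ℝ E]

theorem exp_add_of_commute_real [CompleteSpace E] {A B : E →L[ℝ] E} (h : Commute A B) :
    NormedSpace.exp (A + B) = NormedSpace.exp A * NormedSpace.exp B :=
  letI : NormedAlgebra ℚ (E →L[ℝ] E) := NormedAlgebra.restrictScalars ℚ ℝ _
  NormedSpace.exp_add_of_commute h

theorem exp_smul_add_smul_one [CompleteSpace E] (r s : ℝ) (J : E →L[ℝ] E) :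
    NormedSpace.exp (r • (1 : E →L[ℝ] E) + s • J) = Real.exp r • NormedSpace.exp (s • J) := by
  have h : Commute (r • (1 : E →L[ℝ] E)) (s • J) :=
    ((Commute.one_left J).smul_left r).smul_right s
  have h2 : NormedSpace.exp (r • (1 : E →L[ℝ] E)) = Real.exp r • (1 : E →L[ℝ] E) := by
    have := NormedSpace.algebraMap_exp_comm (𝔸 := E →L[ℝ] E) r
    rw [Algebra.algebraMap_eq_smul_one, Algebra.algebraMap_eq_smul_one] at this
    rw [← this, Real.exp_eq_exp_ℝ]
  rw [exp_add_of_commute_real h, h2, smul_mul_assoc, one_mul]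

theorem hasSum_exp_smul_apply [CompleteSpace E] (s : ℝ) (J : E →L[ℝ] E) (f : E) :
    HasSum (fun k : ℕ => ((k.factorial : ℝ)⁻¹ * s ^ k) • (J ^ k) f)
      (NormedSpace.exp (s • J) f) := by
  have h := NormedSpace.exp_series_hasSum_exp' (𝕂 := ℝ) (s • J)
  have h2 := (ContinuousLinearMap.apply ℝ E f).hasSum h
  convert h2 using 2 with k
  · simp [smul_pow, mul_smul]
  · rfl

theorem norm_exp_smul_apply_le [CompleteSpace E] {s : ℝ} (hs : 0 ≤ s) {J : E →L[ℝ] E}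
    (hJ : ∀ f, ‖J f‖ ≤ ‖f‖) (f : E) : ‖NormedSpace.exp (s • J) f‖ ≤ Real.exp s * ‖f‖ := by
  have hpow : ∀ k : ℕ, ‖(J ^ k) f‖ ≤ ‖f‖ := by
    intro k
    induction k with
    | zero => simp
    | succ k ih => rw [pow_succ']; exact (hJ _).trans ih
  have h2 : HasSum (fun k : ℕ => ((k.factorial : ℝ)⁻¹ * s ^ k) * ‖f‖) (Real.exp s * ‖f‖) := by
    have := NormedSpace.exp_series_hasSum_exp' (𝕂 := ℝ) s
    rw [← Real.exp_eq_exp_ℝ] at this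
    exact this.mul_right ‖f‖
  refine (hasSum_exp_smul_apply s J f).norm_le_of_bounded h2 fun k => ?_
  rw [norm_smul, Real.norm_of_nonneg (by positivity)]
  exact mul_le_mul_of_nonneg_left (hpow k) (by positivity)

/-- Uniformly bounded operators which tend to `0` on a dense set tend to `0` everywhere. -/
theorem tendsto_zero_of_dense {ι : Type*} {l : Filter ι} {D : ι → E →L[ℝ] E} {C : ℝ}
    (hD : ∀ i f, ‖D i f‖ ≤ C * ‖f‖) {S : Set E} (hS : Dense S)
    (h : ∀ f ∈ S, Tendsto (fun i => D i f) l (𝓝 0)) (f : E) :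
    Tendsto (fun i => D i f) l (𝓝 0) := by
  rw [Metric.tendsto_nhds]
  intro ε hε
  have hC : 0 < |C| + 1 := by positivity
  obtain ⟨g, hg, hfg⟩ := Metric.dense_iff.1 hS f (ε / 2 / (|C| + 1)) (by positivity)
  filter_upwards [Metric.tendsto_nhds.1 (h g hfg) (ε / 2) (half_pos hε)] with i hi
  rw [dist_zero_right] at hi ⊢
  rw [Metric.mem_ball, dist_eq_norm, lt_div_iff₀ hC, norm_sub_rev] at hg
  have h1 : ‖D i f‖ ≤ ‖D i (f - g)‖ + ‖D i g‖ := by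
    have := norm_add_le (D i (f - g)) (D i g)
    rwa [← map_add, sub_add_cancel] at this
  have h2 := hD i (f - g)
  have h3 : C * ‖f - g‖ ≤ ‖f - g‖ * (|C| + 1) := by
    rw [mul_comm]
    exact mul_le_mul_of_nonneg_left (by linarith [le_abs_self C]) (norm_nonneg _)
  linarith

end BoundedGenerators

namespace L2Form

variable {X : Type*} [MeasurableSpace X] {m : Measure X}

/-- The contractions `(n + 1) (L + n + 1)⁻¹`. -/
noncomputable def contr (Q : L2Form m) (n : ℕ) : L2Space m →L[ℝ] L2Space m :=
  ((n : ℝ) + 1) • Q.resolvent ((n : ℝ) + 1)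

/-- The Yosida approximations `(n + 1) (1 - (n + 1) (L + n + 1)⁻¹)` of the operator `L`. -/
noncomputable def yosida (Q : L2Form m) (n : ℕ) : L2Space m →L[ℝ] L2Space m :=
  ((n : ℝ) + 1) • (1 - Q.contr n)

/-- The semigroup generated by a Yosida approximation. -/
noncomputable def yosidaExp (Q : L2Form m) (n : ℕ) (t : ℝ) : L2Space m →L[ℝ] L2Space m :=
  NormedSpace.exp (t • -Q.yosida n)

theorem yosidaExp_eq (Q : L2Form m) (n : ℕ) (t : ℝ) : Q.yosidaExp n t =
    Real.exp (-(t * ((n : ℝ) + 1))) • NormedSpace.exp ((t * ((n : ℝ) + 1)) • Q.contr n) := by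
  rw [← exp_smul_add_smul_one, yosidaExp, yosida]
  congr 1
  module

theorem yosidaExp_zero (Q : L2Form m) (n : ℕ) : Q.yosidaExp n 0 = 1 := by
  rw [yosidaExp, zero_smul, NormedSpace.exp_zero]

theorem yosidaExp_add (Q : L2Form m) (n : ℕ) (s t : ℝ) :
    Q.yosidaExp n (s + t) = Q.yosidaExp n s * Q.yosidaExp n t := by
  rw [yosidaExp, add_smul]
  exact exp_add_of_commute_real (((Commute.refl _).smul_left s).smul_right t)

theorem hasDerivAt_yosidaExp (Q : L2Form m) (n : ℕ) (t : ℝ) (f : L2Space m) :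
    HasDerivAt (fun s => Q.yosidaExp n s f) (-Q.yosidaExp n t (Q.yosida n f)) t := by
  have h := (hasDerivAt_exp_smul_const (-Q.yosida n) t).clm_apply (hasDerivAt_const t f)
  simp only [map_zero, add_zero, mul_apply_eq_comp, neg_apply, map_neg] at h
  exact h

namespace IsDirichlet

variable {Q : L2Form m} (hQ : Q.IsDirichlet)
include hQ

theorem norm_contr_le (n : ℕ) (f : L2Space m) : ‖Q.contr n f‖ ≤ ‖f‖ := by
  have h := hQ.norm_resolvent_le (a := (n : ℝ) + 1) (by positivity) f
  rw [contr, smul_apply, norm_smul, Real.norm_of_nonneg (by positivity)]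
  exact h

theorem norm_yosidaExp_le (n : ℕ) {t : ℝ} (ht : 0 ≤ t) (f : L2Space m) :
    ‖Q.yosidaExp n t f‖ ≤ ‖f‖ := by
  have h := norm_exp_smul_apply_le (s := t * ((n : ℝ) + 1)) (by positivity) (hQ.norm_contr_le n) f
  rw [yosidaExp_eq, smul_apply, norm_smul, Real.norm_of_nonneg (Real.exp_nonneg _)]
  refine (mul_le_mul_of_nonneg_left h (Real.exp_nonneg _)).trans_eq ?_
  rw [← mul_assoc, ← Real.exp_add, neg_add_cancel, Real.exp_zero, one_mul]

theorem operatorGraph_resolvent {a : ℝ} (ha : 0 < a) (f : L2Space m) :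
    Q.OperatorGraph (Q.resolvent a f) (f - a • Q.resolvent a f) := by
  refine ⟨hQ.resolvent_mem ha f, fun g hg => ?_⟩
  rw [hQ.bilin_resolvent ha f hg, inner_sub_left, inner_smul_left]
  simp

theorem eq_resolvent_of_operatorGraph {a : ℝ} (ha : 0 < a) {f h : L2Space m}
    (hf : Q.OperatorGraph f h) : f = Q.resolvent a (h + a • f) := by
  refine hQ.eq_resolvent ha hf.1 fun g hg => ?_
  rw [hf.2 g hg, inner_add_left, inner_smul_left]
  simp

theorem tendsto_contr (f : L2Space m) : Tendsto (fun n => Q.contr n f) atTop (𝓝 f) := by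
  have h := tendsto_zero_of_dense (D := fun n : ℕ => Q.contr n - 1) (C := 2) (l := atTop)
    (fun n f => ?_) hQ.dense (fun g hg => ?_) f
  · have h2 := h.add_const f
    simpa using h2
  · refine (norm_sub_le _ _).trans ?_
    have := hQ.norm_contr_le n f
    change ‖Q.contr n f‖ + ‖f‖ ≤ 2 * ‖f‖
    linarith
  · have h2 := hQ.tendsto_smul_resolvent_of_le (u := g) (c := Q.val g)
      fun n => hQ.approx_self_le (by positivity) hg
    simpa [contr] using h2.sub_const g

theorem dense_operatorDomain : Dense {f : L2Space m | ∃ h, Q.OperatorGraph f h} := by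
  intro f
  refine _root_.mem_closure_of_tendsto (hQ.tendsto_contr f) (Eventually.of_forall fun n => ?_)
  have h := hQ.operatorGraph_resolvent (a := (n : ℝ) + 1) (by positivity)
    (((n : ℝ) + 1) • f)
  rw [map_smul] at h
  exact ⟨_, h⟩

theorem yosida_eq_contr (n : ℕ) {f h : L2Space m} (hf : Q.OperatorGraph f h) :
    Q.yosida n f = Q.contr n h := by
  have h1 := hQ.eq_resolvent_of_operatorGraph (a := (n : ℝ) + 1) (by positivity) hf
  rw [map_add, map_smul] at h1
  rw [yosida, contr]
  simp only [smul_apply, sub_apply, one_apply_eq_self]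
  rw [sub_eq_of_eq_add h1]

theorem commute_resolvent {a b : ℝ} (ha : 0 < a) (hb : 0 < b) :
    Commute (Q.resolvent a) (Q.resolvent b) := by
  rcases eq_or_ne a b with rfl | hab
  · exact Commute.refl _
  have key : ∀ {a b : ℝ}, 0 < a → 0 < b → ∀ f, Q.resolvent b f =
      Q.resolvent a f + (a - b) • Q.resolvent a (Q.resolvent b f) := by
    intro a b ha hb f
    have h1 := hQ.eq_resolvent_of_operatorGraph ha (hQ.operatorGraph_resolvent hb f)
    rw [sub_add_eq_add_sub, add_sub_assoc, ← sub_smul, map_add, map_smul] at h1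
    exact h1
  ext1 f
  have h1 := key ha hb f
  have h2 := key hb ha f
  change Q.resolvent a (Q.resolvent b f) = Q.resolvent b (Q.resolvent a f)
  have h3 : (a - b) • Q.resolvent a (Q.resolvent b f) =
      (a - b) • Q.resolvent b (Q.resolvent a f) := by
    have e1 : (a - b) • Q.resolvent a (Q.resolvent b f) = Q.resolvent b f - Q.resolvent a f :=
      eq_sub_of_add_eq' h1.symm
    have e2 : (b - a) • Q.resolvent b (Q.resolvent a f) = Q.resolvent a f - Q.resolvent b f :=
      eq_sub_of_add_eq' h2.symm
    rw [e1, ← neg_sub b a, neg_smul, e2, neg_sub]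
  exact smul_right_injective _ (sub_ne_zero.2 hab) h3

theorem commute_yosida (n k : ℕ) : Commute (Q.yosida n) (Q.yosida k) := by
  have h1 : Commute (Q.contr n) (Q.contr k) :=
    ((hQ.commute_resolvent (by positivity) (by positivity)).smul_left _).smul_right _
  exact (((Commute.one_left _).sub_left ((Commute.one_right _).sub_right h1)).smul_left
    _).smul_right _

/-- The semigroups of the Yosida approximations are compared by differentiating
`s ↦ exp(-s A_n) exp(-(t - s) A_k) f`. -/
theorem norm_yosidaExp_sub_le (n k : ℕ) {t : ℝ} (ht : 0 ≤ t) (f : L2Space m) :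
    ‖Q.yosidaExp n t f - Q.yosidaExp k t f‖ ≤ ‖Q.yosida n f - Q.yosida k f‖ * t := by
  set D := Q.yosida k - Q.yosida n with hD
  have hcomm : ∀ s : ℝ, Q.yosidaExp k t * NormedSpace.exp (s • D) =
      Q.yosidaExp k (t - s) * Q.yosidaExp n s := by
    intro s
    have e1 : s • D = s • Q.yosida k + s • -Q.yosida n := by rw [hD]; module
    have e2 : Commute (s • Q.yosida k) (s • -Q.yosida n) :=
      ((hQ.commute_yosida k n).neg_right.smul_left s).smul_right s
    rw [e1, exp_add_of_commute_real e2, ← mul_assoc]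
    congr 1
    rw [yosidaExp, yosidaExp, ← exp_add_of_commute_real
      (((Commute.refl (Q.yosida k)).neg_left.smul_left t).smul_right s)]
    congr 1
    module
  have hder : ∀ s : ℝ, HasDerivAt (fun s => (Q.yosidaExp k t * NormedSpace.exp (s • D)) f)
      ((Q.yosidaExp k t * NormedSpace.exp (s • D)) (D f)) s := by
    intro s
    have h1 := ((hasDerivAt_exp_smul_const D s).const_mul (Q.yosidaExp k t)).clm_apply
      (hasDerivAt_const s f)
    simpa using h1
  have h := norm_image_sub_le_of_norm_deriv_le_segment' (C := ‖D f‖) (a := 0) (b := t)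
    (fun s _ => (hder s).hasDerivWithinAt) (fun s hs => ?_) t ⟨ht, le_rfl⟩
  · simp only [hcomm] at h
    rw [sub_self, sub_zero, yosidaExp_zero, yosidaExp_zero, one_mul, mul_one] at h
    refine h.trans_eq ?_
    rw [hD, sub_apply, norm_sub_rev]
  · rw [hcomm]
    exact (hQ.norm_yosidaExp_le k (sub_nonneg.2 hs.2.le) _).trans (hQ.norm_yosidaExp_le n hs.1 _)

theorem exists_tendsto_yosidaExp {t : ℝ} (ht : 0 ≤ t) : ∃ T : L2Space m →L[ℝ] L2Space m,
    ∀ f, Tendsto (fun n => Q.yosidaExp n t f) atTop (𝓝 (T f)) := by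
  have hcau : ∀ f, ∃ g, Tendsto (fun n => Q.yosidaExp n t f) atTop (𝓝 g) := by
    intro f
    refine cauchySeq_tendsto_of_complete ?_
    rw [cauchySeq_iff_tendsto_dist_atTop_0]
    have h := tendsto_zero_of_dense (l := atTop)
      (D := fun p : ℕ × ℕ => Q.yosidaExp p.1 t - Q.yosidaExp p.2 t) (C := 2)
      (fun p f => ?_) hQ.dense_operatorDomain ?_ f
    · have h2 := h.norm
      rw [norm_zero] at h2
      refine h2.congr fun p => ?_
      rw [dist_eq_norm, sub_apply]
    · refine (norm_sub_le _ _).trans ?_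
      have h1 := hQ.norm_yosidaExp_le p.1 ht f
      have h2 := hQ.norm_yosidaExp_le p.2 ht f
      change ‖Q.yosidaExp p.1 t f‖ + ‖Q.yosidaExp p.2 t f‖ ≤ 2 * ‖f‖
      linarith
    · rintro f ⟨h, hf⟩
      have hy : CauchySeq fun n => Q.yosida n f := by
        refine Tendsto.cauchySeq (x := h) ((hQ.tendsto_contr h).congr fun n => ?_)
        rw [hQ.yosida_eq_contr n hf]
      rw [cauchySeq_iff_tendsto_dist_atTop_0] at hy
      have hy2 := hy.mul_const t
      rw [zero_mul] at hy2
      refine squeeze_zero_norm (fun p => ?_) hy2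
      rw [dist_eq_norm]
      exact hQ.norm_yosidaExp_sub_le p.1 p.2 ht f
  choose g hg using hcau
  exact ⟨continuousLinearMapOfTendsto (fun n => Q.yosidaExp n t) (tendsto_pi_nhds.2 hg), hg⟩

theorem norm_yosidaExp_sub_self_le (n : ℕ) {t : ℝ} (ht : 0 ≤ t) (f : L2Space m) :
    ‖Q.yosidaExp n t f - f‖ ≤ ‖Q.yosida n f‖ * t := by
  have h := norm_image_sub_le_of_norm_deriv_le_segment' (C := ‖Q.yosida n f‖) (a := 0) (b := t)
    (fun s _ => (Q.hasDerivAt_yosidaExp n s f).hasDerivWithinAt) (fun s hs => ?_) t ⟨ht, le_rfl⟩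
  · simpa [yosidaExp_zero] using h
  · rw [norm_neg]
    exact hQ.norm_yosidaExp_le n hs.1 _

/-- A first order expansion at `t = 0`, with a remainder that is uniform in `n` if `g` is a good
approximation of `L f` in `D(L)`. -/
theorem norm_yosidaExp_sub_add_le (n : ℕ) {t : ℝ} (ht : 0 ≤ t) (f g : L2Space m) :
    ‖Q.yosidaExp n t f - f + t • Q.yosida n f‖ ≤
      (2 * ‖Q.yosida n f - g‖ + t * ‖Q.yosida n g‖) * t := by
  have hder : ∀ s, HasDerivAt (fun s => Q.yosidaExp n s f + s • Q.yosida n f)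
      (-Q.yosidaExp n s (Q.yosida n f) + Q.yosida n f) s := by
    intro s
    have h1 := (Q.hasDerivAt_yosidaExp n s f).fun_add
      ((hasDerivAt_id' s).smul_const (Q.yosida n f))
    rwa [one_smul] at h1
  have h := norm_image_sub_le_of_norm_deriv_le_segment'
    (C := 2 * ‖Q.yosida n f - g‖ + t * ‖Q.yosida n g‖) (a := 0) (b := t)
    (fun s _ => (hder s).hasDerivWithinAt) (fun s hs => ?_) t ⟨ht, le_rfl⟩
  · rw [yosidaExp_zero, zero_smul, sub_zero, add_zero] at h
    rwa [one_apply_eq_self, add_sub_right_comm] at h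
  · have h1 : -Q.yosidaExp n s (Q.yosida n f) + Q.yosida n f =
        (-Q.yosidaExp n s (Q.yosida n f - g) + (Q.yosida n f - g)) -
          (Q.yosidaExp n s g - g) := by
      rw [map_sub]; abel
    have h2 := hQ.norm_yosidaExp_le n hs.1 (Q.yosida n f - g)
    have h3 := hQ.norm_yosidaExp_sub_self_le n hs.1 g
    have h4 := norm_sub_le (-Q.yosidaExp n s (Q.yosida n f - g) + (Q.yosida n f - g))
      (Q.yosidaExp n s g - g)
    have h5 := norm_add_le (-Q.yosidaExp n s (Q.yosida n f - g)) (Q.yosida n f - g)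
    have h6 : ‖Q.yosida n g‖ * s ≤ t * ‖Q.yosida n g‖ := by
      rw [mul_comm]
      exact mul_le_mul_of_nonneg_right hs.2.le (norm_nonneg _)
    rw [norm_neg] at h5
    rw [h1]
    linarith

/-- Existence of the semigroup of a Dirichlet form, as the limit of the semigroups of the Yosida
approximations. -/
theorem exists_isSemigroup : ∃ T : ℝ≥0 → L2Space m →L[ℝ] L2Space m, Q.IsSemigroup T ∧
    ∀ (t : ℝ≥0) f, Tendsto (fun n => Q.yosidaExp n t f) atTop (𝓝 (T t f)) := by
  choose T hT using fun t : ℝ≥0 => hQ.exists_tendsto_yosidaExp t.coe_nonneg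
  have hcontr : ∀ t f, ‖T t f‖ ≤ ‖f‖ := fun t f =>
    le_of_tendsto' (hT t f).norm fun n => hQ.norm_yosidaExp_le n t.2 f
  have hT0 : T 0 = ContinuousLinearMap.id ℝ (L2Space m) := by
    ext1 f
    refine tendsto_nhds_unique (hT 0 f) (tendsto_const_nhds.congr fun n => ?_)
    rw [NNReal.coe_zero, yosidaExp_zero]; rfl
  have hadd : ∀ s t, T (s + t) = (T s).comp (T t) := by
    intro s t
    ext1 f
    refine tendsto_nhds_unique (hT (s + t) f) ?_
    have h1 : Tendsto (fun n => Q.yosidaExp n s (Q.yosidaExp n t f - T t f)) atTop (𝓝 0) := by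
      refine squeeze_zero_norm (fun n => hQ.norm_yosidaExp_le n s.2 _) ?_
      exact tendsto_iff_norm_sub_tendsto_zero.1 (hT t f)
    have h2 := h1.add (hT s (T t f))
    rw [zero_add] at h2
    refine h2.congr fun n => ?_
    rw [← map_add, sub_add_cancel, NNReal.coe_add, yosidaExp_add]; rfl
  have hlip : ∀ {f h}, Q.OperatorGraph f h → ∀ t : ℝ≥0, ‖T t f - f‖ ≤ ‖h‖ * t := by
    intro f h hf t
    refine le_of_tendsto' ((hT t f).sub_const f).norm fun n => ?_
    refine (hQ.norm_yosidaExp_sub_self_le n t.2 f).trans ?_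
    rw [hQ.yosida_eq_contr n hf]
    exact mul_le_mul_of_nonneg_right (hQ.norm_contr_le n h) t.2
  have hcont : ∀ f, Continuous fun t => T t f := by
    have h1 : ∀ {f h}, Q.OperatorGraph f h → Continuous fun t => T t f := by
      intro f h hf
      have key : ∀ s t : ℝ≥0, s ≤ t → dist (T s f) (T t f) ≤ ‖h‖₊ * dist s t := by
        intro s t hst
        obtain ⟨r, rfl⟩ := exists_add_of_le hst
        rw [hadd, dist_comm, dist_eq_norm, ContinuousLinearMap.comp_apply, ← map_sub]
        refine (hcontr s _).trans ((hlip hf r).trans_eq ?_)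
        rw [NNReal.dist_eq]
        simp
      have hL : LipschitzWith ‖h‖₊ fun t => T t f := LipschitzWith.of_dist_le_mul fun s t => by
        rcases le_total s t with hst | hst
        · exact key s t hst
        · rw [dist_comm, dist_comm s]; exact key t s hst
      exact hL.continuous
    intro f
    refine continuous_of_uniform_approx_of_continuous fun U hU => ?_
    obtain ⟨ε, hε, hεU⟩ := Metric.mem_uniformity_dist.1 hU
    obtain ⟨g, hg, ⟨h, hgh⟩⟩ := Metric.dense_iff.1 hQ.dense_operatorDomain f ε hε
    refine ⟨fun t => T t g, h1 hgh, fun t => hεU ?_⟩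
    rw [dist_eq_norm, ← map_sub]
    rw [Metric.mem_ball, dist_comm, dist_eq_norm] at hg
    exact (hcontr t _).trans_lt hg
  have hgen : ∀ {f h}, Q.OperatorGraph f h →
      Tendsto (fun t : ℝ≥0 => (t : ℝ)⁻¹ • (T t f - f)) (𝓝[>] 0) (𝓝 (-h)) := by
    intro f h hf
    have hest : ∀ {g k}, Q.OperatorGraph g k → ∀ t : ℝ≥0,
        ‖T t f - f + (t : ℝ) • h‖ ≤ (2 * ‖h - g‖ + t * ‖k‖) * t := by
      intro g k hg t
      have hy : Tendsto (fun n => Q.yosida n f) atTop (𝓝 h) :=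
        (hQ.tendsto_contr h).congr fun n => (hQ.yosida_eq_contr n hf).symm
      have e1 := (((hT t f).sub_const f).add (hy.const_smul (t : ℝ))).norm
      have e2 := ((((hy.sub_const g).norm).const_mul 2).add_const ((t : ℝ) * ‖k‖)).mul_const (t : ℝ)
      refine le_of_tendsto_of_tendsto' e1 e2 fun n => ?_
      refine (hQ.norm_yosidaExp_sub_add_le n t.2 f g).trans ?_
      rw [hQ.yosida_eq_contr n hg]
      have h5 := mul_le_mul_of_nonneg_left (hQ.norm_contr_le n k) t.2
      exact mul_le_mul_of_nonneg_right (add_le_add le_rfl h5) t.2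
    rw [Metric.tendsto_nhds]
    intro ε hε
    obtain ⟨g, hg, ⟨k, hgk⟩⟩ := Metric.dense_iff.1 hQ.dense_operatorDomain h (ε / 4)
      (by positivity)
    rw [Metric.mem_ball, dist_comm, dist_eq_norm] at hg
    have hsmall : Tendsto (fun t : ℝ≥0 => (t : ℝ) * ‖k‖) (𝓝[>] 0) (𝓝 0) := by
      have h1 : Continuous fun t : ℝ≥0 => (t : ℝ) * ‖k‖ := by fun_prop
      have h2 := h1.tendsto 0
      rw [NNReal.coe_zero, zero_mul] at h2
      exact h2.mono_left nhdsWithin_le_nhds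
    filter_upwards [hsmall.eventually (gt_mem_nhds (half_pos hε)), self_mem_nhdsWithin] with t h1 h2
    have ht : (0 : ℝ) < t := by exact_mod_cast h2
    have h3 := hest hgk t
    have h4 : (t : ℝ)⁻¹ • (T t f - f) - -h = (t : ℝ)⁻¹ • (T t f - f + (t : ℝ) • h) := by
      rw [smul_add, smul_smul, inv_mul_cancel₀ ht.ne', one_smul, sub_neg_eq_add]
    rw [dist_eq_norm, h4, norm_smul, norm_inv, Real.norm_of_nonneg ht.le, inv_mul_eq_div]
    refine ((div_le_iff₀ ht).2 h3).trans_lt ?_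
    linarith
  refine ⟨T, ⟨hT0, hadd, hcont, fun f h => ⟨hgen, fun hf => ?_⟩⟩, hT⟩
  -- The operator `L` cannot be extended properly to a generator: `L + 1` is surjective, and
  -- generators `-L'` of contraction semigroups have an injective `L' + 1`.
  have hg := hQ.operatorGraph_resolvent one_pos (f + h)
  rw [one_smul] at hg
  set g := Q.resolvent 1 (f + h) with hgdef
  have h1 := hf.sub (hgen hg)
  have h2 : Tendsto (fun t : ℝ≥0 => inner ℝ ((t : ℝ)⁻¹ • (T t f - f) - (t : ℝ)⁻¹ • (T t g - g))
      (f - g)) (𝓝[>] 0) (𝓝 (inner ℝ (-h - -(f + h - g)) (f - g))) :=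
    h1.inner tendsto_const_nhds
  have h3 : inner ℝ (-h - -(f + h - g)) (f - g) = ‖f - g‖ ^ 2 := by
    rw [← real_inner_self_eq_norm_sq]
    congr 1
    abel
  rw [h3] at h2
  have hne : (𝓝[>] (0 : ℝ≥0)).NeBot := inferInstance
  have h4 : ‖f - g‖ ^ 2 ≤ 0 := by
    refine le_of_tendsto' h2 fun t => ?_
    have e1 : (t : ℝ)⁻¹ • (T t f - f) - (t : ℝ)⁻¹ • (T t g - g) =
        (t : ℝ)⁻¹ • (T t (f - g) - (f - g)) := by
      rw [← smul_sub, map_sub]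
      congr 1
      abel
    rw [e1, inner_smul_left, inner_sub_left, real_inner_self_eq_norm_sq]
    refine mul_nonpos_of_nonneg_of_nonpos (by simp) ?_
    have e2 := real_inner_le_norm (T t (f - g)) (f - g)
    have e3 := mul_le_mul_of_nonneg_right (hcontr t (f - g)) (norm_nonneg (f - g))
    nlinarith
  have h5 : f - g = 0 := norm_eq_zero.1 (by nlinarith [norm_nonneg (f - g)])
  rw [← sub_eq_zero.1 h5] at hg
  simpa using hg

end IsDirichlet

end L2Form

/-! ### Domination of semigroups, resolvents and forms -/

namespace L2Form

open L2Space

variable {X : Type*} [MeasurableSpace X] {m : Measure X}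

/-- Domination of the resolvents on nonnegative functions. -/
def ResolventDominates (Q' Q : L2Form m) : Prop :=
  ∀ a > 0, ∀ f : L2Space m, 0 ≤ f → Q.resolvent a f ≤ Q'.resolvent a f

/-- The resolvents of Dirichlet forms dominate each other if the semigroups constructed from their
Yosida approximations do. -/
theorem ResolventDominates.dominates {Q Q' : L2Form m} (hQ : Q.IsDirichlet)
    (hQ' : Q'.IsDirichlet) (h : Q'.ResolventDominates Q) : Q'.Dominates Q := by
  obtain ⟨T, hT, hTlim⟩ := hQ.exists_isSemigroup
  obtain ⟨T', hT', hTlim'⟩ := hQ'.exists_isSemigroup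
  refine ⟨T, T', hT, hT', fun t f hf => ?_⟩
  refine le_of_tendsto_of_tendsto' (hTlim t f) (hTlim' t f) fun n => ?_
  have hn : (0 : ℝ) < (n : ℝ) + 1 := by positivity
  have hpos : ∀ g : L2Space m, 0 ≤ g → 0 ≤ Q'.contr n g := fun g hg =>
    smul_nonneg hn.le (hQ'.resolvent_nonneg hn hg)
  have hposQ : ∀ g : L2Space m, 0 ≤ g → 0 ≤ Q.contr n g := fun g hg =>
    smul_nonneg hn.le (hQ.resolvent_nonneg hn hg)
  have hdom : ∀ g : L2Space m, 0 ≤ g → Q.contr n g ≤ Q'.contr n g := by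
    intro g hg
    have h1 := smul_nonneg hn.le (sub_nonneg.2 (h _ hn g hg))
    rw [smul_sub] at h1
    exact sub_nonneg.1 h1
  have hpow : ∀ k : ℕ, 0 ≤ (Q.contr n ^ k) f ∧ (Q.contr n ^ k) f ≤ (Q'.contr n ^ k) f := by
    intro k
    induction k with
    | zero => simpa using hf
    | succ k ih =>
      rw [pow_succ', pow_succ']
      refine ⟨hposQ _ ih.1, (hdom _ ih.1).trans ?_⟩
      have h1 := hpos _ (sub_nonneg.2 ih.2)
      rw [map_sub] at h1
      exact sub_nonneg.1 h1
  have hexp : NormedSpace.exp (((t : ℝ) * ((n : ℝ) + 1)) • Q.contr n) f ≤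
      NormedSpace.exp (((t : ℝ) * ((n : ℝ) + 1)) • Q'.contr n) f := by
    refine hasSum_le (fun k => ?_) (hasSum_exp_smul_apply _ _ f) (hasSum_exp_smul_apply _ _ f)
    have h1 := smul_nonneg (c := ((k.factorial : ℝ)⁻¹ * ((t : ℝ) * ((n : ℝ) + 1)) ^ k))
      (by positivity) (sub_nonneg.2 (hpow k).2)
    rw [smul_sub] at h1
    exact sub_nonneg.1 h1
  rw [yosidaExp_eq, yosidaExp_eq]
  have h1 := smul_nonneg (Real.exp_nonneg (-((t : ℝ) * ((n : ℝ) + 1)))) (sub_nonneg.2 hexp)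
  rw [smul_sub] at h1
  exact sub_nonneg.1 h1

section Semigroup

variable {Q : L2Form m} {T : ℝ≥0 → L2Space m →L[ℝ] L2Space m} (hT : Q.IsSemigroup T)
include hT

theorem IsSemigroup.operatorGraph_apply (t : ℝ≥0) {f h : L2Space m} (hf : Q.OperatorGraph f h) :
    Q.OperatorGraph (T t f) (T t h) := by
  rw [hT.generator] at hf ⊢
  have h1 := ((T t).continuous.tendsto _).comp hf
  rw [map_neg] at h1
  refine h1.congr fun s => ?_
  rw [Function.comp_apply, map_smul, map_sub, ← ContinuousLinearMap.comp_apply, ← hT.add,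
    add_comm, hT.add]
  rfl

theorem IsSemigroup.continuous_toNNReal (f : L2Space m) :
    Continuous fun s : ℝ => T s.toNNReal f :=
  (hT.continuous f).comp continuous_real_toNNReal

/-- Orbits starting in the domain of the generator are differentiable from the right. -/
theorem IsSemigroup.hasDerivWithinAt {f h : L2Space m} (hf : Q.OperatorGraph f h) {t : ℝ}
    (ht : 0 ≤ t) :
    HasDerivWithinAt (fun s : ℝ => T s.toNNReal f) (-T t.toNNReal h) (Set.Ici t) t := by
  rw [← hasDerivWithinAt_Ioi_iff_Ici, hasDerivWithinAt_iff_tendsto_slope' (by simp)]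
  have h1 := (hT.generator f h).1 hf
  have h2 : Tendsto (fun s : ℝ => (s - t).toNNReal) (𝓝[>] t) (𝓝[>] 0) := by
    refine tendsto_nhdsWithin_iff.2 ⟨?_, ?_⟩
    · have h3 : Continuous fun s : ℝ => (s - t).toNNReal := by fun_prop
      have h4 := h3.tendsto t
      rw [sub_self, Real.toNNReal_zero] at h4
      exact h4.mono_left nhdsWithin_le_nhds
    · filter_upwards [self_mem_nhdsWithin] with s hs
      exact Real.toNNReal_pos.2 (sub_pos.2 hs)
  have h5 := ((T t.toNNReal).continuous.tendsto _).comp (h1.comp h2)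
  rw [map_neg] at h5
  refine h5.congr' ?_
  filter_upwards [self_mem_nhdsWithin] with s hs
  have hs' : 0 ≤ s - t := (sub_pos.2 hs).le
  have e : s.toNNReal = t.toNNReal + (s - t).toNNReal := by
    rw [← Real.toNNReal_add ht hs', add_sub_cancel]
  rw [Function.comp_apply, Function.comp_apply, map_smul, map_sub, slope_def_module,
    Real.coe_toNNReal _ hs', e, hT.add]
  rfl

theorem IsSemigroup.norm_apply_le (hQ : Q.IsDirichlet) (t : ℝ≥0) (f : L2Space m) :
    ‖T t f‖ ≤ ‖f‖ := by
  have hcl : IsClosed {f : L2Space m | ‖T t f‖ ≤ ‖f‖} :=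
    isClosed_le (by fun_prop) (by fun_prop)
  have hsub : {f : L2Space m | ∃ h, Q.OperatorGraph f h} ⊆ {f : L2Space m | ‖T t f‖ ≤ ‖f‖} := by
    rintro f ⟨h, hf⟩
    have hder : ∀ s ∈ Set.Ico (0 : ℝ) t, HasDerivWithinAt
        (fun s : ℝ => inner ℝ (T s.toNNReal f) (T s.toNNReal f))
        (inner ℝ (T s.toNNReal f) (-T s.toNNReal h) + inner ℝ (-T s.toNNReal h) (T s.toNNReal f))
        (Set.Ici s) s := fun s hs =>
      (hT.hasDerivWithinAt hf hs.1).inner ℝ (hT.hasDerivWithinAt hf hs.1)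
    have hc := hT.continuous_toNNReal f
    have hmain := image_le_of_deriv_right_le_deriv_boundary (hc.inner hc).continuousOn hder
      (B := fun _ => ‖f‖ ^ 2) (B' := fun _ => 0) (by
        rw [Real.toNNReal_zero, hT.zero]
        exact (real_inner_self_eq_norm_sq f).le)
      continuousOn_const (fun s _ => hasDerivWithinAt_const _ _ _) (fun s _ => by
        have h1 := hT.operatorGraph_apply s.toNNReal hf
        have h2 := h1.2 _ h1.1
        have h3 := hQ.nonneg _ h1.1
        rw [hQ.isQuadratic.bilin_self h1.1] at h2
        rw [inner_neg_right, inner_neg_left, real_inner_comm]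
        linarith) (x := (t : ℝ)) ⟨t.coe_nonneg, le_rfl⟩
    rw [Real.toNNReal_coe, real_inner_self_eq_norm_sq] at hmain
    exact le_of_sq_le_sq hmain (norm_nonneg f)
  exact closure_minimal hsub hcl (hQ.dense_operatorDomain f)

end Semigroup

/-- Domination of semigroups implies domination of resolvents. For `u = (L + a)⁻¹ f` the function
`e^{-at} T_t u` has the right derivative `-e^{-at} T_t f`. Hence the pairing of
`e^{-at} (T'_t u' - T_t u)` with a nonnegative function decreases in `t`, and it tends to `0`
as `t → ∞`. -/
theorem Dominates.resolventDominates {Q Q' : L2Form m} (hQ : Q.IsDirichlet)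
    (hQ' : Q'.IsDirichlet) (h : Q'.Dominates Q) : Q'.ResolventDominates Q := by
  obtain ⟨T, T', hT, hT', hdom⟩ := h
  intro a ha f hf
  rw [← sub_nonneg]
  refine nonneg_of_inner_nonneg fun g hg => ?_
  set u := Q.resolvent a f with hu
  set u' := Q'.resolvent a f with hu'
  have hgu : Q.OperatorGraph u (f - a • u) := hQ.operatorGraph_resolvent ha f
  have hgu' : Q'.OperatorGraph u' (f - a • u') := hQ'.operatorGraph_resolvent ha f
  set p : ℝ → ℝ := fun t => Real.exp (-(a * t)) *
    inner ℝ (T' t.toNNReal u' - T t.toNNReal u) g with hp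
  have hexp : ∀ t : ℝ, HasDerivAt (fun t : ℝ => Real.exp (-(a * t)))
      (Real.exp (-(a * t)) * -a) t := fun t => by
    have h1 := ((hasDerivAt_id' t).const_mul a).fun_neg
    rw [mul_one] at h1
    exact h1.exp
  have hder : ∀ t : ℝ, 0 ≤ t → HasDerivWithinAt p
      (-(Real.exp (-(a * t)) * inner ℝ (T' t.toNNReal f - T t.toNNReal f) g)) (Set.Ici t) t := by
    intro t ht
    have h1 := ((hT'.hasDerivWithinAt hgu' ht).fun_sub (hT.hasDerivWithinAt hgu ht)).inner ℝ
      (hasDerivWithinAt_const t (Set.Ici t) g)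
    have h2 := (hexp t).hasDerivWithinAt.fun_mul h1
    refine h2.congr_deriv ?_
    simp only [inner_zero_right, zero_add, map_sub, map_smul, inner_sub_left, inner_neg_left,
      inner_smul_left, conj_trivial]
    ring
  have hcont : Continuous p := by
    have h1 : Continuous fun t : ℝ => Real.exp (-(a * t)) := by fun_prop
    exact h1.mul (((hT'.continuous_toNNReal u').sub (hT.continuous_toNNReal u)).inner
      continuous_const)
  have hle : ∀ t : ℝ, 0 ≤ t → p t ≤ p 0 := by
    intro t ht
    refine image_le_of_deriv_right_le_deriv_boundary (f := p) hcont.continuousOn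
      (fun s hs => hder s hs.1) (B := fun _ => p 0) (B' := fun _ => 0) le_rfl continuousOn_const
      (fun s _ => hasDerivWithinAt_const _ _ _) (fun s _ => ?_) (x := t) ⟨ht, le_rfl⟩
    have h1 := inner_nonneg (sub_nonneg.2 (hdom s.toNNReal f hf)) hg
    have h2 := mul_nonneg (Real.exp_nonneg (-(a * s))) h1
    linarith
  have hlim : Tendsto p atTop (𝓝 0) := by
    have h1 : Tendsto (fun t : ℝ => Real.exp (-(a * t)) * ((‖u'‖ + ‖u‖) * ‖g‖)) atTop (𝓝 0) := by
      have h2 : Tendsto (fun t : ℝ => Real.exp (-(a * t))) atTop (𝓝 0) :=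
        Real.tendsto_exp_neg_atTop_nhds_zero.comp (tendsto_id.const_mul_atTop ha)
      simpa using h2.mul_const ((‖u'‖ + ‖u‖) * ‖g‖)
    refine squeeze_zero_norm (fun t => ?_) h1
    rw [hp, norm_mul, Real.norm_of_nonneg (Real.exp_nonneg _)]
    refine mul_le_mul_of_nonneg_left ?_ (Real.exp_nonneg _)
    refine (norm_inner_le_norm _ _).trans (mul_le_mul_of_nonneg_right ?_ (norm_nonneg g))
    exact (norm_sub_le _ _).trans
      (add_le_add (hT'.norm_apply_le hQ' _ _) (hT.norm_apply_le hQ _ _))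
  have h0 : 0 ≤ p 0 := le_of_tendsto hlim (by
    filter_upwards [eventually_ge_atTop 0] with t ht using hle t ht)
  rw [hp] at h0
  simpa [hT.zero, hT'.zero] using h0

variable [SigmaFinite m]

theorem IsDirichlet.negPart_mem {Q : L2Form m} (hQ : Q.IsDirichlet) {f : L2Space m}
    (hf : f ∈ Q.domain) : (-f ⊔ 0 : L2Space m) ∈ Q.domain :=
  (hQ.posPart_mem (hQ.isQuadratic.neg_mem hf)).1

omit [SigmaFinite m] in
theorem posPart_sub_negPart (f : L2Space m) : (f ⊔ 0) - (-f ⊔ 0) = f := by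
  refine Lp.ext ?_
  filter_upwards [Lp.coeFn_sub (f ⊔ 0) (-f ⊔ 0), coeFn_posPart' f, coeFn_posPart' (-f),
    Lp.coeFn_neg f] with x h1 h2 h3 h4
  rw [h1, Pi.sub_apply, h2, h3, h4, Pi.neg_apply]
  rcases le_total (f x) 0 with h | h
  · rw [max_eq_right h, max_eq_left (by linarith)]; ring
  · rw [max_eq_left h, max_eq_right (by linarith)]; ring

omit [SigmaFinite m] in
theorem posPart_mul_negPart (f : L2Space m) :
    ∀ᵐ x ∂m, (f ⊔ 0 : L2Space m) x * (-f ⊔ 0 : L2Space m) x = 0 := by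
  filter_upwards [coeFn_posPart' f, coeFn_posPart' (-f), Lp.coeFn_neg f] with x h2 h3 h4
  rw [h2, h3, h4, Pi.neg_apply]
  rcases le_total (f x) 0 with h | h
  · rw [max_eq_right h, zero_mul]
  · rw [max_eq_right (a := -(f x)) (by linarith), mul_zero]

omit [SigmaFinite m] in
theorem posPart_le_abs (f : L2Space m) : (f ⊔ 0 : L2Space m) ≤ |f| := by
  rw [le_iff]
  filter_upwards [coeFn_posPart' f, Lp.coeFn_abs f] with x h1 h2
  rw [h1, h2]
  exact max_le (le_abs_self _) (abs_nonneg _)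

/-- Domination of forms, in terms of the resolvents: if `Q` lives on an order ideal in `D(Q')` and
`Q' ≤ Q` on nonnegative functions, the resolvent of `Q'` dominates the one of `Q`. -/
theorem resolventDominates_of_ideal {Q Q' : L2Form m} (hQ : Q.IsDirichlet)
    (hQ' : Q'.IsDirichlet) (hsub : Q.domain ⊆ Q'.domain)
    (hideal : IsOrderIdealIn Q.domain Q'.domain)
    (hle : ∀ f ∈ Q.domain, ∀ g ∈ Q.domain, 0 ≤ f → 0 ≤ g → Q'.bilin f g ≤ Q.bilin f g) :
    Q'.ResolventDominates Q := by
  intro a ha f hf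
  have hq' := hQ'.isQuadratic
  set u := Q.resolvent a f with hu
  set u' := Q'.resolvent a f with hu'
  have hud : u ∈ Q.domain := hQ.resolvent_mem ha f
  have hud' : u' ∈ Q'.domain := hQ'.resolvent_mem ha f
  have hu0 : 0 ≤ u := hQ.resolvent_nonneg ha hf
  have hu0' : 0 ≤ u' := hQ'.resolvent_nonneg ha hf
  -- `w = u - u'` is tested with its positive part `v`, which satisfies `0 ≤ v ≤ u`.
  set w := u - u' with hw
  have hwd : w ∈ Q'.domain := hq'.sub_mem (hsub hud) hud'
  set v : L2Space m := w ⊔ 0 with hv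
  have hvd' : v ∈ Q'.domain := (hQ'.posPart_mem hwd).1
  have hv0 : 0 ≤ v := le_sup_right
  have hvu : v ≤ u := sup_le (sub_le_self _ hu0') hu0
  have hvd : v ∈ Q.domain := by
    refine hideal u hud v hvd' ?_
    rwa [abs_of_nonneg hv0, abs_of_nonneg hu0]
  have hnd : (-w ⊔ 0 : L2Space m) ∈ Q'.domain := hQ'.negPart_mem hwd
  have h1 := hQ.bilin_resolvent ha f hvd
  have h2 := hQ'.bilin_resolvent ha f hvd'
  have h3 := hle u hud v hvd hu0 hv0
  have hwv := posPart_sub_negPart w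
  have h4 : Q'.val v ≤ Q'.bilin w v := by
    have h5 := hQ'.bilin_nonpos hvd' hnd hv0 le_sup_right (posPart_mul_negPart w)
    have h6 := hq'.bilin_sub_left hvd' hnd hvd'
    rw [hwv, hq'.bilin_self hvd', hq'.bilin_comm hnd hvd'] at h6
    linarith
  have h5 : ‖v‖ ^ 2 = inner ℝ w v := by
    have h6 : inner ℝ (-w ⊔ 0 : L2Space m) v = 0 := by
      rw [inner_eq]
      refine integral_eq_zero_of_ae ?_
      filter_upwards [posPart_mul_negPart w] with x hx
      rw [mul_comm]; exact hx
    have h7 := congrArg (fun z => inner ℝ z v) hwv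
    rw [inner_sub_left, h6, real_inner_self_eq_norm_sq, sub_zero] at h7
    exact h7
  have h6 : Q'.bilin w v = Q'.bilin u v - Q'.bilin u' v := hq'.bilin_sub_left (hsub hud) hud' hvd'
  have h7 : inner ℝ w v = inner ℝ u v - inner ℝ u' v := inner_sub_left _ _ _
  have h8 := hQ'.nonneg _ hvd'
  have h9 : a * ‖v‖ ^ 2 ≤ 0 := by
    rw [h5, h7]
    linarith
  have h10 : ‖v‖ ^ 2 ≤ 0 := by
    by_contra hcon
    push Not at hcon
    linarith [mul_pos ha hcon]
  have h11 : v = 0 := norm_eq_zero.1 (by nlinarith [norm_nonneg v])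
  have h12 : w ≤ 0 := by rw [← h11]; exact le_sup_left
  exact sub_nonpos.1 h12

section Ouhabaz

variable {Q Q' : L2Form m} (hQ : Q.IsDirichlet) (hQ' : Q'.IsDirichlet)
  (h : Q'.ResolventDominates Q)
include hQ hQ' h

omit hQ hQ' [SigmaFinite m] in
theorem ResolventDominates.approx_le {a : ℝ} (ha : 0 < a) {f g : L2Space m} (hf : 0 ≤ f)
    (hg : 0 ≤ g) : Q'.approx a f g ≤ Q.approx a f g := by
  have h1 := inner_nonneg (sub_nonneg.2 (h a ha f hf)) hg
  rw [inner_sub_left] at h1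
  refine mul_le_mul_of_nonneg_left ?_ ha.le
  linarith [mul_nonneg ha.le h1]

theorem ResolventDominates.domain_subset : Q.domain ⊆ Q'.domain := by
  have hpos : ∀ f ∈ Q.domain, 0 ≤ f → f ∈ Q'.domain := fun f hf hf0 =>
    (hQ'.mem_domain_of_approx_le (c := Q.val f) fun n =>
      (h.approx_le (by positivity) hf0 hf0).trans (hQ.approx_self_le (by positivity) hf)).1
  intro f hf
  rw [← posPart_sub_negPart f]
  exact hQ'.isQuadratic.sub_mem (hpos _ (hQ.posPart_mem hf).1 le_sup_right)
    (hpos _ (hQ.negPart_mem hf) le_sup_right)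

theorem ResolventDominates.bilin_le {f g : L2Space m} (hf : f ∈ Q.domain) (hg : g ∈ Q.domain)
    (hf0 : 0 ≤ f) (hg0 : 0 ≤ g) : Q'.bilin f g ≤ Q.bilin f g := by
  have hsub := h.domain_subset hQ hQ'
  exact le_of_tendsto_of_tendsto' (hQ'.tendsto_approx (hsub hf) (hsub hg))
    (hQ.tendsto_approx hf hg) fun n => h.approx_le (by positivity) hf0 hg0

/-- The domain of the dominated form is an order ideal. For `0 ≤ g ≤ f` the difference
`a ⟨g - a G_a g, g⟩ - a ⟨g - a G'_a g, g⟩` is monotone in `g`. -/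
theorem ResolventDominates.isOrderIdealIn : IsOrderIdealIn Q.domain Q'.domain := by
  have hsub := h.domain_subset hQ hQ'
  have hpos : ∀ f ∈ Q.domain, ∀ g ∈ Q'.domain, 0 ≤ g → g ≤ f → g ∈ Q.domain := by
    intro f hf g hg hg0 hgf
    have hf0 := hg0.trans hgf
    refine (hQ.mem_domain_of_approx_le (c := Q'.val g + Q.val f) fun n => ?_).1
    have ha : (0 : ℝ) < (n : ℝ) + 1 := by positivity
    set a := (n : ℝ) + 1
    have h1 := hQ'.approx_self_le ha hg
    have h2 := hQ.approx_self_le ha hf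
    have hf3 : 0 ≤ Q'.approx a f f := by
      rw [hQ'.approx_self_eq ha]
      have e1 := hQ'.nonneg _ (hQ'.isQuadratic.smul_mem a (hQ'.resolvent_mem ha f))
      positivity
    have h4 : inner ℝ (Q'.resolvent a g - Q.resolvent a g) g ≤
        inner ℝ (Q'.resolvent a f - Q.resolvent a f) f := by
      have e1 := inner_nonneg (sub_nonneg.2 (h a ha g hg0)) (sub_nonneg.2 hgf)
      have e2 := inner_nonneg (sub_nonneg.2 (h a ha _ (sub_nonneg.2 hgf))) hf0
      simp only [map_sub, inner_sub_left, inner_sub_right] at e1 e2 ⊢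
      linarith
    have h5 := mul_le_mul_of_nonneg_left h4 (mul_pos ha ha).le
    simp only [inner_sub_left] at h5
    simp only [approx] at h1 h2 hf3 ⊢
    linarith
  intro f hf g hg hgf
  have hfa := (hQ.abs_mem hf).1
  rw [← posPart_sub_negPart g]
  refine hQ.isQuadratic.sub_mem (hpos _ hfa _ (hQ'.posPart_mem hg).1 le_sup_right
    ((posPart_le_abs g).trans hgf)) (hpos _ hfa _ (hQ'.negPart_mem hg) le_sup_right ?_)
  refine (posPart_le_abs (-g)).trans ?_
  rwa [abs_neg]

end Ouhabaz

end L2Form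

/-! ### The difference of two forms -/

namespace L2Form

variable {X : Type*} [MeasurableSpace X] {m : Measure X}

theorem diff_bilin (Q Q' : L2Form m) (f g : L2Space m) :
    (Q.diff Q').bilin f g = Q.bilin f g - Q'.bilin f g := by
  simp only [bilin, diff]; ring

theorem diff_isQuadratic {Q Q' : L2Form m} (hQ : Q.IsQuadratic) (hQ' : Q'.IsQuadratic)
    (hsub : Q.domain ⊆ Q'.domain) : (Q.diff Q').IsQuadratic := by
  refine isQuadratic_of hQ.zero_mem (fun f hf g hg => hQ.add_mem hf hg)
    (fun c f hf => hQ.smul_mem c hf) (fun c f hf => ?_) (fun f hf g hg h hh => ?_)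
    (fun c f hf g hg => ?_)
  · simp only [diff]
    rw [hQ.val_smul c hf, hQ'.val_smul c (hsub hf)]; ring
  · have h1 := hQ.val_add_three hf hg hh
    have h2 := hQ'.val_add_three (hsub hf) (hsub hg) (hsub hh)
    simp only [diff]
    linarith
  · have h1 := hQ.val_smul_add c hf hg
    have h2 := hQ'.val_smul_add c (hsub hf) (hsub hg)
    simp only [diff]
    rw [h1, h2]; ring

theorem IsExtension.bilin_eq {Q Q' : L2Form m} (hQ : Q.IsQuadratic) (h : Q'.IsExtension Q)
    {f g : L2Space m} (hf : f ∈ Q.domain) (hg : g ∈ Q.domain) : Q'.bilin f g = Q.bilin f g := by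
  rw [bilin, bilin, h.2 _ (hQ.add_mem hf hg), h.2 _ (hQ.sub_mem hf hg)]

/-- A form is determined by its bilinear form on the nonnegative functions. -/
theorem val_eq_of_bilin_eq [SigmaFinite m] {Q Q' : L2Form m} (hQ : Q.IsDirichlet)
    (hQ' : Q'.IsQuadratic) (hsub : Q.domain ⊆ Q'.domain)
    (h : ∀ f ∈ Q.domain, ∀ g ∈ Q.domain, 0 ≤ f → 0 ≤ g → Q'.bilin f g = Q.bilin f g)
    {f : L2Space m} (hf : f ∈ Q.domain) : Q'.val f = Q.val f := by
  have hp := (hQ.posPart_mem hf).1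
  have hn := hQ.negPart_mem hf
  have h0 : (0 : L2Space m) ≤ f ⊔ 0 := le_sup_right
  have h0' : (0 : L2Space m) ≤ -f ⊔ 0 := le_sup_right
  rw [← posPart_sub_negPart f, hQ.isQuadratic.val_sub hp hn,
    hQ'.val_sub (hsub hp) (hsub hn), ← hQ.isQuadratic.bilin_self hp,
    ← hQ.isQuadratic.bilin_self hn, ← hQ'.bilin_self (hsub hp), ← hQ'.bilin_self (hsub hn),
    h _ hp _ hp h0 h0, h _ hp _ hn h0 h0', h _ hn _ hn h0' h0']

/-! ### Locality of the perturbation -/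

section Local

variable [SigmaFinite m] {Q Q' : L2Form m}

/-- For bounded disjoint `f, g ≥ 0` the off-diagonal part of `Q'` is at most the one of the main
part: cutting off by `φ` only increases `Q'(f, g) ≤ 0`, and `Q'(φ f, φ g) = Q(φ f, φ g)` is the
value of the polarized form `Q_φ` at `(f, g)`, as `φ f g = 0`. -/
theorem bilin_le_mainPart_of_disjoint (hQ : Q.IsDirichlet) (hQ' : Q'.IsDirichlet)
    (hext : Q'.IsExtension Q) (hsub : Q'.domain ⊆ Q.mainPart.domain) {f g : L2Space m}
    (hf : f ∈ Q'.domain) (hg : g ∈ Q'.domain) (hf0 : 0 ≤ f) (hg0 : 0 ≤ g) {k l : ℝ≥0}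
    (hfk : ∀ᵐ x ∂m, |f x| ≤ k) (hgl : ∀ᵐ x ∂m, |g x| ≤ l) (hfg : ∀ᵐ x ∂m, f x * g x = 0) :
    Q'.bilin f g ≤ Q.mainPart.bilin f g := by
  have hM := mainPart_isDirichlet hQ
  have hneBot := atTop_cutoffs_neBot hQ
  have hlim := ((tendsto_cut_mainPart hQ (hM.isQuadratic.add_mem (hsub hf) (hsub hg))).sub
    (tendsto_cut_mainPart hQ (hM.isQuadratic.sub_mem (hsub hf) (hsub hg)))).div_const 4
  refine ge_of_tendsto' hlim fun ⟨φ, hφ⟩ => ?_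
  have hfφ := mem_preCut_of_mem_cut hQ hφ ((hsub hf).1 φ hφ) hfk
  have hgφ := mem_preCut_of_mem_cut hQ hφ ((hsub hg).1 φ hφ) hgl
  have hq := preCut_isQuadratic hQ hφ
  show Q'.bilin f g ≤ ((Q.cut φ).val (f + g) - (Q.cut φ).val (f - g)) / 4
  rw [(mem_cut_of_mem_preCut hQ hφ (hq.add_mem hfφ hgφ)).2,
    (mem_cut_of_mem_preCut hQ hφ (hq.sub_mem hfφ hgφ)).2]
  change _ ≤ (Q.preCut φ).bilin f g
  obtain ⟨-, -, h1⟩ := preCut_val_add hQ hφ hfφ hgφ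
  rw [hq.val_add hfφ hgφ] at h1
  have h2 : (φ.mulFun fun x => f x * g x) = 0 := by
    refine L2Space.ofFun_eq ?_
    filter_upwards [hfg, Lp.coeFn_zero ℝ 2 m] with x hx h0
    rw [hx, mul_zero]; exact h0
  have h3 : Q.bilin 0 φ = 0 := by
    have := hQ.isQuadratic.bilin_smul_left 0 hφ.1 hφ.1
    simpa using this
  rw [h2, h3] at h1
  have h4 := hext.bilin_eq hQ.isQuadratic hfφ.2.1 hgφ.2.1
  have h5 := hQ'.sum_bilin_nonneg ![1, -1]
    (u := ![L2Space.mulFun φ f, f]) (v := ![L2Space.mulFun φ g, g])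
    (by intro i; fin_cases i; exacts [hext.1 hfφ.2.1, hf])
    (by intro i; fin_cases i; exacts [hext.1 hgφ.2.1, hg])
    (U := ![fun x => φ x * f x, fun x => f x]) (V := ![fun x => φ x * g x, fun x => g x])
    (by
      intro i; fin_cases i
      exacts [L2Space.coeFn_mulFun φ hfφ.1, Eventually.of_forall fun x => rfl])
    (by
      intro i; fin_cases i
      exacts [L2Space.coeFn_mulFun φ hgφ.1, Eventually.of_forall fun x => rfl])
    (p := fun x => f x * g x = 0 ∧ 0 ≤ f x ∧ 0 ≤ g x ∧ 0 ≤ φ x ∧ φ x ≤ 1)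
    (by
      filter_upwards [hfg, L2Space.nonneg_iff.1 hf0, L2Space.nonneg_iff.1 hg0,
        L2Space.nonneg_iff.1 hφ.2.1, hφ.2.2] with x h1 h2 h3 h4 h5
      exact ⟨h1, h2, h3, h4, h5⟩)
    (by
      rintro x ⟨hx, -⟩
      simp only [Fin.sum_univ_two, Matrix.cons_val]
      refine le_of_eq ?_
      linear_combination (1 - φ x ^ 2) * hx)
    (by
      rintro x y ⟨hx, hfx, hgx, hφx, hφx1⟩ ⟨hy, hfy, hgy, hφy, hφy1⟩
      simp only [Fin.sum_univ_two, Matrix.cons_val]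
      have e1 : 0 ≤ (1 - φ x * φ y) * (f x * g y + f y * g x) :=
        mul_nonneg (sub_nonneg.2 (mul_le_one₀ hφx1 hφy hφy1)) (by positivity)
      linear_combination e1 + (1 - φ x ^ 2) * hx + (1 - φ y ^ 2) * hy)
  simp only [Fin.sum_univ_two, Matrix.cons_val] at h5
  change Q'.bilin (L2Space.mulFun φ f) (L2Space.mulFun φ g) = _ at h4
  linarith

/-- The difference of two Dirichlet forms is local if it is on bounded nonnegative functions. -/
theorem diff_isLocal_of_bounded {M : L2Form m} (hQ' : Q'.IsDirichlet) (hM : M.IsDirichlet)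
    (hsub : Q'.domain ⊆ M.domain)
    (h : ∀ f ∈ Q'.domain, ∀ g ∈ Q'.domain, 0 ≤ f → 0 ≤ g → ∀ k l : ℝ≥0,
      (∀ᵐ x ∂m, |f x| ≤ k) → (∀ᵐ x ∂m, |g x| ≤ l) → (∀ᵐ x ∂m, f x * g x = 0) →
      Q'.bilin f g = M.bilin f g) :
    (Q'.diff M).IsLocal := by
  have hq := hQ'.isQuadratic
  have hqM := hM.isQuadratic
  have htr0 : ∀ (k : ℝ≥0) {f : L2Space m}, 0 ≤ f → 0 ≤ L2Space.trunc k f := by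
    intro k f hf
    rw [L2Space.nonneg_iff] at hf ⊢
    filter_upwards [hf, L2Space.coeFn_trunc k f] with x h1 h2
    rw [h2]
    exact le_max_of_le_right (le_min h1 k.coe_nonneg)
  have hlim : ∀ {N : L2Form m}, N.IsDirichlet → ∀ {f g : L2Space m}, f ∈ N.domain → g ∈ N.domain →
      Tendsto (fun n : ℕ => N.bilin (L2Space.trunc n f) g) atTop (𝓝 (N.bilin f g)) :=
    fun hN f g hf hg => hN.tendsto_bilin_of_bounded (fun n => (hN.trunc_mem n hf).1)
      (fun n => (hN.trunc_mem n hf).2) (L2Space.tendsto_trunc f) hg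
  -- The bounds are removed one function at a time.
  have hdisj : ∀ (k : ℝ≥0) {f g : L2Space m}, (∀ᵐ x ∂m, f x * g x = 0) →
      ∀ᵐ x ∂m, L2Space.trunc k f x * g x = 0 := by
    intro k f g hfg
    filter_upwards [hfg, L2Space.coeFn_trunc k f] with x h1 h2
    rcases mul_eq_zero.1 h1 with h3 | h3
    · rw [h2, h3]; simp [L2Space.cap]
    · rw [h3, mul_zero]
  have h1 : ∀ f ∈ Q'.domain, ∀ g ∈ Q'.domain, 0 ≤ f → 0 ≤ g → ∀ l : ℝ≥0,
      (∀ᵐ x ∂m, |g x| ≤ l) → (∀ᵐ x ∂m, f x * g x = 0) → Q'.bilin f g = M.bilin f g := by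
    intro f hf g hg hf0 hg0 l hl hfg
    refine tendsto_nhds_unique (hlim hQ' hf hg) ((hlim hM (hsub hf) (hsub hg)).congr fun n => ?_)
    exact (h _ (hQ'.trunc_mem n hf).1 g hg (htr0 n hf0) hg0 n l (L2Space.abs_trunc_le n f) hl
      (hdisj n hfg)).symm
  have h2 : ∀ f ∈ Q'.domain, ∀ g ∈ Q'.domain, 0 ≤ f → 0 ≤ g →
      (∀ᵐ x ∂m, f x * g x = 0) → Q'.bilin f g = M.bilin f g := by
    intro f hf g hg hf0 hg0 hfg
    have hgf : ∀ᵐ x ∂m, g x * f x = 0 := hfg.mono fun x hx => by rw [mul_comm]; exact hx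
    rw [hq.bilin_comm hf hg, hqM.bilin_comm (hsub hf) (hsub hg)]
    refine tendsto_nhds_unique (hlim hQ' hg hf) ((hlim hM (hsub hg) (hsub hf)).congr fun n => ?_)
    have hn := (hQ'.trunc_mem n hg).1
    rw [hq.bilin_comm hn hf, hqM.bilin_comm (hsub hn) (hsub hf)]
    refine (h1 f hf _ hn hf0 (htr0 n hg0) n (L2Space.abs_trunc_le n g) ?_).symm
    exact (hdisj n hgf).mono fun x hx => by rw [mul_comm]; exact hx
  have hpart : ∀ {f g : L2Space m}, (∀ᵐ x ∂m, f x * g x = 0) →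
      ∀ᵐ x ∂m, (f ⊔ 0 : L2Space m) x * g x = 0 := by
    intro f g hfg
    filter_upwards [hfg, L2Space.coeFn_posPart' f] with x h1 h2
    rcases mul_eq_zero.1 h1 with h3 | h3
    · rw [h2, h3, max_self, zero_mul]
    · rw [h3, mul_zero]
  have hneg : ∀ {f g : L2Space m}, (∀ᵐ x ∂m, f x * g x = 0) →
      ∀ᵐ x ∂m, (-f : L2Space m) x * g x = 0 := by
    intro f g hfg
    filter_upwards [hfg, Lp.coeFn_neg f] with x h1 h2
    rw [h2, Pi.neg_apply, neg_mul, h1, neg_zero]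
  have hsymm : ∀ {f g : L2Space m}, (∀ᵐ x ∂m, f x * g x = 0) → ∀ᵐ x ∂m, g x * f x = 0 :=
    fun hfg => hfg.mono fun x hx => by rw [mul_comm]; exact hx
  have h3 : ∀ f ∈ Q'.domain, ∀ g ∈ Q'.domain, 0 ≤ f →
      (∀ᵐ x ∂m, f x * g x = 0) → Q'.bilin f g = M.bilin f g := by
    intro f hf g hg hf0 hfg
    have hp := (hQ'.posPart_mem hg).1
    have hn := hQ'.negPart_mem hg
    rw [← posPart_sub_negPart g, hq.bilin_sub_right hp hn hf,
      hqM.bilin_sub_right (hsub hp) (hsub hn) (hsub hf),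
      h2 f hf _ hp hf0 le_sup_right (hsymm (hpart (hsymm hfg))),
      h2 f hf _ hn hf0 le_sup_right (hsymm (hpart (hneg (hsymm hfg))))]
  intro f hf g hg hfg
  have hp := (hQ'.posPart_mem hf).1
  have hn := hQ'.negPart_mem hf
  rw [diff_bilin, sub_eq_zero, ← posPart_sub_negPart f, hq.bilin_sub_left hp hn hg,
    hqM.bilin_sub_left (hsub hp) (hsub hn) (hsub hg), h3 _ hp g hg le_sup_right (hpart hfg),
    h3 _ hn g hg le_sup_right (hpart (hneg hfg))]

end Local

end L2Form

/-! ### Forms between `Q` and its active main part -/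

open L2Form in
theorem theorem2p6 {X : Type*} [MeasurableSpace X] (m : Measure X) [SigmaFinite m]
    (Q Q' : L2Form m) (hQ : Q.IsDirichlet) (hQ' : Q'.IsDirichlet)
    (hkill : ∀ f ∈ Q.killingPart.domain, Q.killingPart.val f = 0) :
    (Q'.Dominates Q ∧ Q.mainPart.Dominates Q') ↔
      (Q'.domain ⊆ Q.mainPart.domain ∧ IsOrderIdealIn Q'.domain Q.mainPart.domain) ∧
      ((Q'.diff Q.mainPart).IsQuadratic ∧ (Q'.diff Q.mainPart).IsPositive ∧
        (Q'.diff Q.mainPart).IsLocal) ∧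
      Q'.IsExtension Q := by
  have hM := mainPart_isDirichlet hQ
  have hMext : Q.mainPart.IsExtension Q :=
    ⟨fun f hf => (mem_mainPart_of_mem_domain hQ hf).1,
      fun f hf => (sub_eq_zero.1 (hkill f hf)).symm⟩
  constructor
  · rintro ⟨hd1, hd2⟩
    have h1 := Dominates.resolventDominates hQ hQ' hd1
    have h2 := Dominates.resolventDominates hQ' hM hd2
    have hs1 := h1.domain_subset hQ hQ'
    have hs2 := h2.domain_subset hQ' hM
    have hpos : (Q'.diff Q.mainPart).IsPositive := fun f hf g hg hf0 hg0 => by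
      rw [diff_bilin, sub_nonneg]
      exact h2.bilin_le hQ' hM hf hg hf0 hg0
    -- On `D(Q)` the two dominations squeeze `Q'` between `Q` and the main part, which agree.
    have hext : Q'.IsExtension Q := by
      refine ⟨hs1, fun f hf => val_eq_of_bilin_eq hQ hQ'.isQuadratic hs1 ?_ hf⟩
      intro f hf g hg hf0 hg0
      refine le_antisymm (h1.bilin_le hQ hQ' hf hg hf0 hg0) ?_
      rw [← hMext.bilin_eq hQ.isQuadratic hf hg]
      exact h2.bilin_le hQ' hM (hs1 hf) (hs1 hg) hf0 hg0
    refine ⟨⟨hs2, h2.isOrderIdealIn hQ' hM⟩,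
      ⟨diff_isQuadratic hQ'.isQuadratic hM.isQuadratic hs2, hpos, ?_⟩, hext⟩
    refine diff_isLocal_of_bounded hQ' hM hs2 fun f hf g hg hf0 hg0 k l hk hl hfg => ?_
    exact le_antisymm (bilin_le_mainPart_of_disjoint hQ hQ' hext hs2 hf hg hf0 hg0 hk hl hfg)
      (h2.bilin_le hQ' hM hf hg hf0 hg0)
  · rintro ⟨⟨hsub, hideal⟩, ⟨-, hpos, -⟩, hext⟩
    refine ⟨(resolventDominates_of_ideal hQ hQ' hext.1 ?_ ?_).dominates hQ hQ',
      (resolventDominates_of_ideal hQ' hM hsub hideal ?_).dominates hQ' hM⟩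
    · exact fun f hf g hg hgf => domain_isOrderIdealIn_mainPart hQ f hf g (hsub hg) hgf
    · exact fun f hf g hg _ _ => (hext.bilin_eq hQ.isQuadratic hf hg).le
    · intro f hf g hg hf0 hg0
      have h := hpos f hf g hg hf0 hg0
      rwa [diff_bilin, sub_nonneg] at h
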